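/- **Setup.** Fix $r\in\mathbb N$, $r\ge 1$, and reals $p>0$, $s\ne 0$. For each $n\ge 1$ let $\beta=\beta_n\ge 0$ (e.g. a constant), let $m=m_n$, $l=l_n\ge 1$ be integers, and let $x^{(i)},\bar x^{(i)}\in\mathbb R^n$, $y^{(i)}\in\mathbb R^m$ ($1\le i\le l$) with $\|x^{(i)}\|_2=\|y^{(i)}\|_2=1$, and functions $f_{\bar x^{(i)}}:\mathbb R^n\to\mathbb R$ be given. Lifting parameters are vectors $\mathbf p=(p_0,\dots,p_{r+1})$, $\mathbf q=(q_0,\dots,q_{r+1})$, $\mathbf m=(m_0,\dots,m_{r+1})$ with $1=p_0\ge p_1\ge\dots\ge p_{r+1}=0$, $1=q_0\ge q_1\ge\dots\ge q_{r+1}=0$, $m_0=1$, $m_{r+1}=0$ and $m_k\neq 0$ for $1\le k\le r$. Put $a_k=\sqrt{p_{k-1}q_{k-1}-p_kq_k}$, $b_k=\sqrt{p_{k-1}-p_k}$, $c_k=\sqrt{q_{k-1}-q_k}$, $\omega(1;p)=1$ and $\omega(k;p)=p$ for $k\ge 2$. Let $G\in\mathbb R^{m\times n}$ and $\mathcal U_k=(u^{(4,k)},u^{(2,k)},h^{(k)})\in\mathbb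 R\times\mathbb R^m\times\mathbb R^n$ ($1\le k\le r+1$) have independent standard normal entries; $\mathbb E_{\mathcal U_k}$ is expectation over $\mathcal U_k$ only. For $t\in[0,1]$ let $$D_{0,S}^{(i_1,i_2,i_3)}=\sqrt t\,(y^{(i_2)})^TGx^{(i_1)}+\sqrt{1-t}\,\|x^{(i_1)}\|_2(y^{(i_2)})^T\sum_{k=1}^{r+1}b_ku^{(2,k)}+\sqrt{1-t}\,\|y^{(i_2)}\|_2\Big(\sum_{k=1}^{r+1}c_kh^{(k)}\Big)^Tx^{(i_1)}+f_{\bar x^{(i_3)}}(x^{(i_1)}),$$ $$D_0^{(i_1,i_2,i_3)}=D_{0,S}^{(i_1,i_2,i_3)}+\sqrt t\,\|x^{(i_1)}\|_2\|y^{(i_2)}\|_2\sum_{k=1}^{r+1}a_ku^{(4,k)}.$$ Let $A_{i_3}^{(i_1,i_2)}=e^{\beta D_0^{(i_1,i_2,i_3)}}$, $C_{i_3}^{(i_1)}=\sum_{i_2}A_{i_3}^{(i_1,i_2)}$, $Z_{i_3}=\sum_{i_1}(C_{i_3}^{(i_1)})^s$, $\zeta_1=\sum_{i_3}(\mathbb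 E_{\mathcal U_1}Z_{i_3}^{m_1})^p$, $\zeta_k=\mathbb E_{\mathcal U_k}\zeta_{k-1}^{m_k/m_{k-1}}$ for $k\ge2$, and $$\psi(\mathbf p,\mathbf q,\mathbf m,t)=\mathbb E_{G,\mathcal U_{r+1}}\frac{1}{p|s|\sqrt n\,m_r}\log\zeta_r .$$ Let $\psi_S$ be the same expression with $D_{0,S}$ in place of $D_0$. *Averages.* Let $\gamma_{00}(i_3)=(\mathbb E_{\mathcal U_1}Z_{i_3}^{m_1})^p/\zeta_1$, $\gamma_0(i_1,i_2;i_3)=\frac{(C_{i_3}^{(i_1)})^s}{Z_{i_3}}\frac{A_{i_3}^{(i_1,i_2)}}{C_{i_3}^{(i_1)}}$, $\Phi_1^{(i_3)}(\cdot)=\mathbb E_{\mathcal U_1}\big[\tfrac{Z_{i_3}^{m_1}}{\mathbb E_{\mathcal U_1}Z_{i_3}^{m_1}}(\cdot)\big]$ and $\Phi_k(\cdot)=\mathbb E_{\mathcal U_k}\big[\tfrac{\zeta_{k-1}^{m_k/m_{k-1}}}{\zeta_k}(\cdot)\big]$ for $k\ge 2$. Let $\langle\cdot\rangle_{\gamma_1}$,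 $\langle\cdot\rangle_{\gamma_{22}}$ be the averages of functions of $(i_1,i_2,p_1,p_2)$ with weights $\Phi_r\cdots\Phi_2\big(\gamma_{00}(i_3)\Phi_1^{(i_3)}(\gamma_0(i_1,i_2;i_3)\gamma_0(p_1,p_2;i_3))\big)$ and $\Phi_r\cdots\Phi_2\big(\gamma_{00}(i_3)\,\Phi_1^{(i_3)}\gamma_0(i_1,i_2;i_3)\,\Phi_1^{(i_3)}\gamma_0(p_1,p_2;i_3)\big)$, and for $k\ge1$ let $\langle\cdot\rangle_{\gamma_{k+1}}$ be that with weights $\Phi_r\cdots\Phi_{k+1}\big(w_k(i_1,i_2,i_3)\,w_k(p_1,p_2,p_3)\big)$, $w_k(i_1,i_2,i_3)=\Phi_k\cdots\Phi_2\,\gamma_{00}(i_3)\Phi_1^{(i_3)}\gamma_0(i_1,i_2;i_3)$. Write $\mathbb E=\mathbb E_{G,\mathcal U_{r+1}}$, $N_x=\|x^{(i_1)}\|_2\|x^{(p_1)}\|_2$, $N_y=\|y^{(i_2)}\|_2\|y^{(p_2)}\|_2$, $R_x=(x^{(p_1)})^Tx^{(i_1)}$, $R_y=(y^{(p_2)})^Ty^{(i_2)}$.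 Define $$\psi_1=-\frac{\mathrm{sign}(s)s\beta^2}{2\sqrt n}\sum_{k=1}^{r+1}\big(p_{k-1}q_{k-1}\mathbb E\langle N_xN_y\rangle_{\gamma_k}-p_kq_k\mathbb E\langle N_xN_y\rangle_{\gamma_{k+1}}\big)m_k\,\omega(k;p)+\psi,$$ $$\phi_k=-s(m_{k-1}-m_k)\omega(k;p)\mathbb E\langle(p_{k-1}N_x-R_x)(q_{k-1}N_y-R_y)\rangle_{\gamma_k},\qquad \phi_{22}=-sm_1(1-p)\mathbb E\langle(p_1N_x-R_x)(q_1N_y-R_y)\rangle_{\gamma_{22}}.$$ **Hypotheses.** For each $n$ let $\bar{\mathbf p}(t),\bar{\mathbf q}(t),\bar{\mathbf m}(t)$, $t\in[0,1]$, be lifting parameters as above, continuous on $[0,1]$ and differentiable on $(0,1)$, such that for all $t\in(0,1)$ the following stationarity system holds: with $c=\frac{\mathrm{sign}(s)s\beta^2}{2\sqrt n}$, $$\partial_{p_1}\psi_1=(1-t)c\big[(m_1-m_2)p\,\mathbb E\langle N_x(q_1N_y-R_y)\rangle_{\gamma_2}-m_1(p-1)\mathbb E\langle N_x(q_1N_y-R_y)\rangle_{\gamma_{22}}\big]=0,$$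 $$\partial_{p_k}\psi_1=(1-t)c\,(m_k-m_{k+1})p\,\mathbb E\langle N_x(q_kN_y-R_y)\rangle_{\gamma_{k+1}}=0\quad(2\le k\le r),$$ the same equations for $\partial_{q_k}\psi_1$, with the roles of $(N_x,\,q_kN_y-R_y)$ taken by $(N_y,\,p_kN_x-R_x)$, and $\partial_{m_k}\psi_1=0$ for $2\le k\le r$ (where some $p_{k-1}-p_k$ or $q_{k-1}-q_k$ vanish, the middle expressions are the ones meant). Further, $\bar m_1$ is constant in $t$ (or also $\partial_{m_1}\psi_1=0$ on $(0,1)$), and $\frac{\beta_n^2}{\sqrt n}(1-\bar m_1(t))\to0$ (e.g. $\bar m_1=1$, or $\bar m_1\to1$ uniformly in $t$ with $\beta_n^2/\sqrt n$ bounded). Finally, $\bar p_k,\bar q_k$ are concentrating points of the overlaps: $$\frac{\beta_n^2}{\sqrt n}|\bar m_k-\bar m_{k+1}|\,\mathbb E\langle(\bar p_kN_x-R_x)^2+(\bar q_kN_y-R_y)^2\rangle_{\gamma_{k+1}}\to0\quad(1\le k\le r),$$ and, for $k=1$, also $\frac{\beta_n^2}{\sqrt n}|\bar m_1(1-p)|\,\mathbb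 E\langle(\bar p_1N_x-R_x)^2+(\bar q_1N_y-R_y)^2\rangle_{\gamma_{22}}\to0$; or, for any of the $k$, instead of this, they are such that $\frac{\beta_n^2}{\sqrt n}\phi_{k+1}\to0$ if $k\ge2$, and $\frac{\beta_n^2}{\sqrt n}(\phi_2+\phi_{22})\to0$ if $k=1$ (in particular if these quantities are $0$). All these limits are as $n\to\infty$, for each $t\in(0,1)$, with a bound, for all large $n$, that is uniform in $t\in(0,1)$. **Conclusion.** (i) For all $t\in[0,1]$, $$\lim_{n\to\infty}\psi_1(\bar{\mathbf p}(t),\bar{\mathbf q}(t),\bar{\mathbf m}(t),t)=\lim_{n\to\infty}\psi_1(\bar{\mathbf p}(0),\bar{\mathbf q}(0),\bar{\mathbf m}(0),0)=\lim_{n\to\infty}\psi_1(\bar{\mathbf p}(1),\bar{\mathbf q}(1),\bar{\mathbf m}(1),1).$$ (ii) For $t_0=0$ and for $t_0=1$, and every $n\ge1$, $$\psi_1(\bar{\mathbf p}(t_0),\bar{\mathbf q}(t_0),\bar{\mathbf m}(t_0),t_0)=-\frac{\mathrm{sign}(s)s\beta^2}{2\sqrt n}\sum_{k=1}^{r+1}\big(\bar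 p_{k-1}(t_0)\bar q_{k-1}(t_0)-\bar p_k(t_0)\bar q_k(t_0)\big)\bar m_k(t_0)\omega(k;p)+\psi(\bar{\mathbf p}(t_0),\bar{\mathbf q}(t_0),\bar{\mathbf m}(t_0),t_0).$$ (iii) $$\lim_{n\to\infty}\psi_S(\bar{\mathbf p}(1),\bar{\mathbf q}(1),\bar{\mathbf m}(1),1)=-\lim_{n\to\infty}\frac{\mathrm{sign}(s)s\beta^2}{2\sqrt n}\sum_{k=1}^{r+1}\big(\bar p_{k-1}(0)\bar q_{k-1}(0)-\bar p_k(0)\bar q_k(0)\big)\bar m_k(0)\omega(k;p)+\lim_{n\to\infty}\psi_S(\bar{\mathbf p}(0),\bar{\mathbf q}(0),\bar{\mathbf m}(0),0).$$ In (i) and (iii) equality of limits means: the difference of the two sides, taken before the limits, tends to $0$; in (i) the three limits exist together and agree, and in (iii) the left limit exists and equals the right side whenever the two limits on the right exist. -/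

import Mathlib

open MeasureTheory ProbabilityTheory Filter Topology
open scoped Matrix

noncomputable section

/-- The data of a bilinearly indexed random process in dimension `n`: the finite families
`x, xbar` in `ℝⁿ` and `y` in `ℝᵐ` (all indexed by `Fin l`), the functions `f xbar : ℝⁿ → ℝ`
and the real scalars `β, p, s`. -/
structure Blirp (n : ℕ) where
  m : ℕ
  l : ℕ
  x : Fin l → EuclideanSpace ℝ (Fin n)
  xbar : Fin l → EuclideanSpace ℝ (Fin n)
  y : Fin l → EuclideanSpace ℝ (Fin m)
  f : EuclideanSpace ℝ (Fin n) → EuclideanSpace ℝ (Fin n) → ℝ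
  β : ℝ
  p : ℝ
  s : ℝ

/-- The three vectors of lifting parameters; only the entries `0, …, r + 1` are used. -/
structure Lifting where
  p : ℕ → ℝ
  q : ℕ → ℝ
  m : ℕ → ℝ

/-- Constraints on the lifting parameters at level `r`. -/
structure Lifting.Admissible (Λ : Lifting) (r : ℕ) : Prop where
  p_zero : Λ.p 0 = 1
  q_zero : Λ.q 0 = 1
  m_zero : Λ.m 0 = 1
  p_last : Λ.p (r + 1) = 0
  q_last : Λ.q (r + 1) = 0
  m_last : Λ.m (r + 1) = 0
  p_anti : ∀ k ≤ r, Λ.p (k + 1) ≤ Λ.p k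
  q_anti : ∀ k ≤ r, Λ.q (k + 1) ≤ Λ.q k
  m_ne : ∀ k, 1 ≤ k → k ≤ r → Λ.m k ≠ 0

/-- `ω(k; p)`: equal to `1` for `k = 1` and to `p` otherwise. -/
def omegaWeight (k : ℕ) (p : ℝ) : ℝ := if k = 1 then 1 else p

namespace Blirp

variable {n : ℕ}

/-- A value of `U_k = (u^(4,k), u^(2,k), h^(k))`. -/
abbrev Level (B : Blirp n) : Type := ℝ × (Fin B.m → ℝ) × (Fin n → ℝ)

/-- A value of all the `U_k`; `U_k` is the entry number `k`, for `1 ≤ k ≤ r + 1`. -/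
abbrev Noise (B : Blirp n) : Type := ℕ → B.Level

/-- The law of `U_k`: independent standard normal entries. -/
def levelLaw (B : Blirp n) : Measure B.Level :=
  (gaussianReal 0 1).prod
    ((Measure.pi fun _ : Fin B.m => gaussianReal 0 1).prod
      (Measure.pi fun _ : Fin n => gaussianReal 0 1))

/-- The law of `G`: independent standard normal entries. -/
def matrixLaw (B : Blirp n) : Measure (Fin B.m → Fin n → ℝ) :=
  Measure.pi fun _ : Fin B.m => Measure.pi fun _ : Fin n => gaussianReal 0 1

/-- The conditional expectation `E_{U_k}`: integrate out `U_k`, all the rest being fixed. -/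
def EU (B : Blirp n) (k : ℕ) (F : B.Noise → ℝ) : B.Noise → ℝ :=
  fun U => ∫ u, F (Function.update U k u) ∂B.levelLaw

/-- `E_{G, U_{r+1}}` of a quantity from which `U_1, …, U_r` have been integrated out already
(so that the base point `0` plays no role). -/
def EGU (B : Blirp n) (r : ℕ) (F : (Fin B.m → Fin n → ℝ) → B.Noise → ℝ) : ℝ :=
  ∫ G, B.EU (r + 1) (F G) 0 ∂B.matrixLaw

/-- The simplified exponent `D_{0,S}^{(i₁,i₂,i₃)}`, without the `u^(4,k)`. -/
def D0S (B : Blirp n) (r : ℕ) (Λ : Lifting) (t : ℝ) (G : Fin B.m → Fin n → ℝ)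
    (U : B.Noise) (i₁ i₂ i₃ : Fin B.l) : ℝ :=
  √t * ((B.y i₂).ofLp ⬝ᵥ (Matrix.of G *ᵥ (B.x i₁).ofLp))
  + √(1 - t) * ‖B.x i₁‖ *
      ((B.y i₂).ofLp ⬝ᵥ ∑ k ∈ Finset.Icc 1 (r + 1), √(Λ.p (k - 1) - Λ.p k) • (U k).2.1)
  + √(1 - t) * ‖B.y i₂‖ *
      ((∑ k ∈ Finset.Icc 1 (r + 1), √(Λ.q (k - 1) - Λ.q k) • (U k).2.2) ⬝ᵥ (B.x i₁).ofLp)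
  + B.f (B.xbar i₃) (B.x i₁)

/-- The full exponent `D_0^{(i₁,i₂,i₃)}`. -/
def D0 (B : Blirp n) (r : ℕ) (Λ : Lifting) (t : ℝ) (G : Fin B.m → Fin n → ℝ)
    (U : B.Noise) (i₁ i₂ i₃ : Fin B.l) : ℝ :=
  B.D0S r Λ t G U i₁ i₂ i₃
  + √t * ‖B.x i₁‖ * ‖B.y i₂‖ *
      ∑ k ∈ Finset.Icc 1 (r + 1),
        √(Λ.p (k - 1) * Λ.q (k - 1) - Λ.p k * Λ.q k) * (U k).1

section Gibbs

/-! In this section the matrix `G` is fixed, `M` is the vector of the exponents `m_k`, and `D` is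
the exponent, as a function of the remaining randomness and of `i₁, i₂, i₃`. -/

variable (B : Blirp n) (M : ℕ → ℝ) (D : B.Noise → Fin B.l → Fin B.l → Fin B.l → ℝ)

def A (i₁ i₂ i₃ : Fin B.l) (U : B.Noise) : ℝ := Real.exp (B.β * D U i₁ i₂ i₃)

def C (i₁ i₃ : Fin B.l) (U : B.Noise) : ℝ := ∑ i₂, B.A D i₁ i₂ i₃ U

def Z (i₃ : Fin B.l) (U : B.Noise) : ℝ := ∑ i₁, B.C D i₁ i₃ U ^ B.s

/-- `ζ_1 = ∑_{i₃} (E_{U_1} Z_{i₃}^{m_1})^p` and `ζ_k = E_{U_k} ζ_{k-1}^{m_k / m_{k-1}}` for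
`k ≥ 2` (the entry number `0` is not used). -/
def zeta : ℕ → B.Noise → ℝ
  | 0 => fun _ => 1
  | 1 => fun U => ∑ i₃, B.EU 1 (fun V => B.Z D i₃ V ^ M 1) U ^ B.p
  | k + 2 => B.EU (k + 2) fun V => zeta (k + 1) V ^ (M (k + 2) / M (k + 1))

/-- The operator `Φ_{U_1}^{(i₃)}`. -/
def Phi1 (i₃ : Fin B.l) (F : B.Noise → ℝ) : B.Noise → ℝ :=
  B.EU 1 fun U => B.Z D i₃ U ^ M 1 / B.EU 1 (fun V => B.Z D i₃ V ^ M 1) U * F U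

/-- The operator `Φ_{U_k}`, `k ≥ 2`. -/
def Phi (k : ℕ) (F : B.Noise → ℝ) : B.Noise → ℝ :=
  B.EU k fun U => B.zeta M D (k - 1) U ^ (M k / M (k - 1)) / B.zeta M D k U * F U

/-- The composition `Φ_{U_k} ⋯ Φ_{U_j}` (`Φ_{U_j}` acts first), the identity if `k < j`. -/
def PhiProd (j : ℕ) (F : B.Noise → ℝ) : ℕ → B.Noise → ℝ
  | 0 => F
  | k + 1 => if j ≤ k + 1 then B.Phi M D (k + 1) (PhiProd j F k) else F

def gamma00 (i₃ : Fin B.l) (U : B.Noise) : ℝ :=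
  B.EU 1 (fun V => B.Z D i₃ V ^ M 1) U ^ B.p /
    ∑ j₃, B.EU 1 (fun V => B.Z D j₃ V ^ M 1) U ^ B.p

def gamma0 (i₁ i₂ i₃ : Fin B.l) (U : B.Noise) : ℝ :=
  B.C D i₁ i₃ U ^ B.s / B.Z D i₃ U * (B.A D i₁ i₂ i₃ U / B.C D i₁ i₃ U)

/-- The weight of one replica, `Φ_{U_k} ⋯ Φ_{U_2} γ₀₀(i₃) Φ_{U_1}^{(i₃)} γ₀(i₁,i₂;i₃)`, `k ≥ 1`. -/
def replica (k : ℕ) (i₁ i₂ i₃ : Fin B.l) : B.Noise → ℝ :=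
  B.PhiProd M D 2 (fun U => B.gamma00 M D i₃ U * B.Phi1 M D i₃ (B.gamma0 D i₁ i₂ i₃) U) k

/-- The measure `γ_1^{(r)}`. -/
def gamma1 (r : ℕ) (i₁ i₂ p₁ p₂ i₃ : Fin B.l) : B.Noise → ℝ :=
  B.PhiProd M D 2 (fun U => B.gamma00 M D i₃ U *
    B.Phi1 M D i₃ (fun V => B.gamma0 D i₁ i₂ i₃ V * B.gamma0 D p₁ p₂ i₃ V) U) r

/-- The measure `γ_j^{(r)}`, `j ≥ 2`; for `j = 2` this is `γ_{21}^{(r)}`. -/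
def gammaGe2 (r j : ℕ) (i₁ i₂ i₃ p₁ p₂ p₃ : Fin B.l) : B.Noise → ℝ :=
  B.PhiProd M D j (fun U => B.replica M D (j - 1) i₁ i₂ i₃ U *
    B.replica M D (j - 1) p₁ p₂ p₃ U) r

/-- The measure `γ_{22}^{(r)}`. -/
def gamma22 (r : ℕ) (i₁ i₂ p₁ p₂ i₃ : Fin B.l) : B.Noise → ℝ :=
  B.PhiProd M D 2 (fun U => B.gamma00 M D i₃ U *
    (B.Phi1 M D i₃ (B.gamma0 D i₁ i₂ i₃) U * B.Phi1 M D i₃ (B.gamma0 D p₁ p₂ i₃) U)) r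

/-- The average `⟨F(i₁,i₂,p₁,p₂)⟩` with respect to `γ_j^{(r)}`, `j ≥ 1`. -/
def avg (r j : ℕ) (F : Fin B.l → Fin B.l → Fin B.l → Fin B.l → ℝ) (U : B.Noise) : ℝ :=
  if j = 1 then
    ∑ i₁, ∑ i₂, ∑ p₁, ∑ p₂, ∑ i₃, B.gamma1 M D r i₁ i₂ p₁ p₂ i₃ U * F i₁ i₂ p₁ p₂
  else
    ∑ i₁, ∑ i₂, ∑ i₃, ∑ p₁, ∑ p₂, ∑ p₃,
      B.gammaGe2 M D r j i₁ i₂ i₃ p₁ p₂ p₃ U * F i₁ i₂ p₁ p₂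

/-- The average `⟨F(i₁,i₂,p₁,p₂)⟩` with respect to `γ_{22}^{(r)}`. -/
def avg22 (r : ℕ) (F : Fin B.l → Fin B.l → Fin B.l → Fin B.l → ℝ) (U : B.Noise) : ℝ :=
  ∑ i₁, ∑ i₂, ∑ p₁, ∑ p₂, ∑ i₃, B.gamma22 M D r i₁ i₂ p₁ p₂ i₃ U * F i₁ i₂ p₁ p₂

end Gibbs

variable (B : Blirp n) (r : ℕ) (Λ : Lifting) (t : ℝ)

/-- The interpolating function `ψ(p, q, m, t)`. -/
def psi : ℝ :=
  B.EGU r fun G U =>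
    1 / (B.p * |B.s| * √n * Λ.m r) * Real.log (B.zeta Λ.m (B.D0 r Λ t G) r U)

/-- The function `ψ_S(p, q, m, t)`: the same, without the terms in `u^(4,k)`. -/
def psiS : ℝ :=
  B.EGU r fun G U =>
    1 / (B.p * |B.s| * √n * Λ.m r) * Real.log (B.zeta Λ.m (B.D0S r Λ t G) r U)

/-- `E_{G,U_{r+1}} ⟨F⟩` with respect to `γ_j^{(r)}`, `j ≥ 1`. -/
def meanAvg (j : ℕ) (F : Fin B.l → Fin B.l → Fin B.l → Fin B.l → ℝ) : ℝ :=
  B.EGU r fun G => B.avg Λ.m (B.D0 r Λ t G) r j F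

/-- `E_{G,U_{r+1}} ⟨F⟩` with respect to `γ_{22}^{(r)}`. -/
def meanAvg22 (F : Fin B.l → Fin B.l → Fin B.l → Fin B.l → ℝ) : ℝ :=
  B.EGU r fun G => B.avg22 Λ.m (B.D0 r Λ t G) r F

/-- `‖x^{(i₁)}‖ ‖x^{(p₁)}‖`. -/
def normX (i₁ p₁ : Fin B.l) : ℝ := ‖B.x i₁‖ * ‖B.x p₁‖

/-- `‖y^{(i₂)}‖ ‖y^{(p₂)}‖`. -/
def normY (i₂ p₂ : Fin B.l) : ℝ := ‖B.y i₂‖ * ‖B.y p₂‖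

/-- `a ‖x^{(i₁)}‖ ‖x^{(p₁)}‖ - (x^{(p₁)})ᵀ x^{(i₁)}`. -/
def devX (a : ℝ) (i₁ p₁ : Fin B.l) : ℝ := a * B.normX i₁ p₁ - inner ℝ (B.x p₁) (B.x i₁)

/-- `a ‖y^{(i₂)}‖ ‖y^{(p₂)}‖ - (y^{(p₂)})ᵀ y^{(i₂)}`. -/
def devY (a : ℝ) (i₂ p₂ : Fin B.l) : ℝ := a * B.normY i₂ p₂ - inner ℝ (B.y p₂) (B.y i₂)

/-- The constant `sign(s) s β² / (2 √n)`. -/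
def pref : ℝ := Real.sign B.s * B.s * B.β ^ 2 / (2 * √n)

/-- The function `ψ_1(p, q, m, t)`. -/
def psi1 : ℝ :=
  -B.pref * ∑ k ∈ Finset.Icc 1 (r + 1),
      (Λ.p (k - 1) * Λ.q (k - 1) *
          B.meanAvg r Λ t k (fun i₁ i₂ p₁ p₂ => B.normX i₁ p₁ * B.normY i₂ p₂)
        - Λ.p k * Λ.q k *
          B.meanAvg r Λ t (k + 1) (fun i₁ i₂ p₁ p₂ => B.normX i₁ p₁ * B.normY i₂ p₂))
      * Λ.m k * omegaWeight k B.p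
    + B.psi r Λ t

/-- The explicit term
`(sign(s) s β² / (2 √n)) ∑_{k=1}^{r+1} (p_{k-1} q_{k-1} - p_k q_k) m_k ω(k; p)`. -/
def correction : ℝ :=
  B.pref * ∑ k ∈ Finset.Icc 1 (r + 1),
    (Λ.p (k - 1) * Λ.q (k - 1) - Λ.p k * Λ.q k) * Λ.m k * omegaWeight k B.p

/-- `φ_k^{(r)}`, `1 ≤ k ≤ r + 1`. -/
def phi (k : ℕ) : ℝ :=
  -B.s * (Λ.m (k - 1) - Λ.m k) * omegaWeight k B.p *
    B.meanAvg r Λ t k (fun i₁ i₂ p₁ p₂ =>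
      B.devX (Λ.p (k - 1)) i₁ p₁ * B.devY (Λ.q (k - 1)) i₂ p₂)

/-- `φ_{22}^{(r)}`. -/
def phi22 : ℝ :=
  -B.s * Λ.m 1 * (1 - B.p) *
    B.meanAvg22 r Λ t (fun i₁ i₂ p₁ p₂ => B.devX (Λ.p 1) i₁ p₁ * B.devY (Λ.q 1) i₂ p₂)

/-- `m_k` is stationary: `∂ψ_1(p, q, m, t) / ∂m_k = 0`. -/
def StationaryM (k : ℕ) : Prop :=
  HasDerivAt (fun μ => B.psi1 r { Λ with m := Function.update Λ.m k μ } t) 0 (Λ.m k)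

/-- The system of stationarity equations for `p_k, q_k` (`1 ≤ k ≤ r`) and `m_k` (`2 ≤ k ≤ r`).
The left hand sides for `p_k` and `q_k` are the partial derivatives of `ψ_1` (for families of
constant magnitude) in the form in which they make sense also where some of the
`p_{k-1} - p_k` or `q_{k-1} - q_k` vanish. -/
structure Stationary : Prop where
  p_one :
    (1 - t) * (Λ.m 1 - Λ.m 2) * B.p * B.pref *
        B.meanAvg r Λ t 2 (fun i₁ i₂ p₁ p₂ => B.normX i₁ p₁ * B.devY (Λ.q 1) i₂ p₂)
      - (1 - t) * Λ.m 1 * (B.p - 1) * B.pref *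
        B.meanAvg22 r Λ t (fun i₁ i₂ p₁ p₂ => B.normX i₁ p₁ * B.devY (Λ.q 1) i₂ p₂) = 0
  p_gt_one : ∀ k, 2 ≤ k → k ≤ r →
    (1 - t) * (Λ.m k - Λ.m (k + 1)) * B.p * B.pref *
        B.meanAvg r Λ t (k + 1) (fun i₁ i₂ p₁ p₂ => B.normX i₁ p₁ * B.devY (Λ.q k) i₂ p₂) = 0
  q_one :
    (1 - t) * (Λ.m 1 - Λ.m 2) * B.p * B.pref *
        B.meanAvg r Λ t 2 (fun i₁ i₂ p₁ p₂ => B.normY i₂ p₂ * B.devX (Λ.p 1) i₁ p₁)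
      - (1 - t) * Λ.m 1 * (B.p - 1) * B.pref *
        B.meanAvg22 r Λ t (fun i₁ i₂ p₁ p₂ => B.normY i₂ p₂ * B.devX (Λ.p 1) i₁ p₁) = 0
  q_gt_one : ∀ k, 2 ≤ k → k ≤ r →
    (1 - t) * (Λ.m k - Λ.m (k + 1)) * B.p * B.pref *
        B.meanAvg r Λ t (k + 1) (fun i₁ i₂ p₁ p₂ => B.normY i₂ p₂ * B.devX (Λ.p k) i₁ p₁) = 0
  m_gt_one : ∀ k, 2 ≤ k → k ≤ r → B.StationaryM r Λ t k

/-- `(β² / √n) |m_k - m_{k+1}| E⟨(p_k ‖x‖‖x'‖ - x'ᵀx)² + (q_k ‖y‖‖y'‖ - y'ᵀy)²⟩`, the average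
being with respect to `γ_{k+1}^{(r)}`: the scaled spread of the overlaps about `p_k, q_k`. -/
def spread (k : ℕ) : ℝ :=
  B.β ^ 2 / √n * |Λ.m k - Λ.m (k + 1)| *
    B.meanAvg r Λ t (k + 1) (fun i₁ i₂ p₁ p₂ =>
      B.devX (Λ.p k) i₁ p₁ ^ 2 + B.devY (Λ.q k) i₂ p₂ ^ 2)

/-- The scaled spread of the overlaps about `p_1, q_1` with respect to `γ_{22}^{(r)}`. -/
def spread22 : ℝ :=
  B.β ^ 2 / √n * |Λ.m 1 * (1 - B.p)| *
    B.meanAvg22 r Λ t (fun i₁ i₂ p₁ p₂ =>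
      B.devX (Λ.p 1) i₁ p₁ ^ 2 + B.devY (Λ.q 1) i₂ p₂ ^ 2)

end Blirp

/-- `a n t → 0` as `n → ∞` for every `t ∈ (0,1)`, boundedly in `t` (this is weaker than uniform
convergence on `(0,1)`). -/
def VanishesBoundedly (a : ℕ → ℝ → ℝ) : Prop :=
  (∀ t ∈ Set.Ioo (0 : ℝ) 1, Tendsto (fun n => a n t) atTop (𝓝 0)) ∧
    ∃ K : ℝ, ∀ᶠ n in atTop, ∀ t ∈ Set.Ioo (0 : ℝ) 1, |a n t| ≤ K

/-- The complete stationarized fully lifted frame: for every dimension `n ≥ 1` the curve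
`t ↦ Λ n t` of lifting parameters on `[0,1]` is regular and solves the stationarity system,
`m_1` is held fixed along the curve (or is stationary, too) and is `1` in the limit, and
`p_k, q_k` are concentrating points of the overlaps, or make the terms `φ_{k+1}` vanish. -/
structure CompleteFrame (r : ℕ) (B : (n : ℕ) → Blirp n) (Λ : ℕ → ℝ → Lifting) : Prop where
  admissible : ∀ n, 1 ≤ n → ∀ t ∈ Set.Icc (0 : ℝ) 1, (Λ n t).Admissible r
  continuous : ∀ n, 1 ≤ n → ∀ k, 1 ≤ k → k ≤ r →
    ContinuousOn (fun t => (Λ n t).p k) (Set.Icc 0 1) ∧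
    ContinuousOn (fun t => (Λ n t).q k) (Set.Icc 0 1) ∧
    ContinuousOn (fun t => (Λ n t).m k) (Set.Icc 0 1)
  differentiable : ∀ n, 1 ≤ n → ∀ k, 1 ≤ k → k ≤ r →
    DifferentiableOn ℝ (fun t => (Λ n t).p k) (Set.Ioo 0 1) ∧
    DifferentiableOn ℝ (fun t => (Λ n t).q k) (Set.Ioo 0 1) ∧
    DifferentiableOn ℝ (fun t => (Λ n t).m k) (Set.Ioo 0 1)
  stationary : ∀ n, 1 ≤ n → ∀ t ∈ Set.Ioo (0 : ℝ) 1, (B n).Stationary r (Λ n t) t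
  m_one : ∀ n, 1 ≤ n →
    (∀ t ∈ Set.Icc (0 : ℝ) 1, (Λ n t).m 1 = (Λ n 0).m 1) ∨
    (∀ t ∈ Set.Ioo (0 : ℝ) 1, (B n).StationaryM r (Λ n t) t 1)
  m_one_limit : VanishesBoundedly fun n t => (B n).β ^ 2 / √n * (1 - (Λ n t).m 1)
  concentration_one :
    (VanishesBoundedly (fun n t => (B n).spread r (Λ n t) t 1) ∧
      VanishesBoundedly (fun n t => (B n).spread22 r (Λ n t) t)) ∨
    VanishesBoundedly (fun n t => (B n).β ^ 2 / √n *
      ((B n).phi r (Λ n t) t 2 + (B n).phi22 r (Λ n t) t))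
  concentration_gt_one : ∀ k, 2 ≤ k → k ≤ r →
    VanishesBoundedly (fun n t => (B n).spread r (Λ n t) t k) ∨
    VanishesBoundedly (fun n t => (B n).β ^ 2 / √n * (B n).phi r (Λ n t) t (k + 1))

end

open MeasureTheory ProbabilityTheory Filter Topology
open scoped Matrix

noncomputable section

set_option linter.unusedSectionVars false

namespace Interp

/-! ### Functions of exponential growth and their limits -/

section Growth

variable {E : Type*} [NormedAddCommGroup E]

/-! Fix `n`. All vectors have norm one, so the exponent is a deterministic term plus a centred
Gaussian field `v i₁ i₂`, to which `G` and each `U_k` contribute independent summands. Integrating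
out `U_k` is therefore a convolution (`smear`). The quantities `m_k⁻¹ log ζ_k` become functions of
the field, built by a recursion of free energies (`freeX`); the operators `Φ` become expectations
under exponentially tilted laws (`tilt`), and every replica average is obtained by applying such
operators to one function of the field (`avg_one_eq`, `avg_ge_two_eq`, `avg22_eq`).

A Gaussian vector whose variance moves with `t` acts as a heat flow: the derivative is half the
derivative of the covariance, contracted with second derivatives (`heat_gaussian`). The parameter is
the variance and not its root, so this stays valid where some `p_{k-1} - p_k` or `q_{k-1} - q_k`
vanishes. A logarithm of a tilted expectation adds a variance of first derivatives at each level;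
summation by parts over the levels (`freeXDeriv_add_tail`) collects these terms. In the result
(`hasDerivAt_meanFree`) two-replica averages carry the coefficients `(m_{k+1} - m_k) p`, `-(1 -
m_1)` and `-m_1 (1 - p)`, and the averaged function is half the derivative of the covariance
accumulated over the outer levels and `G`, `t p_k q_k + (1 - t)(p_k R_y + q_k R_x) + t R_x R_y`.

The derivative of this covariance is `(p_k - R_x)(q_k - R_y) - (1 - t) p_k' (q_k - R_y) - (1 - t)
q_k' (p_k - R_x) + (p_k q_k)'`. The last summand is constant on replicas and cancels against the
derivative of the explicit correction in `ψ₁`. The terms in `p_k'`, `q_k'` vanish by stationarity in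
the overlaps, those in `m_k'` by stationarity in the exponents (`Standing.expDeriv_eq`) or because
`m_1` is fixed. What remains is the derivative of `ψ₁` as a multiple of `φ_1 + φ_22 + ∑ φ_{k+1}`
(`StationaryCurve.hasDerivAt_psi1`). The term `φ_1` carries the factor `1 - m_1`; the others are
bounded by the spread of the overlaps, or vanish by assumption (`CompleteFrame.vanishes`). The
derivative tends to zero boundedly on the open interval, and integrating it
(`VanishesBoundedly.tendsto_sub`) gives the first claim. The explicit form at the ends holds because
the averages are normalized (`Standing.psi1_eq`).

For `ψ_S`, the terms in `u^(4,k)` shift the whole field by a constant and so contribute exactly `t`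
times the correction (`Standing.meanFree_parOf`). Hence `ψ_S = ψ₁` at `t = 1` and `ψ_S = ψ` at `t =
0`, and the third claim follows from the first.

The analysis is organized so that limits and derivatives pass through sums, products, `exp`, `log`
and Gaussian averages: functions of the field have at most exponential growth, and convergence is
joint in parameter and base point. -/

lemma growth_mono {K K' : ℝ} (h : K ≤ K') (v : E) :
    Real.exp (K * (1 + ‖v‖)) ≤ Real.exp (K' * (1 + ‖v‖)) := by
  gcongr

lemma le_growth {K : ℝ} (h : 0 ≤ K) (v : E) : K ≤ Real.exp (K * (1 + ‖v‖)) := by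
  have h1 := Real.add_one_le_exp (K * (1 + ‖v‖))
  nlinarith [norm_nonneg v, mul_nonneg h (norm_nonneg v)]

lemma add_growth (K K' : ℝ) (v : E) :
    Real.exp (K * (1 + ‖v‖)) + Real.exp (K' * (1 + ‖v‖)) ≤
      Real.exp ((max K K' + 1) * (1 + ‖v‖)) := by
  have h1 := growth_mono (le_max_left K K') v
  have h2 := growth_mono (le_max_right K K') v
  -- The extra `1` in the constant of the bound pays for the factor two of a sum of two terms.
  have h3 : (2 : ℝ) ≤ Real.exp (1 + ‖v‖) := by
    have := Real.add_one_le_exp (1 + ‖v‖)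
    linarith [norm_nonneg v]
  rw [add_mul, Real.exp_add, one_mul]
  nlinarith [Real.exp_pos (max K K' * (1 + ‖v‖))]

/-- Continuous functions of at most exponential growth. -/
structure TameFn (f : E → ℝ) : Prop where
  cont : Continuous f
  bound : ∃ K : ℝ, ∀ v, |f v| ≤ Real.exp (K * (1 + ‖v‖))

/-- `F τ → f` along `l`, locally uniformly in the sense of joint limits, all the `F τ` being
continuous and with a common exponential bound. -/
structure TameLim (l : Filter ℝ) (F : ℝ → E → ℝ) (f : E → ℝ) : Prop where
  bound : ∃ K : ℝ, ∀ᶠ τ in l, ∀ v, |F τ v| ≤ Real.exp (K * (1 + ‖v‖))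
  cont : ∀ᶠ τ in l, Continuous (F τ)
  lim : ∀ v, Tendsto (fun q : ℝ × E => F q.1 q.2) (l ×ˢ 𝓝 v) (𝓝 (f v))

/-- At most linear growth, uniformly along `l`. -/
def LinGrowth (l : Filter ℝ) (F : ℝ → E → ℝ) : Prop :=
  ∃ K : ℝ, ∀ᶠ τ in l, ∀ v, |F τ v| ≤ K * (1 + ‖v‖)

namespace TameLim

variable {l : Filter ℝ} {F G : ℝ → E → ℝ} {f g : E → ℝ}

lemma tendsto (h : TameLim l F f) (v : E) : Tendsto (fun τ => F τ v) l (𝓝 (f v)) :=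
  (h.lim v).comp (tendsto_id.prodMk tendsto_const_nhds)

/-- Continuity comes from the joint limit alone: `F τ v` stays in a given closed neighbourhood of `f
v₀` for all `v` near `v₀` at once, and the limit in `τ` at fixed `v` stays there too. -/
lemma limit [l.NeBot] (h : TameLim l F f) : TameFn f := by
  refine ⟨continuous_iff_continuousAt.2 fun v₀ => ?_, ?_⟩
  · refine (closed_nhds_basis (f v₀)).tendsto_right_iff.2 fun U hU => ?_
    obtain ⟨A, hA, N, hN, hAN⟩ := mem_prod_iff.1 (h.lim v₀ hU.1)
    filter_upwards [hN] with v hv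
    refine hU.2.mem_of_tendsto (h.tendsto v) ?_
    filter_upwards [hA] with τ hτ
    exact hAN (Set.mk_mem_prod hτ hv)
  · obtain ⟨K, hK⟩ := h.bound
    refine ⟨K, fun v => ?_⟩
    exact le_of_tendsto (h.tendsto v).abs (hK.mono fun τ hτ => hτ v)

lemma congr' (h : TameLim l F f) (hG : ∀ᶠ τ in l, ∀ v, G τ v = F τ v) : TameLim l G f := by
  obtain ⟨K, hK⟩ := h.bound
  refine ⟨⟨K, ?_⟩, ?_, fun v => (h.lim v).congr' ?_⟩
  · filter_upwards [hK, hG] with τ h1 h2 v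
    rw [h2]; exact h1 v
  · filter_upwards [h.cont, hG] with τ h1 h2
    rwa [show G τ = F τ from funext h2]
  · filter_upwards [hG.prod_inl (𝓝 v)] with q hq
    exact (hq q.2).symm

lemma congr_lim (h : TameLim l F f) (hg : ∀ v, g v = f v) : TameLim l F g := by
  rwa [show g = f from funext hg]

lemma const (h : TameFn f) : TameLim l (fun _ => f) f := by
  obtain ⟨K, hK⟩ := h.bound
  exact ⟨⟨K, .of_forall fun _ => hK⟩, .of_forall fun _ => h.cont,
    fun v => (h.cont.tendsto v).comp tendsto_snd⟩

lemma of_scalar {a : ℝ → ℝ} {a₀ : ℝ} (h : Tendsto a l (𝓝 a₀)) :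
    TameLim l (fun τ (_ : E) => a τ) (fun _ => a₀) := by
  refine ⟨⟨|a₀| + 1, ?_⟩, .of_forall fun _ => continuous_const, fun v => h.comp tendsto_fst⟩
  filter_upwards [h.abs.eventually_le_const (lt_add_one |a₀|)] with τ hτ v
  exact hτ.trans (le_growth (by positivity) v)

lemma add (hF : TameLim l F f) (hG : TameLim l G g) :
    TameLim l (fun τ v => F τ v + G τ v) (fun v => f v + g v) := by
  obtain ⟨K, hK⟩ := hF.bound
  obtain ⟨K', hK'⟩ := hG.bound
  refine ⟨⟨max K K' + 1, ?_⟩, ?_, fun v => (hF.lim v).add (hG.lim v)⟩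
  · filter_upwards [hK, hK'] with τ h1 h2 v
    exact (abs_add_le _ _).trans ((add_le_add (h1 v) (h2 v)).trans (add_growth K K' v))
  · filter_upwards [hF.cont, hG.cont] with τ h1 h2
    exact h1.add h2

lemma mul (hF : TameLim l F f) (hG : TameLim l G g) :
    TameLim l (fun τ v => F τ v * G τ v) (fun v => f v * g v) := by
  obtain ⟨K, hK⟩ := hF.bound
  obtain ⟨K', hK'⟩ := hG.bound
  refine ⟨⟨K + K', ?_⟩, ?_, fun v => (hF.lim v).mul (hG.lim v)⟩
  · filter_upwards [hK, hK'] with τ h1 h2 v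
    rw [abs_mul, add_mul, Real.exp_add]
    gcongr
    exacts [h1 v, h2 v]
  · filter_upwards [hF.cont, hG.cont] with τ h1 h2
    exact h1.mul h2

lemma const_mul (a : ℝ) (hF : TameLim l F f) :
    TameLim l (fun τ v => a * F τ v) (fun v => a * f v) :=
  (of_scalar tendsto_const_nhds).mul hF

lemma sum {ι : Type*} (s : Finset ι) {F : ι → ℝ → E → ℝ} {f : ι → E → ℝ}
    (h : ∀ i ∈ s, TameLim l (F i) (f i)) :
    TameLim l (fun τ v => ∑ i ∈ s, F i τ v) (fun v => ∑ i ∈ s, f i v) := by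
  classical
  induction s using Finset.induction_on with
  | empty => simpa using of_scalar (E := E) (l := l) (tendsto_const_nhds (x := (0 : ℝ)))
  | insert i s hi ih =>
    simp only [Finset.sum_insert hi]
    exact (h i (by simp)).add (ih fun j hj => h j (by simp [hj]))

lemma comp {φ : ℝ → ℝ} (hF : TameLim l F f) (hφ : ∀ v, ContinuousAt φ (f v))
    (hc : ∀ᶠ τ in l, Continuous fun v => φ (F τ v))
    (hb : ∃ K : ℝ, ∀ᶠ τ in l, ∀ v, |φ (F τ v)| ≤ Real.exp (K * (1 + ‖v‖))) :
    TameLim l (fun τ v => φ (F τ v)) (fun v => φ (f v)) :=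
  ⟨hb, hc, fun v => (hφ v).tendsto.comp (hF.lim v)⟩

end TameLim

namespace TameFn

variable {f g : E → ℝ}

/-- A single function is a limit along a trivial filter, so closure properties proved once for
`TameLim` descend to `TameFn`. The filter `pure 0` serves this purpose throughout. -/
lemma iff_tameLim : TameFn f ↔ TameLim (pure 0) (fun _ => f) f :=
  ⟨TameLim.const, fun h => h.limit⟩

lemma const (a : ℝ) : TameFn fun _ : E => a :=
  (TameLim.of_scalar (l := pure 0) (tendsto_const_nhds (x := a))).limit

lemma add (hf : TameFn f) (hg : TameFn g) : TameFn fun v => f v + g v :=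
  ((iff_tameLim.1 hf).add (iff_tameLim.1 hg)).limit

lemma mul (hf : TameFn f) (hg : TameFn g) : TameFn fun v => f v * g v :=
  ((iff_tameLim.1 hf).mul (iff_tameLim.1 hg)).limit

lemma const_mul (a : ℝ) (hf : TameFn f) : TameFn fun v => a * f v := (const a).mul hf

lemma sub (hf : TameFn f) (hg : TameFn g) : TameFn fun v => f v - g v := by
  simpa [sub_eq_add_neg] using hf.add (hg.const_mul (-1))

lemma sum {ι : Type*} (s : Finset ι) {f : ι → E → ℝ} (h : ∀ i ∈ s, TameFn (f i)) :
    TameFn fun v => ∑ i ∈ s, f i v :=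
  (TameLim.sum (l := pure 0) s fun i hi => TameLim.const (h i hi)).limit

end TameFn

/-! ### Positive functions of exponential growth -/

/-- `F τ` is positive with logarithm of at most linear growth, uniformly along `l`. -/
def PosGrowth (l : Filter ℝ) (F : ℝ → E → ℝ) : Prop :=
  ∃ K : ℝ, ∀ᶠ τ in l, ∀ v, Real.exp (-(K * (1 + ‖v‖))) ≤ F τ v ∧ F τ v ≤ Real.exp (K * (1 + ‖v‖))

section PosLin

variable {l : Filter ℝ} {F G : ℝ → E → ℝ} {f g : E → ℝ}

lemma LinGrowth.pos (h : LinGrowth l F) :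
    ∃ K : ℝ, 0 ≤ K ∧ ∀ᶠ τ in l, ∀ v, |F τ v| ≤ K * (1 + ‖v‖) := by
  obtain ⟨K, hK⟩ := h
  refine ⟨max K 0, le_max_right _ _, hK.mono fun τ h v => (h v).trans ?_⟩
  gcongr
  exact le_max_left _ _

lemma LinGrowth.scalar_mul {a : ℝ → ℝ} {a₀ : ℝ} (ha : Tendsto a l (𝓝 a₀)) (h : LinGrowth l F) :
    LinGrowth l (fun τ v => a τ * F τ v) := by
  obtain ⟨K, hK0, hK⟩ := h.pos
  refine ⟨(|a₀| + 1) * K, ?_⟩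
  filter_upwards [hK, ha.abs.eventually_le_const (lt_add_one |a₀|)] with τ h1 h2 v
  rw [abs_mul, mul_assoc]
  gcongr
  exact h1 v

lemma LinGrowth.posGrowth_exp (h : LinGrowth l F) : PosGrowth l fun τ v => Real.exp (F τ v) := by
  obtain ⟨K, hK⟩ := h
  refine ⟨K, hK.mono fun τ h v => ⟨?_, ?_⟩⟩
  · exact Real.exp_le_exp.2 (neg_le_of_abs_le (h v))
  · exact Real.exp_le_exp.2 (le_of_abs_le (h v))

lemma PosGrowth.pos (h : PosGrowth l F) : ∀ᶠ τ in l, ∀ v, 0 < F τ v := by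
  obtain ⟨K, hK⟩ := h
  exact hK.mono fun τ h v => (Real.exp_pos _).trans_le (h v).1

lemma PosGrowth.linGrowth_log (h : PosGrowth l F) : LinGrowth l fun τ v => Real.log (F τ v) := by
  obtain ⟨K, hK⟩ := h
  refine ⟨K, hK.mono fun τ h v => abs_le.2 ⟨?_, ?_⟩⟩
  · rw [Real.le_log_iff_exp_le ((Real.exp_pos _).trans_le (h v).1)]; exact (h v).1
  · rw [Real.log_le_iff_le_exp ((Real.exp_pos _).trans_le (h v).1)]; exact (h v).2

lemma PosGrowth.sum {ι : Type*} {s : Finset ι} (hs : s.Nonempty) {F : ι → ℝ → E → ℝ}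
    (h : ∀ i ∈ s, PosGrowth l (F i)) : PosGrowth l fun τ v => ∑ i ∈ s, F i τ v := by
  classical
  induction hs using Finset.Nonempty.cons_induction with
  | singleton i => simpa using h i (by simp)
  | cons i s hi hs ih =>
    simp only [Finset.sum_cons]
    obtain ⟨K, hK⟩ := h i (by simp)
    obtain ⟨K', hK'⟩ := ih fun j hj => h j (by simp [hj])
    refine ⟨max K K' + 1, ?_⟩
    filter_upwards [hK, hK'] with τ h1 h2 v
    refine ⟨?_, (add_le_add (h1 v).2 (h2 v).2).trans (add_growth K K' v)⟩
    have h3 : 0 < ∑ j ∈ s, F j τ v := (Real.exp_pos _).trans_le (h2 v).1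
    refine le_trans ?_ ((h1 v).1.trans (le_add_of_nonneg_right h3.le))
    gcongr
    linarith [le_max_left K K']

lemma LinGrowth.exp_bound (h : LinGrowth l F) :
    ∃ K : ℝ, ∀ᶠ τ in l, ∀ v, |F τ v| ≤ Real.exp (K * (1 + ‖v‖)) := by
  obtain ⟨K, hK⟩ := h
  refine ⟨K, hK.mono fun τ h v => (h v).trans ?_⟩
  linarith [Real.add_one_le_exp (K * (1 + ‖v‖))]

lemma PosGrowth.limit [l.NeBot] (h : PosGrowth l F) (hF : TameLim l F f) :
    PosGrowth (pure 0) fun _ => f := by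
  obtain ⟨K, hK⟩ := h
  exact ⟨K, (eventually_pure).2 fun v => ⟨ge_of_tendsto (hF.tendsto v) (hK.mono fun τ h => (h v).1),
    le_of_tendsto (hF.tendsto v) (hK.mono fun τ h => (h v).2)⟩⟩

lemma LinGrowth.limit [l.NeBot] (h : LinGrowth l F) (hF : TameLim l F f) :
    LinGrowth (pure 0) fun _ => f := by
  obtain ⟨K, hK⟩ := h
  exact ⟨K, (eventually_pure).2 fun v => le_of_tendsto (hF.tendsto v).abs
    (hK.mono fun τ h => h v)⟩

lemma TameLim.exp (hF : TameLim l F f) (h : LinGrowth l F) :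
    TameLim l (fun τ v => Real.exp (F τ v)) (fun v => Real.exp (f v)) := by
  refine hF.comp (fun v => Real.continuous_exp.continuousAt)
    (hF.cont.mono fun τ h => Real.continuous_exp.comp h) ?_
  obtain ⟨K, hK⟩ := h.posGrowth_exp
  refine ⟨K, hK.mono fun τ h v => ?_⟩
  rw [abs_of_pos (Real.exp_pos _)]
  exact (h v).2

lemma TameLim.log [l.NeBot] (hF : TameLim l F f) (h : PosGrowth l F) :
    TameLim l (fun τ v => Real.log (F τ v)) (fun v => Real.log (f v)) := by
  have h0 : ∀ v, 0 < f v := (eventually_pure).1 (h.limit hF).pos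
  refine hF.comp (fun v => Real.continuousAt_log (h0 v).ne') ?_ h.linGrowth_log.exp_bound
  filter_upwards [hF.cont, h.pos] with τ h1 h2
  exact h1.log fun v => (h2 v).ne'

lemma TameLim.inv [l.NeBot] (hF : TameLim l F f) (h : PosGrowth l F) :
    TameLim l (fun τ v => (F τ v)⁻¹) (fun v => (f v)⁻¹) := by
  have h0 : ∀ v, 0 < f v := (eventually_pure).1 (h.limit hF).pos
  refine hF.comp (φ := fun x => x⁻¹) (fun v => continuousAt_inv₀ (h0 v).ne') ?_ ?_
  · filter_upwards [hF.cont, h.pos] with τ h1 h2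
    exact h1.inv₀ fun v => (h2 v).ne'
  · obtain ⟨K, hK⟩ := h
    refine ⟨K, hK.mono fun τ h v => ?_⟩
    have := (Real.exp_pos _).trans_le (h v).1
    rw [abs_of_pos (inv_pos.2 this), inv_le_comm₀ this (Real.exp_pos _), ← Real.exp_neg]
    exact (h v).1

end PosLin

end Growth

/-! ### Differentiability in the parameter -/

lemma exists_mean_value {φ φ' : ℝ → ℝ} {s : Set ℝ} (hs : s.OrdConnected)
    (hφ : ∀ x ∈ s, HasDerivAt φ (φ' x) x) {a b : ℝ} (ha : a ∈ s) (hb : b ∈ s) :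
    ∃ ξ ∈ Set.uIcc a b, φ b - φ a = φ' ξ * (b - a) := by
  rcases lt_trichotomy a b with h | h | h
  · obtain ⟨ξ, hξ, e⟩ := exists_hasDerivAt_eq_slope φ φ' h
      (fun x hx => (hφ x (hs.out ha hb hx)).continuousAt.continuousWithinAt)
      (fun x hx => hφ x (hs.out ha hb (Set.Ioo_subset_Icc_self hx)))
    refine ⟨ξ, Set.Icc_subset_uIcc (Set.Ioo_subset_Icc_self hξ), ?_⟩
    rw [e, div_mul_cancel₀ _ (sub_pos.2 h).ne']
  · exact ⟨a, by simp, by simp [h]⟩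
  · obtain ⟨ξ, hξ, e⟩ := exists_hasDerivAt_eq_slope φ φ' h
      (fun x hx => (hφ x (hs.out hb ha hx)).continuousAt.continuousWithinAt)
      (fun x hx => hφ x (hs.out hb ha (Set.Ioo_subset_Icc_self hx)))
    refine ⟨ξ, Set.Icc_subset_uIcc' (Set.Ioo_subset_Icc_self hξ), ?_⟩
    have := (sub_pos.2 h).ne'
    rw [e]; field_simp; ring

section Slope

variable {E : Type*} [NormedAddCommGroup E]

/-- `F'` is the derivative of `τ ↦ F τ` at `t₀`, the difference quotients converging in the sense
of `TameLim`. -/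
structure HasSlope (t₀ : ℝ) (F : ℝ → E → ℝ) (F' : E → ℝ) : Prop where
  base : TameFn (F t₀)
  slope : TameLim (𝓝[≠] t₀) (fun τ v => (F τ v - F t₀ v) / (τ - t₀)) F'

namespace HasSlope

variable {t₀ : ℝ} {F G : ℝ → E → ℝ} {F' G' : E → ℝ}

lemma tame_deriv (h : HasSlope t₀ F F') : TameFn F' := h.slope.limit

lemma ne_eventually : ∀ᶠ τ in 𝓝[≠] t₀, τ - t₀ ≠ 0 := by
  filter_upwards [self_mem_nhdsWithin] with τ hτ
  exact sub_ne_zero.2 hτ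

/-- Differentiability implies continuity: `F τ` is `F t₀` plus `τ - t₀` times the difference
quotient. -/
lemma tame (h : HasSlope t₀ F F') : TameLim (𝓝[≠] t₀) F (F t₀) := by
  have h0 : Tendsto (fun τ : ℝ => τ - t₀) (𝓝[≠] t₀) (𝓝 0) :=
    tendsto_nhdsWithin_of_tendsto_nhds (by simpa using (continuous_sub_right t₀).tendsto t₀)
  refine (((TameLim.const h.base).add ((TameLim.of_scalar h0).mul h.slope)).congr' ?_).congr_lim
    (by simp)
  filter_upwards [ne_eventually (t₀ := t₀)] with τ hτ v
  field_simp; ring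

lemma hasDerivAt (h : HasSlope t₀ F F') (v : E) : HasDerivAt (fun τ => F τ v) (F' v) t₀ := by
  rw [hasDerivAt_iff_tendsto_slope]
  refine (h.slope.tendsto v).congr fun τ => ?_
  rw [slope_def_field]

lemma congr_deriv (h : HasSlope t₀ F F') (hG : ∀ v, G' v = F' v) : HasSlope t₀ F G' :=
  ⟨h.base, h.slope.congr_lim hG⟩

lemma const {f : E → ℝ} (hf : TameFn f) : HasSlope t₀ (fun _ => f) (fun _ => 0) :=
  ⟨hf, by simpa using TameLim.of_scalar (tendsto_const_nhds (x := (0 : ℝ)))⟩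

lemma of_scalar {a : ℝ → ℝ} {a' : ℝ} (h : HasDerivAt a a' t₀) :
    HasSlope t₀ (fun τ (_ : E) => a τ) (fun _ => a') := by
  refine ⟨TameFn.const _, TameLim.of_scalar ?_⟩
  refine (hasDerivAt_iff_tendsto_slope.1 h).congr fun τ => ?_
  rw [slope_def_field]

lemma mul (hF : HasSlope t₀ F F') (hG : HasSlope t₀ G G') :
    HasSlope t₀ (fun τ v => F τ v * G τ v) (fun v => F' v * G t₀ v + F t₀ v * G' v) :=
  ⟨hF.base.mul hG.base, ((hF.slope.mul hG.tame).add ((TameLim.const hF.base).mul hG.slope)).congr'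
    (.of_forall fun τ v => by ring)⟩

lemma const_mul (a : ℝ) (hF : HasSlope t₀ F F') :
    HasSlope t₀ (fun τ v => a * F τ v) (fun v => a * F' v) :=
  ((const (TameFn.const a)).mul hF).congr_deriv (by simp)

lemma sum {ι : Type*} (s : Finset ι) {F : ι → ℝ → E → ℝ} {F' : ι → E → ℝ}
    (h : ∀ i ∈ s, HasSlope t₀ (F i) (F' i)) :
    HasSlope t₀ (fun τ v => ∑ i ∈ s, F i τ v) (fun v => ∑ i ∈ s, F' i v) :=
  ⟨TameFn.sum s fun i hi => (h i hi).base,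
    (TameLim.sum s fun i hi => (h i hi).slope).congr' (.of_forall fun τ v => by
      rw [← Finset.sum_sub_distrib, Finset.sum_div])⟩

/-- By the mean value theorem the difference quotient of `φ ∘ F` is `φ' ξ` times that of `F`, with
`ξ` between `F t₀ v` and `F τ v`. The exponential bound therefore needs `φ'` on the whole segment,
and the joint limit follows by squeezing `ξ`. -/
lemma comp {φ φ' : ℝ → ℝ} {s : Set ℝ} (hs : s.OrdConnected) (hso : IsOpen s)
    (hφ : ∀ x ∈ s, HasDerivAt φ (φ' x) x) (hφ' : ContinuousOn φ' s) (hF : HasSlope t₀ F F')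
    (h0 : ∀ v, F t₀ v ∈ s) (hFs : ∀ᶠ τ in 𝓝[≠] t₀, ∀ v, F τ v ∈ s)
    (hb : ∃ K : ℝ, ∀ᶠ τ in 𝓝[≠] t₀, ∀ v, ∀ ξ ∈ Set.uIcc (F t₀ v) (F τ v),
      |φ' ξ| ≤ Real.exp (K * (1 + ‖v‖)))
    (hb0 : TameFn fun v => φ (F t₀ v)) :
    HasSlope t₀ (fun τ v => φ (F τ v)) (fun v => φ' (F t₀ v) * F' v) := by
  -- The location of `ξ` is asserted even when `F τ v` leaves `s`, so that the chosen function is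
  -- squeezed without exceptions.
  have key : ∀ τ v, ∃ ξ ∈ Set.uIcc (F t₀ v) (F τ v),
      F τ v ∈ s → φ (F τ v) - φ (F t₀ v) = φ' ξ * (F τ v - F t₀ v) := fun τ v => by
    by_cases h : F τ v ∈ s
    · obtain ⟨ξ, h1, h2⟩ := exists_mean_value hs hφ (h0 v) h
      exact ⟨ξ, h1, fun _ => h2⟩
    · exact ⟨F t₀ v, Set.left_mem_uIcc, fun h' => absurd h' h⟩
  choose ξ hξ hξe using key
  obtain ⟨K, hK⟩ := hb
  obtain ⟨K', hK'⟩ := hF.slope.bound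
  refine ⟨hb0, ⟨K + K', ?_⟩, ?_, fun v => ?_⟩
  · filter_upwards [hK, hK', hFs] with τ h1 h2 h3 v
    rw [hξe τ v (h3 v), mul_div_assoc, abs_mul, add_mul, Real.exp_add]
    gcongr
    exacts [h1 v _ (hξ τ v), h2 v]
  · filter_upwards [hFs, hF.tame.cont] with τ h1 h2
    have : Continuous fun v => φ (F τ v) := continuous_iff_continuousAt.2 fun v =>
      ContinuousAt.comp (f := F τ) (hφ _ (h1 v)).continuousAt h2.continuousAt
    exact (this.sub hb0.cont).div_const _
  · have hlim := hF.tame.lim v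
    have hbase : Tendsto (fun q : ℝ × E => F t₀ q.2) (𝓝[≠] t₀ ×ˢ 𝓝 v) (𝓝 (F t₀ v)) :=
      (hF.base.cont.tendsto v).comp tendsto_snd
    have hξlim : Tendsto (fun q : ℝ × E => ξ q.1 q.2) (𝓝[≠] t₀ ×ˢ 𝓝 v) (𝓝 (F t₀ v)) := by
      refine tendsto_of_tendsto_of_tendsto_of_le_of_le (by simpa using hbase.min hlim)
        (by simpa using hbase.max hlim) (fun q => ?_) (fun q => ?_)
      · exact (hξ q.1 q.2).1
      · exact (hξ q.1 q.2).2
    have hφlim := (hφ'.continuousAt (hso.mem_nhds (h0 v))).tendsto.comp hξlim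
    refine (hφlim.mul (hF.slope.lim v)).congr' ?_
    filter_upwards [hFs.prod_inl (𝓝 v)] with q hq
    simp only [Function.comp]
    rw [hξe q.1 q.2 (hq q.2), mul_div_assoc]

lemma exp (hF : HasSlope t₀ F F') (h : LinGrowth (𝓝[≠] t₀) F) :
    HasSlope t₀ (fun τ v => Real.exp (F τ v)) (fun v => Real.exp (F t₀ v) * F' v) := by
  refine comp (s := Set.univ) Set.ordConnected_univ isOpen_univ
    (fun x _ => Real.hasDerivAt_exp x) Real.continuous_exp.continuousOn hF (by simp) (by simp) ?_
    (hF.tame.exp h).limit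
  obtain ⟨K, hK⟩ := h
  refine ⟨K, ?_⟩
  filter_upwards [hK] with τ h1 v ξ hξ
  have h0 : |F t₀ v| ≤ K * (1 + ‖v‖) :=
    le_of_tendsto (hF.tame.tendsto v).abs (hK.mono fun τ h => h v)
  rw [abs_of_pos (Real.exp_pos _)]
  gcongr
  exact hξ.2.trans (max_le (le_of_abs_le h0) (le_of_abs_le (h1 v)))

lemma log (hF : HasSlope t₀ F F') (h : PosGrowth (𝓝[≠] t₀) F) :
    HasSlope t₀ (fun τ v => Real.log (F τ v)) (fun v => (F t₀ v)⁻¹ * F' v) := by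
  have hl := (eventually_pure).1 (h.limit hF.tame).pos
  refine comp (s := Set.Ioi 0) Set.ordConnected_Ioi isOpen_Ioi
    (fun x hx => Real.hasDerivAt_log (ne_of_gt hx))
    (continuousOn_inv₀.mono fun x hx => ne_of_gt hx) hF hl h.pos ?_
    (hF.tame.log h).limit
  obtain ⟨K, hK⟩ := h
  refine ⟨K, ?_⟩
  filter_upwards [hK] with τ h1 v ξ hξ
  have h0 : Real.exp (-(K * (1 + ‖v‖))) ≤ F t₀ v :=
    ge_of_tendsto (hF.tame.tendsto v) (hK.mono fun τ h => (h v).1)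
  have h2 : Real.exp (-(K * (1 + ‖v‖))) ≤ ξ := (le_min h0 (h1 v).1).trans hξ.1
  have h3 : 0 < ξ := (Real.exp_pos _).trans_le h2
  rwa [abs_of_pos (inv_pos.2 h3), inv_le_comm₀ h3 (Real.exp_pos _), ← Real.exp_neg]

end HasSlope
end Slope

end Interp

namespace Interp

/-! ### Smearing by random shifts -/

section Smear

variable {E : Type*} [NormedAddCommGroup E]

lemma TameLim.eventually_tameFn {l : Filter ℝ} {F : ℝ → E → ℝ} {f : E → ℝ} (h : TameLim l F f) :
    ∀ᶠ τ in l, TameFn (F τ) := by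
  obtain ⟨K, hK⟩ := h.bound
  filter_upwards [hK, h.cont] with τ h1 h2
  exact ⟨h2, K, h1⟩

lemma HasSlope.congr' {t₀ : ℝ} {F G : ℝ → E → ℝ} {F' : E → ℝ} (h : HasSlope t₀ F F')
    (h0 : ∀ v, G t₀ v = F t₀ v) (hG : ∀ᶠ τ in 𝓝[≠] t₀, ∀ v, G τ v = F τ v) :
    HasSlope t₀ G F' := by
  have e : G t₀ = F t₀ := funext h0
  refine ⟨e ▸ h.base, h.slope.congr' ?_⟩
  filter_upwards [hG] with τ hτ v
  rw [hτ, e]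

lemma growth_add {K : ℝ} (hK : 0 ≤ K) (v u : E) {w : ℝ} (hw : ‖u‖ ≤ w) :
    Real.exp (K * (1 + ‖v + u‖)) ≤ Real.exp (K * (1 + ‖v‖)) * Real.exp (K * w) := by
  rw [← Real.exp_add, ← mul_add]
  exact Real.exp_le_exp.2 (mul_le_mul_of_nonneg_left (by linarith [norm_add_le v u]) hK)

variable {Ω : Type*} [MeasurableSpace Ω]

/-- The average of the translates of `f` by a random vector. -/
def smear (μ : Measure Ω) (V : Ω → E) (f : E → ℝ) (v : E) : ℝ := ∫ ω, f (v + V ω) ∂μ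

variable [MeasurableSpace E]

/-- The random vectors `V τ` converge to `V₀` along `l`, dominated by a variable with all
exponential moments. -/
structure Driven (l : Filter ℝ) (μ : Measure Ω) (V : ℝ → Ω → E) (V₀ : Ω → E) : Prop where
  meas : ∀ τ, Measurable (V τ)
  meas₀ : Measurable V₀
  dom : ∃ W : Ω → ℝ, (∀ K : ℝ, Integrable (fun ω => Real.exp (K * W ω)) μ) ∧
    (∀ ω, ‖V₀ ω‖ ≤ W ω) ∧ ∀ᶠ τ in l, ∀ ω, ‖V τ ω‖ ≤ W ω
  lim : ∀ ω, Tendsto (fun τ => V τ ω) l (𝓝 (V₀ ω))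

variable {μ : Measure Ω} {l : Filter ℝ} {V : ℝ → Ω → E} {V₀ : Ω → E}

lemma Driven.const {l' : Filter ℝ} (h : Driven l μ V V₀) : Driven l' μ (fun _ => V₀) V₀ := by
  obtain ⟨W, h1, h2, -⟩ := h.dom
  exact ⟨fun _ => h.meas₀, h.meas₀, ⟨W, h1, h2, .of_forall fun _ => h2⟩,
    fun _ => tendsto_const_nhds⟩

lemma Driven.eventually_const (h : Driven l μ V V₀) :
    ∀ᶠ τ in l, Driven (pure 0) μ (fun _ => V τ) (V τ) := by
  obtain ⟨W, h1, h2, h3⟩ := h.dom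
  filter_upwards [h3] with τ h3
  exact ⟨fun _ => h.meas τ, h.meas τ, ⟨W, h1, h3, .of_forall fun _ => h3⟩,
    fun _ => tendsto_const_nhds⟩

variable [BorelSpace E] [SecondCountableTopology E]

lemma TameFn.aestronglyMeasurable {f : E → ℝ} (hf : Continuous f) {V : Ω → E} (hV : Measurable V)
    (v : E) : AEStronglyMeasurable (fun ω => f (v + V ω)) μ :=
  (hf.measurable.comp (hV.const_add v)).aestronglyMeasurable

lemma Driven.integrable (h : Driven l μ V V₀) {f : E → ℝ} (hf : TameFn f) (v : E) :
    Integrable (fun ω => f (v + V₀ ω)) μ := by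
  obtain ⟨W, h1, h2, -⟩ := h.dom
  obtain ⟨K, hK⟩ := hf.bound
  refine Integrable.mono' ((h1 (max K 0)).const_mul (Real.exp (max K 0 * (1 + ‖v‖))))
    (TameFn.aestronglyMeasurable hf.cont h.meas₀ v) (.of_forall fun ω => ?_)
  exact (hK _).trans ((growth_mono (le_max_left K 0) _).trans
    (growth_add (le_max_right K 0) v _ (h2 ω)))

/-- Dominated convergence, with an exponential of the dominating variable `W` as majorant. The
argument `v + V τ ω` moves with `τ`, so convergence at fixed points would not suffice: this is what
joint limits are for. -/
lemma TameLim.smear [l.IsCountablyGenerated] {F : ℝ → E → ℝ} {f : E → ℝ} (hF : TameLim l F f)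
    (h : Driven l μ V V₀) :
    TameLim l (fun τ => smear μ (V τ) (F τ)) (smear μ V₀ f) := by
  obtain ⟨W, h1, h2, h3⟩ := h.dom
  obtain ⟨K, hK⟩ := hF.bound
  -- A nonnegative constant is needed for the bound to be monotone in the norm of the shifted point.
  have hK' : ∀ᶠ τ in l, ∀ v, |F τ v| ≤ Real.exp (max K 0 * (1 + ‖v‖)) :=
    hK.mono fun τ h v => (h v).trans (growth_mono (le_max_left K 0) v)
  set K' := max K 0 with hKdef
  have hK0 : 0 ≤ K' := le_max_right K 0
  have hpt : ∀ᶠ τ in l, ∀ v ω, ‖F τ (v + V τ ω)‖ ≤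
      Real.exp (K' * (1 + ‖v‖)) * Real.exp (K' * W ω) := by
    filter_upwards [h3, hK'] with τ h3 h4 v ω
    exact (h4 _).trans (growth_add hK0 v _ (h3 ω))
  refine ⟨⟨K' + ∫ ω, Real.exp (K' * W ω) ∂μ, ?_⟩, ?_, fun v => ?_⟩
  · filter_upwards [hpt] with τ h4 v
    have h5 : 0 ≤ ∫ ω, Real.exp (K' * W ω) ∂μ := integral_nonneg fun ω => (Real.exp_pos _).le
    calc |Interp.smear μ (V τ) (F τ) v|
        ≤ ∫ ω, Real.exp (K' * (1 + ‖v‖)) * Real.exp (K' * W ω) ∂μ :=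
          norm_integral_le_of_norm_le ((h1 K').const_mul _) (.of_forall (h4 v))
      _ = Real.exp (K' * (1 + ‖v‖)) * ∫ ω, Real.exp (K' * W ω) ∂μ := integral_const_mul _ _
      _ ≤ Real.exp (K' * (1 + ‖v‖)) *
            Real.exp ((∫ ω, Real.exp (K' * W ω) ∂μ) * (1 + ‖v‖)) := by
          gcongr
          exact le_growth h5 v
      _ = _ := by rw [← Real.exp_add, ← add_mul]
  · filter_upwards [hpt, hF.cont] with τ h4 h5
    refine continuous_iff_continuousAt.2 fun v => ?_
    refine continuousAt_of_dominated (bound := fun ω => Real.exp (K' * (1 + (‖v‖ + 1))) *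
        Real.exp (K' * W ω)) (.of_forall fun v =>
      TameFn.aestronglyMeasurable h5 (h.meas τ) v) ?_ ((h1 K').const_mul _)
      (.of_forall fun ω => (h5.comp (continuous_add_const (V τ ω))).continuousAt)
    filter_upwards [(continuous_norm.tendsto v).eventually_le_const (lt_add_one _)] with u hu
    refine .of_forall fun ω => (h4 u ω).trans ?_
    gcongr
  · refine tendsto_integral_filter_of_dominated_convergence (fun ω =>
      Real.exp (K' * (1 + (‖v‖ + 1))) * Real.exp (K' * W ω)) ?_ ?_ ((h1 K').const_mul _)
      (.of_forall fun ω => ?_)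
    · filter_upwards [hF.cont.prod_inl (𝓝 v)] with q hq
      exact TameFn.aestronglyMeasurable hq (h.meas q.1) q.2
    · have hv := (continuous_norm.tendsto v).eventually_le_const (lt_add_one _)
      filter_upwards [hpt.prod_inl (𝓝 v), hv.prod_inr l] with q h4 h5
      refine .of_forall fun ω => (h4 q.2 ω).trans ?_
      gcongr
    · have h6 : Tendsto (fun q : ℝ × E => q.2 + V q.1 ω) (l ×ˢ 𝓝 v) (𝓝 (v + V₀ ω)) :=
        tendsto_snd.add ((h.lim ω).comp tendsto_fst)
      exact (hF.lim (v + V₀ ω)).comp (tendsto_fst.prodMk h6)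

lemma Driven.tameFn_smear (h : Driven l μ V V₀) {f : E → ℝ} (hf : TameFn f) :
    TameFn (smear μ V₀ f) :=
  ((TameLim.const (l := pure 0) hf).smear h.const).limit

/-- From below, a random shift costs at most a factor `exp (-K W)`. Its mean `D` is a fixed positive
number, whose logarithm is absorbed into the constant. -/
lemma PosGrowth.smear [IsProbabilityMeasure μ] {F : ℝ → E → ℝ} {f : E → ℝ} (hF : TameLim l F f)
    (hp : PosGrowth l F) (h : Driven l μ V V₀) :
    PosGrowth l fun τ => smear μ (V τ) (F τ) := by
  obtain ⟨W, h1, h2, h3⟩ := h.dom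
  obtain ⟨K, hK⟩ := hp
  set C := ∫ ω, Real.exp (max K 0 * W ω) ∂μ
  set D := ∫ ω, Real.exp (-max K 0 * W ω) ∂μ
  have hC : 0 ≤ C := integral_nonneg fun ω => (Real.exp_pos _).le
  have hD : 0 < D := integral_exp_pos (h1 _)
  refine ⟨max K 0 + max C (|Real.log D|), ?_⟩
  filter_upwards [hK, h3, hF.eventually_tameFn, h.eventually_const] with τ h4 h5 h6 h7 v
  have hint := h7.integrable h6 v
  constructor
  · calc Real.exp (-((max K 0 + max C |Real.log D|) * (1 + ‖v‖)))
        ≤ Real.exp (-(max K 0 * (1 + ‖v‖)) + Real.log D) := by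
          gcongr
          have := neg_abs_le (Real.log D)
          have := le_max_right C |Real.log D|
          nlinarith [norm_nonneg v, abs_nonneg (Real.log D)]
      _ = ∫ ω, Real.exp (-(max K 0 * (1 + ‖v‖))) * Real.exp (-max K 0 * W ω) ∂μ := by
          rw [Real.exp_add, Real.exp_log hD, integral_const_mul]
      _ ≤ _ := by
          refine integral_mono ((h1 _).const_mul _) hint fun ω => ?_
          refine le_trans ?_ (h4 _).1
          rw [← Real.exp_add]
          gcongr
          have h8 : 1 + ‖v + V τ ω‖ ≤ 1 + ‖v‖ + W ω := by
            linarith [norm_add_le v (V τ ω), h5 ω]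
          have h9 : 0 ≤ ‖v + V τ ω‖ := norm_nonneg _
          nlinarith [le_max_left K 0, le_max_right K 0]
  · calc Interp.smear μ (V τ) (F τ) v
        ≤ ∫ ω, Real.exp (max K 0 * (1 + ‖v‖)) * Real.exp (max K 0 * W ω) ∂μ := by
          refine integral_mono hint ((h1 _).const_mul _) fun ω => ?_
          exact (h4 _).2.trans ((growth_mono (le_max_left K 0) _).trans
            (growth_add (le_max_right K 0) v _ (h5 ω)))
      _ = Real.exp (max K 0 * (1 + ‖v‖)) * C := integral_const_mul _ _
      _ ≤ Real.exp (max K 0 * (1 + ‖v‖)) * Real.exp (C * (1 + ‖v‖)) := by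
          gcongr
          exact le_growth hC v
      _ ≤ _ := by
          rw [← Real.exp_add, ← add_mul]
          gcongr
          exact le_max_left _ _

lemma Driven.prod {Ω' : Type*} [MeasurableSpace Ω'] {ν : Measure Ω'} {V' : ℝ → Ω' → E}
    {V₀' : Ω' → E} [SFinite μ] [SFinite ν] (h : Driven l μ V V₀) (h' : Driven l ν V' V₀') :
    Driven l (μ.prod ν) (fun τ ω => V τ ω.1 + V' τ ω.2) (fun ω => V₀ ω.1 + V₀' ω.2) := by
  obtain ⟨W, h1, h2, h3⟩ := h.dom
  obtain ⟨W', h1', h2', h3'⟩ := h'.dom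
  refine ⟨fun τ => ((h.meas τ).comp measurable_fst).add ((h'.meas τ).comp measurable_snd),
    (h.meas₀.comp measurable_fst).add (h'.meas₀.comp measurable_snd),
    ⟨fun ω => W ω.1 + W' ω.2, fun K => ?_, fun ω => ?_, ?_⟩,
    fun ω => (h.lim ω.1).add (h'.lim ω.2)⟩
  · simp only [mul_add, Real.exp_add]
    exact (h1 K).mul_prod (h1' K)
  · exact (norm_add_le _ _).trans (add_le_add (h2 _) (h2' _))
  · filter_upwards [h3, h3'] with τ h4 h5 ω
    exact (norm_add_le _ _).trans (add_le_add (h4 _) (h5 _))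

lemma smear_prod {Ω' : Type*} [MeasurableSpace Ω'] {ν : Measure Ω'} {l' : Filter ℝ}
    {V' : ℝ → Ω' → E}
    {V₀' : Ω' → E} [SFinite μ] [SFinite ν] (h : Driven l μ V V₀) (h' : Driven l' ν V' V₀')
    {f : E → ℝ} (hf : TameFn f) :
    smear (μ.prod ν) (fun ω => V₀ ω.1 + V₀' ω.2) f = smear μ V₀ (smear ν V₀' f) := by
  funext v
  unfold smear
  rw [integral_prod]
  · simp only [add_assoc]
  · exact ((h.const (l' := pure 0)).prod (h'.const (l' := pure 0))).integrable hf v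

lemma Driven.comp_measurePreserving {Ω' : Type*} [MeasurableSpace Ω'] {ν : Measure Ω'}
    (h : Driven l μ V V₀) {e : Ω' → Ω} (he : MeasurePreserving e ν μ) :
    Driven l ν (fun τ ω => V τ (e ω)) (fun ω => V₀ (e ω)) := by
  obtain ⟨W, h1, h2, h3⟩ := h.dom
  refine ⟨fun τ => (h.meas τ).comp he.measurable, h.meas₀.comp he.measurable,
    ⟨fun ω => W (e ω), fun K => he.integrable_comp_of_integrable (h1 K), fun ω => h2 _,
    h3.mono fun τ h ω => h _⟩, fun ω => h.lim _⟩

lemma smear_comp_measurePreserving {Ω' : Type*} [MeasurableSpace Ω'] {ν : Measure Ω'}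
    {e : Ω' ≃ᵐ Ω} (he : MeasurePreserving e ν μ) (V₀ : Ω → E) (f : E → ℝ) :
    smear ν (fun ω => V₀ (e ω)) f = smear μ V₀ f := by
  funext v
  exact he.integral_comp e.measurableEmbedding (fun ω => f (v + V₀ ω))

lemma Driven.pi [IsProbabilityMeasure μ] {m : ℕ} {V : Fin m → ℝ → Ω → E} {V₀ : Fin m → Ω → E}
    (h : ∀ a, Driven l μ (V a) (V₀ a)) :
    Driven l (Measure.pi fun _ : Fin m => μ) (fun τ ω => ∑ a, V a τ (ω a))
      (fun ω => ∑ a, V₀ a (ω a)) := by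
  induction m with
  | zero =>
    simp only [Finset.univ_eq_empty, Finset.sum_empty]
    exact ⟨fun _ => measurable_const, measurable_const, ⟨fun _ => 0, by simp, by simp, by simp⟩,
      fun _ => tendsto_const_nhds⟩
  | succ m ih =>
    have h1 := (h 0).prod (ih fun a => h a.succ)
    have := h1.comp_measurePreserving (measurePreserving_piFinSuccAbove (fun _ => μ) 0)
    simpa [Fin.sum_univ_succ, MeasurableEquiv.piFinSuccAbove_apply, Fin.tail] using this

end Smear

end Interp

namespace Interp

/-! ### Directional derivatives and heat flow -/

section Heat

variable {E : Type*} [NormedAddCommGroup E] [NormedSpace ℝ E]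

/-- `f₁` is the derivative of `f` in the direction `w`. -/
def HasDir (w : E) (f f₁ : E → ℝ) : Prop := HasSlope 0 (fun ε v => f (v + ε • w)) f₁

lemma HasDir.base {w : E} {f f₁ : E → ℝ} (h : HasDir w f f₁) : TameFn f := by
  simpa using HasSlope.base h

lemma HasDir.tame_deriv {w : E} {f f₁ : E → ℝ} (h : HasDir w f f₁) : TameFn f₁ :=
  HasSlope.tame_deriv h

lemma HasDir.hasDerivAt {w : E} {f f₁ : E → ℝ} (h : HasDir w f f₁) (v : E) (s : ℝ) :
    HasDerivAt (fun s => f (v + s • w)) (f₁ (v + s • w)) s := by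
  have := HasSlope.hasDerivAt h (v + s • w)
  have h2 : HasDerivAt (fun x : ℝ => x - s) 1 s := (hasDerivAt_id s).sub_const s
  have h3 := HasDerivAt.comp s (h₂ := fun ε : ℝ => f (v + s • w + ε • w)) (h := fun x => x - s)
    (by simpa using this) h2
  refine (by simpa using h3 : HasDerivAt _ _ s).congr_of_eventuallyEq (.of_forall fun x => ?_)
  simp [Function.comp, add_assoc, ← add_smul]

lemma TameFn.comp_line {f : E → ℝ} (h : TameFn f) (v w : E) :
    TameFn fun s : ℝ => f (v + s • w) := by
  obtain ⟨K, hK⟩ := h.bound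
  refine ⟨h.cont.comp (by fun_prop), max K 0 * (1 + ‖v‖ + ‖w‖), fun s => (hK _).trans ?_⟩
  rw [Real.exp_le_exp]
  calc K * (1 + ‖v + s • w‖) ≤ max K 0 * (1 + ‖v + s • w‖) := by gcongr; exact le_max_left _ _
    _ ≤ max K 0 * ((1 + ‖v‖ + ‖w‖) * (1 + ‖s‖)) := by
        gcongr
        have := norm_add_le v (s • w)
        rw [norm_smul] at this
        nlinarith [norm_nonneg v, norm_nonneg w, norm_nonneg s,
          mul_nonneg (norm_nonneg v) (norm_nonneg s)]
    _ = _ := by ring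

/-- The value at a finite measure `Q` on directions of a function of directions. -/
def quad (Q : E →₀ ℝ) (φ : E → ℝ) : ℝ := Finsupp.linearCombination ℝ φ Q

lemma quad_eq_sum (Q : E →₀ ℝ) (φ : E → ℝ) : quad Q φ = ∑ w ∈ Q.support, Q w * φ w := by
  simp [quad, Finsupp.linearCombination_apply, Finsupp.sum]

@[simp] lemma quad_add_left (Q Q' : E →₀ ℝ) (φ : E → ℝ) :
    quad (Q + Q') φ = quad Q φ + quad Q' φ := map_add _ _ _

@[simp] lemma quad_zero_left (φ : E → ℝ) : quad 0 φ = 0 := map_zero _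

@[simp] lemma quad_single (w : E) (a : ℝ) (φ : E → ℝ) :
    quad (Finsupp.single w a) φ = a * φ w := by
  simp [quad, Finsupp.linearCombination_single]

lemma quad_sum_left {ι : Type*} (s : Finset ι) (Q : ι → E →₀ ℝ) (φ : E → ℝ) :
    quad (∑ i ∈ s, Q i) φ = ∑ i ∈ s, quad (Q i) φ := map_sum _ _ _

lemma quad_add (Q : E →₀ ℝ) (φ ψ : E → ℝ) :
    quad Q (fun w => φ w + ψ w) = quad Q φ + quad Q ψ := by
  simp [quad_eq_sum, mul_add, Finset.sum_add_distrib]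

lemma quad_sub (Q : E →₀ ℝ) (φ ψ : E → ℝ) :
    quad Q (fun w => φ w - ψ w) = quad Q φ - quad Q ψ := by
  simp [quad_eq_sum, mul_sub, Finset.sum_sub_distrib]

lemma quad_const_mul (Q : E →₀ ℝ) (a : ℝ) (φ : E → ℝ) :
    quad Q (fun w => a * φ w) = a * quad Q φ := by
  simp only [quad_eq_sum, Finset.mul_sum]
  exact Finset.sum_congr rfl fun w _ => by ring

lemma quad_sum {ι : Type*} (s : Finset ι) (Q : E →₀ ℝ) (φ : ι → E → ℝ) :
    quad Q (fun w => ∑ i ∈ s, φ i w) = ∑ i ∈ s, quad Q (φ i) := by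
  simp only [quad_eq_sum, Finset.mul_sum]
  exact Finset.sum_comm

lemma TameFn.quad {Q : E →₀ ℝ} {φ : E → E → ℝ} (h : ∀ w, TameFn (φ w)) :
    TameFn fun v => quad Q fun w => φ w v := by
  simp only [quad_eq_sum]
  exact TameFn.sum _ fun w _ => (h w).const_mul _

variable {Ω : Type*} [MeasurableSpace Ω] [MeasurableSpace E] [BorelSpace E]
  [SecondCountableTopology E]

variable {μ : Measure Ω} {l : Filter ℝ} {V : ℝ → Ω → E} {V₀ : Ω → E}

lemma Driven.smear_add (h : Driven l μ V V₀) {f g : E → ℝ} (hf : TameFn f) (hg : TameFn g)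
    (v : E) : smear μ V₀ (fun v => f v + g v) v = smear μ V₀ f v + smear μ V₀ g v :=
  integral_add (h.integrable hf v) (h.integrable hg v)

lemma Driven.smear_sub (h : Driven l μ V V₀) {f g : E → ℝ} (hf : TameFn f) (hg : TameFn g)
    (v : E) : smear μ V₀ (fun v => f v - g v) v = smear μ V₀ f v - smear μ V₀ g v :=
  integral_sub (h.integrable hf v) (h.integrable hg v)

lemma smear_const_mul (a : ℝ) (f : E → ℝ) (v : E) :
    smear μ V₀ (fun v => a * f v) v = a * smear μ V₀ f v :=
  integral_const_mul _ _

lemma smear_div_const (a : ℝ) (f : E → ℝ) (v : E) :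
    smear μ V₀ (fun v => f v / a) v = smear μ V₀ f v / a :=
  integral_div _ _

lemma Driven.smear_sum (h : Driven l μ V V₀) {ι : Type*} (s : Finset ι) {f : ι → E → ℝ}
    (hf : ∀ i ∈ s, TameFn (f i)) (v : E) :
    smear μ V₀ (fun v => ∑ i ∈ s, f i v) v = ∑ i ∈ s, smear μ V₀ (f i) v :=
  integral_finsetSum _ fun i hi => h.integrable (hf i hi) v

lemma Driven.smear_quad (h : Driven l μ V V₀) (Q : E →₀ ℝ) {φ : E → E → ℝ}
    (hφ : ∀ w, TameFn (φ w)) (v : E) :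
    smear μ V₀ (fun v => quad Q fun w => φ w v) v = quad Q fun w => smear μ V₀ (φ w) v := by
  simp only [quad_eq_sum]
  rw [h.smear_sum _ fun w _ => (hφ w).const_mul _]
  simp only [smear_const_mul]

/-- Averaging over random shifts commutes with a deterministic shift along `w`, hence with the
difference quotients. -/
lemma HasDir.smear {w : E} {f f₁ : E → ℝ} (hf : HasDir w f f₁) (h : Driven l μ V V₀) :
    HasDir w (smear μ V₀ f) (smear μ V₀ f₁) := by
  refine ⟨by simpa using h.tameFn_smear hf.base, ?_⟩
  have h1 := (HasSlope.slope hf).smear (h.const (l' := 𝓝[≠] 0))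
  refine h1.congr' ?_
  filter_upwards [(HasSlope.tame hf).eventually_tameFn] with ε hε v
  simp only [zero_smul, add_zero]
  rw [smear_div_const, h.smear_sub hε hf.base]
  congr 2
  simp only [Interp.smear, add_right_comm v]

/-- The family `V τ` of random vectors acts on smooth functions as a heat flow: the derivative of
the average of the translates of `F τ` is the average of the derivative of `F` plus the
second derivatives along the directions of `Q`. -/
structure Heat (t₀ : ℝ) (μ : Measure Ω) (V : ℝ → Ω → E) (Q : E →₀ ℝ) : Prop where
  driven : Driven (𝓝[≠] t₀) μ V (V t₀)
  slope : ∀ (F : ℝ → E → ℝ) (F' : E → ℝ) (F₁ F₂ : E → E → ℝ), HasSlope t₀ F F' →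
    (∀ w, HasDir w (F t₀) (F₁ w)) → (∀ w, HasDir w (F₁ w) (F₂ w)) →
    HasSlope t₀ (fun τ => smear μ (V τ) (F τ))
      (smear μ (V t₀) fun v => F' v + quad Q fun w => F₂ w v)

/-- The two independent flows are applied one after the other. The outer flow meets the second
derivatives of a smeared function, which are the smeared second derivatives, so the two measures on
directions simply add. -/
lemma Heat.prod {Ω' : Type*} [MeasurableSpace Ω'] {ν : Measure Ω'} [SFinite μ] [SFinite ν]
    {V' : ℝ → Ω' → E} {t₀ : ℝ} {Q Q' : E →₀ ℝ} (h : Heat t₀ μ V Q) (h' : Heat t₀ ν V' Q') :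
    Heat t₀ (μ.prod ν) (fun τ ω => V τ ω.1 + V' τ ω.2) (Q + Q') := by
  refine ⟨h.driven.prod h'.driven, fun F F' F₁ F₂ hF h1 h2 => ?_⟩
  have key := h.slope _ _ _ _ (h'.slope F F' F₁ F₂ hF h1 h2) (fun w => (h1 w).smear h'.driven)
    (fun w => (h2 w).smear h'.driven)
  have hF₂ : ∀ w, TameFn (F₂ w) := fun w => (h2 w).tame_deriv
  have hq' : TameFn fun v => F' v + quad Q' fun w => F₂ w v := hF.tame_deriv.add (.quad hF₂)
  refine (key.congr' (G := fun τ => smear (μ.prod ν) (fun ω => V τ ω.1 + V' τ ω.2) (F τ))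
    (fun v => ?_) ?_).congr_deriv fun v => ?_
  · rw [smear_prod h.driven h'.driven hF.base]
  · filter_upwards [hF.tame.eventually_tameFn, h.driven.eventually_const,
      h'.driven.eventually_const] with τ h3 h4 h5 v
    rw [smear_prod h4 h5 h3]
  · rw [smear_prod h.driven h'.driven (by exact hF.tame_deriv.add (.quad hF₂))]
    congr 1
    funext u
    rw [← h'.driven.smear_quad Q hF₂, ← h'.driven.smear_add hq' (.quad hF₂)]
    congr 1
    funext z
    simp only [quad_add_left]
    ring

lemma Heat.comp_measurePreserving {Ω' : Type*} [MeasurableSpace Ω'] {ν : Measure Ω'} {t₀ : ℝ}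
    {Q : E →₀ ℝ} (h : Heat t₀ μ V Q) {e : Ω' ≃ᵐ Ω} (he : MeasurePreserving e ν μ) :
    Heat t₀ ν (fun τ ω => V τ (e ω)) Q := by
  refine ⟨h.driven.comp_measurePreserving he, fun F F' F₁ F₂ hF h1 h2 => ?_⟩
  simpa only [smear_comp_measurePreserving he] using h.slope F F' F₁ F₂ hF h1 h2

lemma Heat.of_trivial [IsProbabilityMeasure μ] {t₀ : ℝ} : Heat t₀ μ (fun _ _ => (0 : E)) 0 := by
  refine ⟨⟨fun _ => measurable_const, measurable_const, ⟨fun _ => 0, by simp, by simp, by simp⟩,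
    fun _ => tendsto_const_nhds⟩, fun F F' F₁ F₂ hF h1 h2 => ?_⟩
  have e : ∀ f : E → ℝ, Interp.smear μ (fun _ => (0 : E)) f = f := fun f => by
    funext v
    simp [Interp.smear]
  simpa [e] using hF

lemma Heat.pi [IsProbabilityMeasure μ] {m : ℕ} {V : Fin m → ℝ → Ω → E} {t₀ : ℝ}
    {Q : Fin m → E →₀ ℝ} (h : ∀ a, Heat t₀ μ (V a) (Q a)) :
    Heat t₀ (Measure.pi fun _ : Fin m => μ) (fun τ ω => ∑ a, V a τ (ω a)) (∑ a, Q a) := by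
  induction m with
  | zero => simpa using Heat.of_trivial
  | succ m ih =>
    have h1 := (h 0).prod (ih fun a => h a.succ)
    have := h1.comp_measurePreserving (measurePreserving_piFinSuccAbove (fun _ => μ) 0)
    simpa [Fin.sum_univ_succ, MeasurableEquiv.piFinSuccAbove_apply, Fin.tail] using this

end Heat

end Interp

namespace Interp

/-! ### The Gaussian heat flow in one direction -/

lemma integrable_exp_mul_abs_gaussian (K : ℝ) :
    Integrable (fun g => Real.exp (K * |g|)) (gaussianReal 0 1) := by
  refine integrable_exp_mul_abs (X := fun g => g) ?_ ?_
  · exact integrable_exp_mul_gaussianReal K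
  · exact integrable_exp_mul_gaussianReal (-K)

lemma TameFn.integrable_gaussian {f : ℝ → ℝ} (hf : TameFn f) :
    Integrable f (gaussianReal 0 1) := by
  obtain ⟨K, hK⟩ := hf.bound
  refine Integrable.mono' ((integrable_exp_mul_abs_gaussian K).const_mul (Real.exp K))
    hf.cont.aestronglyMeasurable (.of_forall fun x => (hK x).trans ?_)
  rw [← Real.exp_add, Real.norm_eq_abs]
  ring_nf; rfl

lemma tameFn_id : TameFn fun x : ℝ => x :=
  ⟨continuous_id, 1, fun x => by
    have := Real.add_one_le_exp (1 * (1 + ‖x‖))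
    rw [Real.norm_eq_abs] at *
    linarith⟩

lemma hasDerivAt_gaussianPDFReal (x : ℝ) :
    HasDerivAt (gaussianPDFReal 0 1) (-(x * gaussianPDFReal 0 1 x)) x := by
  have h : gaussianPDFReal 0 1 = fun x => (√(2 * Real.pi))⁻¹ * Real.exp (-x ^ 2 / 2) := by
    ext x; simp [gaussianPDFReal]
  rw [h]
  have h1 : HasDerivAt (fun x : ℝ => -x ^ 2 / 2) (-x) x := by
    have := ((hasDerivAt_pow 2 x).neg).div_const 2
    refine this.congr_deriv ?_
    simp only [Nat.cast_ofNat]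
    ring
  refine (h1.exp.const_mul _).congr_deriv ?_
  ring

lemma integrable_mul_gaussianPDFReal {f : ℝ → ℝ} (hf : TameFn f) :
    Integrable fun x => f x * gaussianPDFReal 0 1 x := by
  have h := hf.integrable_gaussian
  rw [gaussianReal_of_var_ne_zero 0 one_ne_zero, integrable_withDensity_iff
    (measurable_gaussianPDF 0 1) (.of_forall fun x => gaussianPDF_lt_top)] at h
  simpa [toReal_gaussianPDF] using h

/-- Gaussian integration by parts. -/
lemma gaussian_integral_by_parts {h h' : ℝ → ℝ} (hd : ∀ x, HasDerivAt h (h' x) x)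
    (hh : TameFn h) (hh' : TameFn h') :
    ∫ x, x * h x ∂gaussianReal 0 1 = ∫ x, h' x ∂gaussianReal 0 1 := by
  rw [integral_gaussianReal_eq_integral_smul one_ne_zero,
    integral_gaussianReal_eq_integral_smul one_ne_zero]
  have key := integral_mul_deriv_eq_deriv_mul_of_integrable (u := h) (u' := h')
    (v := gaussianPDFReal 0 1) (v' := fun x => -(x * gaussianPDFReal 0 1 x))
    (fun x _ => hd x) (fun x _ => hasDerivAt_gaussianPDFReal x) ?_ (integrable_mul_gaussianPDFReal hh')
    (integrable_mul_gaussianPDFReal hh)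
  · simp only [smul_eq_mul]
    have e1 : ∀ x, h x * -(x * gaussianPDFReal 0 1 x) = -(gaussianPDFReal 0 1 x * (x * h x)) :=
      fun x => by ring
    have e2 : ∀ x, h' x * gaussianPDFReal 0 1 x = gaussianPDFReal 0 1 x * h' x :=
      fun x => by ring
    simp only [e1, e2, integral_neg, neg_inj] at key
    exact key
  · refine ((integrable_mul_gaussianPDFReal (tameFn_id.mul hh)).neg).congr (.of_forall fun x => ?_)
    simp only [Pi.neg_apply, Pi.mul_apply]
    ring

/-- Differentiating under the integral produces `g f₁(√c g) / (2 √c)`. Integration by parts trades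
the factor `g` for `√c f₂`, and the singular factor `1/√c` cancels; the formula thus keeps its
meaning as `c` tends to `0`. -/
lemma hasDerivAt_gaussian_variance {f f₁ f₂ : ℝ → ℝ} (h1 : ∀ x, HasDerivAt f (f₁ x) x)
    (h2 : ∀ x, HasDerivAt f₁ (f₂ x) x) (hf : TameFn f) (hf₁ : TameFn f₁) (hf₂ : TameFn f₂)
    {c : ℝ} (hc : 0 < c) :
    HasDerivAt (fun c => ∫ g, f (√c * g) ∂gaussianReal 0 1)
      (1 / 2 * ∫ g, f₂ (√c * g) ∂gaussianReal 0 1) c := by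
  have hcomp : ∀ {f : ℝ → ℝ}, TameFn f → ∀ a : ℝ, TameFn fun g => f (a * g) := fun hf a => by
    simpa [mul_comm] using hf.comp_line 0 a
  obtain ⟨K, hK⟩ := hf₁.bound
  have key := hasDerivAt_integral_of_dominated_loc_of_deriv_le (μ := gaussianReal 0 1)
    (F := fun c g => f (√c * g)) (F' := fun c g => f₁ (√c * g) * (1 / (2 * √c) * g))
    (bound := fun g => Real.exp (max K 0 * (1 + √(2 * c) * |g|)) * (1 / (2 * √(c / 2)) * |g|))
    -- On this neighbourhood both `√x` and `1/√x` are bounded, which gives the integrable majorant.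
    (s := Set.Ioo (c / 2) (2 * c)) (x₀ := c) (Ioo_mem_nhds (by linarith) (by linarith))
    (.of_forall fun c => (hcomp hf _).cont.aestronglyMeasurable)
    (hcomp hf _).integrable_gaussian
    (((hcomp hf₁ _).cont.mul (by fun_prop)).aestronglyMeasurable) ?_ ?_ ?_
  · refine key.2.congr_deriv ?_
    have hs : 0 < √c := Real.sqrt_pos.2 hc
    have ibp := gaussian_integral_by_parts (h := fun g => f₁ (√c * g))
      (h' := fun g => √c * f₂ (√c * g)) (fun x => by
        have := (h2 (√c * x)).comp x (((hasDerivAt_id x).const_mul (√c)))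
        simpa [mul_comm, Function.comp_def] using this) (hcomp hf₁ _)
      ((hcomp hf₂ _).const_mul _)
    have e : ∀ g, f₁ (√c * g) * (1 / (2 * √c) * g) = 1 / (2 * √c) * (g * f₁ (√c * g)) :=
      fun g => by ring
    simp only [e]
    rw [integral_const_mul, ibp, integral_const_mul]
    field_simp
  · refine .of_forall fun g x hx => ?_
    rw [norm_mul, Real.norm_eq_abs, Real.norm_eq_abs, abs_mul]
    have h0 : 0 < c / 2 := by linarith
    have h3 : √(c / 2) ≤ √x := Real.sqrt_le_sqrt hx.1.le
    have h4 : √x ≤ √(2 * c) := Real.sqrt_le_sqrt hx.2.le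
    have h5 : 0 < √(c / 2) := Real.sqrt_pos.2 h0
    have h6 : 0 < 1 / (2 * √x) := by have := h5.trans_le h3; positivity
    rw [abs_of_pos h6]
    gcongr
    refine (hK _).trans ((growth_mono (le_max_left K 0) _).trans ?_)
    rw [norm_mul, Real.norm_eq_abs, Real.norm_eq_abs, abs_of_nonneg (Real.sqrt_nonneg x)]
    gcongr
  · have h7 : TameFn fun g : ℝ => Real.exp (max K 0 * (1 + √(2 * c) * |g|)) *
        (1 / (2 * √(c / 2)) * |g|) := by
      refine TameFn.mul ⟨by fun_prop, max K 0 * (1 + √(2 * c)), fun g => ?_⟩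
        (TameFn.const_mul _ ⟨by fun_prop, 1, fun g => ?_⟩)
      · rw [abs_of_pos (Real.exp_pos _), Real.exp_le_exp, mul_assoc]
        refine mul_le_mul_of_nonneg_left ?_ (le_max_right K 0)
        rw [Real.norm_eq_abs]
        nlinarith [abs_nonneg g, Real.sqrt_nonneg (2 * c)]
      · have := Real.add_one_le_exp (1 * (1 + ‖g‖))
        rw [abs_abs]
        rw [Real.norm_eq_abs] at *
        linarith
    exact h7.integrable_gaussian
  · refine .of_forall fun g x hx => ?_
    have hx0 : 0 < x := by linarith [hx.1]
    have h8 := (Real.hasDerivAt_sqrt hx0.ne').mul_const g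
    exact (h1 (√x * g)).comp x h8

section

variable {E : Type*} [NormedAddCommGroup E] [NormedSpace ℝ E] [MeasurableSpace E] [BorelSpace E]
  [SecondCountableTopology E]

lemma driven_gaussian (w : E) {l : Filter ℝ} {c : ℝ → ℝ} {c₀ : ℝ} (hc : Tendsto c l (𝓝 c₀)) :
    Driven l (gaussianReal 0 1) (fun τ g => (√(c τ) * g) • w) (fun g => (√c₀ * g) • w) := by
  have hm : ∀ c : ℝ, Measurable fun g : ℝ => (√c * g) • w := fun c =>
    (by fun_prop : Continuous fun g : ℝ => (√c * g) • w).measurable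
  have hn : ∀ c : ℝ, c ≤ c₀ + 1 → ∀ g : ℝ, ‖(√c * g) • w‖ ≤ √(c₀ + 1) * ‖w‖ * |g| :=
    fun c hc g => by
      rw [norm_smul, norm_mul, Real.norm_eq_abs, Real.norm_eq_abs,
        abs_of_nonneg (Real.sqrt_nonneg c), mul_right_comm]
      gcongr
  refine ⟨fun τ => hm _, hm _, ⟨fun g => √(c₀ + 1) * ‖w‖ * |g|, fun K => ?_, hn _ (by linarith),
    ?_⟩, fun g => ?_⟩
  · simpa only [mul_assoc] using integrable_exp_mul_abs_gaussian (K * (√(c₀ + 1) * ‖w‖))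
  · filter_upwards [hc.eventually_le_const (lt_add_one c₀)] with τ hτ
    exact hn _ hτ
  · exact (((Real.continuous_sqrt.tendsto c₀).comp hc).mul_const g).smul_const w

/-- The variance may be zero at `t₀`, where its square root need not be differentiable. The function
of the variance is differentiable only inside `(0, ∞)` but continuous up to `0`; the mean value
theorem there writes its increment as half a smeared second derivative times the increment of `c`,
without any singular factor. -/
lemma heat_gaussian (w : E) {c : ℝ → ℝ} {c' t₀ : ℝ} (hc : HasDerivAt c c' t₀)
    (hc0 : ∀ᶠ τ in 𝓝 t₀, 0 ≤ c τ) :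
    Heat t₀ (gaussianReal 0 1) (fun τ g => (√(c τ) * g) • w) (Finsupp.single w (c' / 2)) := by
  have hct : Tendsto c (𝓝[≠] t₀) (𝓝 (c t₀)) := hc.continuousAt.tendsto.mono_left inf_le_left
  have hdr := driven_gaussian w hct
  refine ⟨hdr, fun F F' F₁ F₂ hF h1 h2 => ?_⟩
  set Φ : (E → ℝ) → ℝ → E → ℝ := fun f c => smear (gaussianReal 0 1) (fun g => (√c * g) • w) f
    with hΦ
  have hF1 := (h1 w).tame_deriv
  have hF2 := (h2 w).tame_deriv
  have hlim : ∀ f : E → ℝ, TameFn f → ∀ c₀, TameLim (𝓝 c₀) (Φ f) (Φ f c₀) := fun f hf c₀ =>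
    (TameLim.const hf).smear (driven_gaussian w tendsto_id)
  have hder : ∀ v, ∀ c, 0 < c → HasDerivAt (fun c => Φ (F t₀) c v) (1 / 2 * Φ (F₂ w) c v) c :=
    fun v c hc => by
      have := hasDerivAt_gaussian_variance (fun s => (h1 w).hasDerivAt v s)
        (fun s => (h2 w).hasDerivAt v s) (hF.base.comp_line v w) (hF1.comp_line v w)
        (hF2.comp_line v w) hc
      exact this
  -- The end point `0` is allowed: the derivative is used only strictly between `a` and `b`, where
  -- the variance is positive.
  have hmv : ∀ v a b, 0 ≤ a → 0 ≤ b → ∃ σ ∈ Set.uIcc a b,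
      Φ (F t₀) b v - Φ (F t₀) a v = 1 / 2 * Φ (F₂ w) σ v * (b - a) := by
    have hlt : ∀ v a b, 0 ≤ a → a < b → ∃ σ ∈ Set.Icc a b,
        Φ (F t₀) b v - Φ (F t₀) a v = 1 / 2 * Φ (F₂ w) σ v * (b - a) := fun v a b ha hab => by
      obtain ⟨σ, hσ, e⟩ := exists_hasDerivAt_eq_slope (fun c => Φ (F t₀) c v)
        (fun c => 1 / 2 * Φ (F₂ w) c v) hab
        (fun c _ => ContinuousAt.continuousWithinAt ((hlim _ hF.base c).tendsto v))
        (fun c hc => hder v c (ha.trans_lt hc.1))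
      refine ⟨σ, Set.Ioo_subset_Icc_self hσ, ?_⟩
      rw [e, div_mul_cancel₀ _ (sub_pos.2 hab).ne']
    intro v a b ha hb
    rcases lt_trichotomy a b with h | h | h
    · obtain ⟨σ, hσ, e⟩ := hlt v a b ha h
      exact ⟨σ, Set.Icc_subset_uIcc hσ, e⟩
    · exact ⟨a, by simp, by simp [h]⟩
    · obtain ⟨σ, hσ, e⟩ := hlt v b a hb h
      exact ⟨σ, Set.Icc_subset_uIcc' hσ, by linarith⟩
  have hc0' : 0 ≤ c t₀ := hc0.self_of_nhds
  have hex : ∀ τ v, ∃ σ ∈ Set.uIcc (c t₀) (c τ), 0 ≤ c τ →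
      Φ (F t₀) (c τ) v - Φ (F t₀) (c t₀) v = 1 / 2 * Φ (F₂ w) σ v * (c τ - c t₀) := fun τ v => by
    by_cases h : 0 ≤ c τ
    · obtain ⟨σ, hσ, e⟩ := hmv v _ _ hc0' h
      exact ⟨σ, hσ, fun _ => e⟩
    · exact ⟨c t₀, Set.left_mem_uIcc, fun h' => absurd h' h⟩
  choose σ hσ hσe using hex
  -- Uniform in `v`, since the distance of `σ τ v` from `c t₀` is at most `|c τ - c t₀|`.
  have hσlim : ∀ U ∈ 𝓝 (c t₀), ∀ᶠ τ in 𝓝[≠] t₀, ∀ v, σ τ v ∈ U := fun U hU => by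
    obtain ⟨ε, hε, hU⟩ := Metric.mem_nhds_iff.1 hU
    filter_upwards [hct (Metric.ball_mem_nhds _ hε)] with τ hτ v
    refine hU ?_
    have h3 : |c τ - c t₀| < ε := by simpa [Real.dist_eq] using hτ
    have := Set.abs_sub_left_of_mem_uIcc (hσ τ v)
    rw [Metric.mem_ball, Real.dist_eq]
    exact this.trans_lt h3
  have hc0'' : ∀ᶠ τ in 𝓝[≠] t₀, 0 ≤ c τ := hc0.filter_mono inf_le_left
  have hsl : Tendsto (fun τ => (c τ - c t₀) / (τ - t₀)) (𝓝[≠] t₀) (𝓝 c') := by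
    refine (hasDerivAt_iff_tendsto_slope.1 hc).congr fun τ => ?_
    rw [slope_def_field]
  have hR : TameLim (𝓝[≠] t₀) (fun τ v => (Φ (F t₀) (c τ) v - Φ (F t₀) (c t₀) v) / (τ - t₀))
      (fun v => c' / 2 * Φ (F₂ w) (c t₀) v) := by
    have hrep : ∀ᶠ τ in 𝓝[≠] t₀, ∀ v, (Φ (F t₀) (c τ) v - Φ (F t₀) (c t₀) v) / (τ - t₀) =
        (c τ - c t₀) / (τ - t₀) * (1 / 2 * Φ (F₂ w) (σ τ v) v) := by
      filter_upwards [hc0''] with τ hτ v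
      rw [hσe τ v hτ]
      ring
    refine ⟨?_, ?_, fun v => ?_⟩
    · obtain ⟨K, hK⟩ := (((hlim _ hF2 (c t₀)).const_mul (1 / 2))).bound
      obtain ⟨K', hK'⟩ := (TameLim.of_scalar (E := E) hsl).bound
      refine ⟨K' + K, ?_⟩
      filter_upwards [hσlim _ hK, hK', hrep] with τ h3 h4 h5 v
      rw [h5, abs_mul, add_mul, Real.exp_add]
      gcongr
      exacts [h4 v, h3 v v]
    · refine .of_forall fun τ => ?_
      exact ((((TameLim.const hF.base).smear (driven_gaussian w
        (tendsto_const_nhds (x := c τ) (f := pure (0 : ℝ))))).limit.cont).sub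
        (((TameLim.const hF.base).smear (driven_gaussian w
        (tendsto_const_nhds (x := c t₀) (f := pure (0 : ℝ))))).limit.cont)).div_const _
    · have h3 : Tendsto (fun q : ℝ × E => (σ q.1 q.2, q.2)) (𝓝[≠] t₀ ×ˢ 𝓝 v)
          (𝓝 (c t₀) ×ˢ 𝓝 v) := by
        refine Tendsto.prodMk (tendsto_def.2 fun U hU => ?_) tendsto_snd
        filter_upwards [(hσlim U hU).prod_inl (𝓝 v)] with q hq
        exact hq q.2
      have h4 := ((hlim _ hF2 (c t₀)).lim v).comp h3
      have h5 := (hsl.comp (tendsto_fst (g := 𝓝 v))).mul (h4.const_mul (1 / 2))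
      refine (by convert h5 using 2; ring : Tendsto _ _ (𝓝 (c' / 2 * Φ (F₂ w) (c t₀) v))).congr' ?_
      filter_upwards [hrep.prod_inl (𝓝 v)] with q hq
      rw [hq]
      rfl
  refine ⟨hdr.tameFn_smear hF.base, ?_⟩
  -- The increment splits into the change of `F` seen by the moving law and the change of the law
  -- seen by the frozen function `F t₀`.
  refine (((hF.slope.smear hdr).add hR).congr' ?_).congr_lim fun v => ?_
  · filter_upwards [hF.tame.eventually_tameFn, hdr.eventually_const] with τ h3 h4 v
    rw [smear_div_const, h4.smear_sub h3 hF.base]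
    simp only [hΦ]
    ring
  · simp only [quad_single]
    rw [hdr.smear_add hF.tame_deriv (hF2.const_mul _), smear_const_mul]

end

end Interp

namespace Interp

/-! ### Second order jets -/

section Jets

variable {E : Type*} [NormedAddCommGroup E] [NormedSpace ℝ E]

lemma norm_shift_le (v w : E) {ε : ℝ} (hε : |ε| ≤ 1) :
    1 + ‖v + ε • w‖ ≤ (1 + ‖w‖) * (1 + ‖v‖) := by
  have h1 := norm_add_le v (ε • w)
  rw [norm_smul, Real.norm_eq_abs] at h1
  nlinarith [norm_nonneg v, norm_nonneg w, mul_nonneg (norm_nonneg v) (norm_nonneg w)]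

lemma abs_le_one_eventually : ∀ᶠ ε in 𝓝[≠] (0 : ℝ), |ε| ≤ 1 := by
  have : Tendsto (fun ε : ℝ => |ε|) (𝓝[≠] 0) (𝓝 0) := by
    simpa using (continuous_abs.tendsto (0 : ℝ)).mono_left (nhdsWithin_le_nhds (s := {0}ᶜ))
  exact this.eventually_le_const one_pos

lemma PosGrowth.nonneg {l : Filter ℝ} {F : ℝ → E → ℝ} (h : PosGrowth l F) :
    ∃ K : ℝ, 0 ≤ K ∧ ∀ᶠ τ in l, ∀ v,
      Real.exp (-(K * (1 + ‖v‖))) ≤ F τ v ∧ F τ v ≤ Real.exp (K * (1 + ‖v‖)) := by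
  obtain ⟨K, hK⟩ := h
  refine ⟨max K 0, le_max_right _ _, hK.mono fun τ h v => ⟨le_trans ?_ (h v).1,
    (h v).2.trans (growth_mono (le_max_left _ _) v)⟩⟩
  gcongr
  exact le_max_left _ _

lemma LinGrowth.shift {f : E → ℝ} (h : LinGrowth (pure 0) fun _ => f) (w : E) :
    LinGrowth (𝓝[≠] 0) fun ε v => f (v + ε • w) := by
  obtain ⟨K, hK0, hK⟩ := h.pos
  rw [eventually_pure] at hK
  refine ⟨K * (1 + ‖w‖), abs_le_one_eventually.mono fun ε hε v => (hK _).trans ?_⟩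
  rw [mul_assoc]
  exact mul_le_mul_of_nonneg_left (norm_shift_le v w hε) hK0

lemma PosGrowth.shift {f : E → ℝ} (h : PosGrowth (pure 0) fun _ => f) (w : E) :
    PosGrowth (𝓝[≠] 0) fun ε v => f (v + ε • w) := by
  obtain ⟨K, hK0, hK⟩ := h.nonneg
  rw [eventually_pure] at hK
  refine ⟨K * (1 + ‖w‖), abs_le_one_eventually.mono fun ε hε v =>
    ⟨le_trans ?_ (hK _).1, (hK _).2.trans ?_⟩⟩
  · rw [Real.exp_le_exp, neg_le_neg_iff, mul_assoc]
    exact mul_le_mul_of_nonneg_left (norm_shift_le v w hε) hK0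
  · rw [Real.exp_le_exp, mul_assoc]
    exact mul_le_mul_of_nonneg_left (norm_shift_le v w hε) hK0

namespace HasDir

variable {w : E} {f f₁ g g₁ : E → ℝ}

lemma congr_deriv (h : HasDir w f f₁) (hg : ∀ v, g v = f₁ v) : HasDir w f g :=
  HasSlope.congr_deriv h hg

lemma const (a : ℝ) : HasDir w (fun _ => a) (fun _ => 0) := HasSlope.const (TameFn.const a)

lemma mul (hf : HasDir w f f₁) (hg : HasDir w g g₁) :
    HasDir w (fun v => f v * g v) (fun v => f₁ v * g v + f v * g₁ v) :=
  (HasSlope.mul hf hg).congr_deriv (by simp)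

lemma const_mul (a : ℝ) (hf : HasDir w f f₁) : HasDir w (fun v => a * f v) (fun v => a * f₁ v) :=
  HasSlope.const_mul a hf

lemma sum {ι : Type*} (s : Finset ι) {f f₁ : ι → E → ℝ} (h : ∀ i ∈ s, HasDir w (f i) (f₁ i)) :
    HasDir w (fun v => ∑ i ∈ s, f i v) (fun v => ∑ i ∈ s, f₁ i v) := HasSlope.sum s h

lemma exp (hf : HasDir w f f₁) (h : LinGrowth (pure 0) fun _ => f) :
    HasDir w (fun v => Real.exp (f v)) (fun v => Real.exp (f v) * f₁ v) :=
  (HasSlope.exp hf (h.shift w)).congr_deriv (by simp)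

lemma log (hf : HasDir w f f₁) (h : PosGrowth (pure 0) fun _ => f) :
    HasDir w (fun v => Real.log (f v)) (fun v => (f v)⁻¹ * f₁ v) :=
  (HasSlope.log hf (h.shift w)).congr_deriv (by simp)

/-- The reciprocal of a positive function is `exp (-log f)`, so the rules for `log` and `exp`
suffice. -/
lemma inv (hf : HasDir w f f₁) (h : PosGrowth (pure 0) fun _ => f) :
    HasDir w (fun v => (f v)⁻¹) (fun v => -((f v)⁻¹ * ((f v)⁻¹ * f₁ v))) := by
  have h0 : ∀ v, 0 < f v := (eventually_pure).1 h.pos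
  have h1 := ((hf.log h).const_mul (-1)).exp
    (h.linGrowth_log.scalar_mul (tendsto_const_nhds (x := (-1 : ℝ))))
  have e : ∀ v, Real.exp (-1 * Real.log (f v)) = (f v)⁻¹ := fun v => by
    rw [neg_one_mul, Real.exp_neg, Real.exp_log (h0 v)]
  simp only [e] at h1
  exact h1.congr_deriv fun v => by ring

end HasDir

/-- A family `F` with its derivative `F'` in the parameter at `t₀` and the first and second
directional derivatives `F₁, F₂` of `F t₀`. -/
structure Jet (t₀ : ℝ) (F : ℝ → E → ℝ) (F' : E → ℝ) (F₁ F₂ : E → E → ℝ) : Prop where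
  slope : HasSlope t₀ F F'
  dir₁ : ∀ w, HasDir w (F t₀) (F₁ w)
  dir₂ : ∀ w, HasDir w (F₁ w) (F₂ w)

namespace Jet

variable {t₀ : ℝ} {F : ℝ → E → ℝ} {F' G' : E → ℝ} {F₁ F₂ G₁ G₂ : E → E → ℝ}

lemma tame₁ (h : Jet t₀ F F' F₁ F₂) (w : E) : TameFn (F₁ w) := (h.dir₁ w).tame_deriv

lemma tame₂ (h : Jet t₀ F F' F₁ F₂) (w : E) : TameFn (F₂ w) := (h.dir₂ w).tame_deriv

lemma congr (h : Jet t₀ F F' F₁ F₂) (h' : ∀ v, G' v = F' v) (h₁ : ∀ w v, G₁ w v = F₁ w v)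
    (h₂ : ∀ w v, G₂ w v = F₂ w v) : Jet t₀ F G' G₁ G₂ := by
  rwa [show G' = F' from funext h', show G₁ = F₁ from funext fun w => funext (h₁ w),
    show G₂ = F₂ from funext fun w => funext (h₂ w)]

lemma const_mul (a : ℝ) (h : Jet t₀ F F' F₁ F₂) :
    Jet t₀ (fun τ v => a * F τ v) (fun v => a * F' v) (fun w v => a * F₁ w v)
      (fun w v => a * F₂ w v) :=
  ⟨h.slope.const_mul a, fun w => (h.dir₁ w).const_mul a, fun w => (h.dir₂ w).const_mul a⟩

lemma sum {ι : Type*} (s : Finset ι) {F : ι → ℝ → E → ℝ} {F' : ι → E → ℝ}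
    {F₁ F₂ : ι → E → E → ℝ} (h : ∀ i ∈ s, Jet t₀ (F i) (F' i) (F₁ i) (F₂ i)) :
    Jet t₀ (fun τ v => ∑ i ∈ s, F i τ v) (fun v => ∑ i ∈ s, F' i v)
      (fun w v => ∑ i ∈ s, F₁ i w v) (fun w v => ∑ i ∈ s, F₂ i w v) :=
  ⟨.sum s fun i hi => (h i hi).slope, fun w => .sum s fun i hi => (h i hi).dir₁ w,
    fun w => .sum s fun i hi => (h i hi).dir₂ w⟩

lemma exp (h : Jet t₀ F F' F₁ F₂) (hl : LinGrowth (𝓝[≠] t₀) F) {a : ℝ → ℝ} {a' : ℝ}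
    (ha : HasDerivAt a a' t₀) :
    Jet t₀ (fun τ v => Real.exp (a τ * F τ v))
      (fun v => Real.exp (a t₀ * F t₀ v) * (a' * F t₀ v + a t₀ * F' v))
      (fun w v => Real.exp (a t₀ * F t₀ v) * (a t₀ * F₁ w v))
      (fun w v => Real.exp (a t₀ * F t₀ v) * (a t₀ * (F₂ w v + a t₀ * F₁ w v ^ 2))) := by
  have hat : Tendsto a (𝓝[≠] t₀) (𝓝 (a t₀)) := ha.continuousAt.tendsto.mono_left inf_le_left
  have hl0 := (hl.scalar_mul hat).limit ((TameLim.of_scalar hat).mul h.slope.tame)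
  have hd : ∀ w, HasDir w (fun v => Real.exp (a t₀ * F t₀ v))
      (fun v => Real.exp (a t₀ * F t₀ v) * (a t₀ * F₁ w v)) := fun w =>
    ((h.dir₁ w).const_mul (a t₀)).exp hl0
  refine ⟨(((HasSlope.of_scalar ha).mul h.slope).exp (hl.scalar_mul hat)), hd, fun w => ?_⟩
  refine ((hd w).mul ((h.dir₂ w).const_mul (a t₀))).congr_deriv fun v => ?_
  ring

lemma log (h : Jet t₀ F F' F₁ F₂) (hp : PosGrowth (𝓝[≠] t₀) F) {a : ℝ → ℝ} {a' : ℝ}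
    (ha : HasDerivAt a a' t₀) (ha0 : a t₀ ≠ 0) :
    Jet t₀ (fun τ v => (a τ)⁻¹ * Real.log (F τ v))
      (fun v => (a t₀)⁻¹ * ((F t₀ v)⁻¹ * F' v) - a' / a t₀ ^ 2 * Real.log (F t₀ v))
      (fun w v => (a t₀)⁻¹ * ((F t₀ v)⁻¹ * F₁ w v))
      (fun w v => (a t₀)⁻¹ * ((F t₀ v)⁻¹ * F₂ w v - ((F t₀ v)⁻¹ * F₁ w v) ^ 2)) := by
  have hp0 := hp.limit h.slope.tame
  refine ⟨?_, fun w => ((h.dir₁ w).log hp0).const_mul _, fun w => ?_⟩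
  · refine ((HasSlope.of_scalar (ha.inv ha0)).mul (h.slope.log hp)).congr_deriv fun v => ?_
    simp only [Pi.inv_apply]
    ring
  · refine ((((h.dir₁ w).inv hp0).mul (h.dir₂ w)).const_mul _).congr_deriv fun v => ?_
    ring

variable {Ω : Type*} [MeasurableSpace Ω] [MeasurableSpace E] [BorelSpace E]
  [SecondCountableTopology E]

variable {μ : Measure Ω} {V : ℝ → Ω → E} {Q : E →₀ ℝ}

lemma heat (h : Jet t₀ F F' F₁ F₂) (hV : Heat t₀ μ V Q) :
    Jet t₀ (fun τ => smear μ (V τ) (F τ)) (smear μ (V t₀) fun v => F' v + quad Q fun w => F₂ w v)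
      (fun w => smear μ (V t₀) (F₁ w)) (fun w => smear μ (V t₀) (F₂ w)) :=
  ⟨hV.slope F F' F₁ F₂ h.slope h.dir₁ h.dir₂, fun w => (h.dir₁ w).smear hV.driven,
    fun w => (h.dir₂ w).smear hV.driven⟩

end Jet

/-! ### Free energies -/

/-- Tame functions of at most linear growth. -/
structure LinTame (f : E → ℝ) : Prop where
  tame : TameFn f
  lin : LinGrowth (pure 0) fun _ => f

section Fold

variable {Ω : Type*} [MeasurableSpace Ω] (μ : Measure Ω) (V : Ω → E) (a : ℝ) (X : E → ℝ)

/-- The free energy `a⁻¹ log E exp (a X)`. -/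
def fold (v : E) : ℝ := a⁻¹ * Real.log (smear μ V (fun v => Real.exp (a * X v)) v)

/-- The expectation with respect to the measure with density proportional to `exp (a X)`. -/
def tilt (f : E → ℝ) (v : E) : ℝ :=
  smear μ V (fun v => Real.exp (a * X v) * f v) v / smear μ V (fun v => Real.exp (a * X v)) v

end Fold

section FoldSum

variable {ι : Type*} [Fintype ι] (a : ℝ) (X : ι → E → ℝ)

/-- The free energy `a⁻¹ log ∑ exp (a X)`. -/
def foldSum (v : E) : ℝ := a⁻¹ * Real.log (∑ i, Real.exp (a * X i v))

/-- The average with weights proportional to `exp (a X)`. -/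
def tiltSum (f : ι → E → ℝ) (v : E) : ℝ :=
  (∑ i, Real.exp (a * X i v) * f i v) / ∑ i, Real.exp (a * X i v)

end FoldSum

section ExpMul

variable {l : Filter ℝ} {X : ℝ → E → ℝ} {x : E → ℝ} {a : ℝ → ℝ} {a₀ : ℝ}

lemma TameLim.exp_mul (hX : TameLim l X x) (hl : LinGrowth l X) (ha : Tendsto a l (𝓝 a₀)) :
    TameLim l (fun τ v => Real.exp (a τ * X τ v)) (fun v => Real.exp (a₀ * x v)) :=
  ((TameLim.of_scalar ha).mul hX).exp (hl.scalar_mul ha)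

lemma LinTame.exp_mul (hx : LinTame x) (a : ℝ) : TameFn fun v => Real.exp (a * x v) :=
  ((TameLim.const hx.tame).exp_mul hx.lin tendsto_const_nhds).limit

lemma LinTame.posGrowth_exp (hx : LinTame x) (a : ℝ) :
    PosGrowth (pure 0) fun _ v => Real.exp (a * x v) :=
  (hx.lin.scalar_mul tendsto_const_nhds).posGrowth_exp

end ExpMul

section FoldLemmas

variable {Ω : Type*} [MeasurableSpace Ω] [MeasurableSpace E] [BorelSpace E]
  [SecondCountableTopology E] {μ : Measure Ω} [IsProbabilityMeasure μ]
  {l l' : Filter ℝ} {V : ℝ → Ω → E} {V₀ : Ω → E} {X : ℝ → E → ℝ} {x : E → ℝ} {a : ℝ → ℝ} {a₀ : ℝ}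

lemma fold_linGrowth [l.IsCountablyGenerated] (hX : TameLim l X x) (hl : LinGrowth l X)
    (hV : Driven l μ V V₀) (ha : Tendsto a l (𝓝 a₀)) (ha0 : a₀ ≠ 0) :
    LinGrowth l fun τ => fold μ (V τ) (a τ) (X τ) :=
  (PosGrowth.smear (hX.exp_mul hl ha) (hl.scalar_mul ha).posGrowth_exp hV).linGrowth_log.scalar_mul
    (ha.inv₀ ha0)

lemma fold_tameLim [l.IsCountablyGenerated] [l.NeBot] (hX : TameLim l X x) (hl : LinGrowth l X)
    (hV : Driven l μ V V₀) (ha : Tendsto a l (𝓝 a₀)) (ha0 : a₀ ≠ 0) :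
    TameLim l (fun τ => fold μ (V τ) (a τ) (X τ)) (fold μ V₀ a₀ x) :=
  (TameLim.of_scalar (ha.inv₀ ha0)).mul (((hX.exp_mul hl ha).smear hV).log
    (PosGrowth.smear (hX.exp_mul hl ha) (hl.scalar_mul ha).posGrowth_exp hV))

lemma Driven.linTame_fold (h : Driven l μ V V₀) (hx : LinTame x) (ha0 : a₀ ≠ 0) :
    LinTame (fold μ V₀ a₀ x) :=
  ⟨(fold_tameLim (TameLim.const hx.tame) hx.lin h.const tendsto_const_nhds ha0).limit,
    fold_linGrowth (TameLim.const hx.tame) hx.lin h.const tendsto_const_nhds ha0⟩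

lemma Driven.posGrowth_smear_exp (h : Driven l μ V V₀) (hx : LinTame x) (a₀ : ℝ) :
    PosGrowth (pure 0) fun _ => smear μ V₀ fun v => Real.exp (a₀ * x v) :=
  PosGrowth.smear (TameLim.const (hx.exp_mul a₀)) (hx.posGrowth_exp a₀) h.const

lemma Driven.smear_exp_pos (h : Driven l μ V V₀) (hx : LinTame x) (a₀ : ℝ) (v : E) :
    0 < smear μ V₀ (fun v => Real.exp (a₀ * x v)) v :=
  (eventually_pure).1 (h.posGrowth_smear_exp hx a₀).pos v

lemma Driven.tameFn_tilt (h : Driven l μ V V₀) (hx : LinTame x) (a₀ : ℝ) {f : E → ℝ}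
    (hf : TameFn f) : TameFn (tilt μ V₀ a₀ x f) := by
  have h1 := h.tameFn_smear ((hx.exp_mul a₀).mul hf)
  have h2 := ((TameLim.const (l := pure 0) (h.tameFn_smear (hx.exp_mul a₀))).inv
    (h.posGrowth_smear_exp hx a₀)).limit
  rw [show tilt μ V₀ a₀ x f = _ from funext fun v => div_eq_mul_inv _ _]
  exact h1.mul h2

lemma Driven.tilt_add (h : Driven l μ V V₀) (hx : LinTame x) (a₀ : ℝ) {f g : E → ℝ}
    (hf : TameFn f) (hg : TameFn g) (v : E) :
    tilt μ V₀ a₀ x (fun v => f v + g v) v = tilt μ V₀ a₀ x f v + tilt μ V₀ a₀ x g v := by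
  simp only [tilt, mul_add]
  rw [h.smear_add ((hx.exp_mul a₀).mul hf) ((hx.exp_mul a₀).mul hg), add_div]

lemma tilt_const_mul (a₀ b : ℝ) (f : E → ℝ) (v : E) :
    tilt μ V₀ a₀ x (fun v => b * f v) v = b * tilt μ V₀ a₀ x f v := by
  simp only [tilt, mul_left_comm _ b, smear_const_mul, mul_div_assoc]

lemma Driven.tilt_sum (h : Driven l μ V V₀) (hx : LinTame x) (a₀ : ℝ) {ι : Type*} (s : Finset ι)
    {f : ι → E → ℝ} (hf : ∀ i ∈ s, TameFn (f i)) (v : E) :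
    tilt μ V₀ a₀ x (fun v => ∑ i ∈ s, f i v) v = ∑ i ∈ s, tilt μ V₀ a₀ x (f i) v := by
  simp only [tilt, Finset.mul_sum]
  rw [h.smear_sum s fun i hi => (hx.exp_mul a₀).mul (hf i hi), Finset.sum_div]

lemma Driven.tilt_quad (h : Driven l μ V V₀) (hx : LinTame x) (a₀ : ℝ) (Q : E →₀ ℝ)
    {φ : E → E → ℝ} (hφ : ∀ w, TameFn (φ w)) (v : E) :
    tilt μ V₀ a₀ x (fun v => quad Q fun w => φ w v) v = quad Q fun w => tilt μ V₀ a₀ x (φ w) v := by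
  simp only [quad_eq_sum]
  rw [h.tilt_sum hx _ _ fun w _ => (hφ w).const_mul _]
  simp only [tilt_const_mul]

lemma Driven.tilt_const (h : Driven l μ V V₀) (hx : LinTame x) (a₀ b : ℝ) (v : E) :
    tilt μ V₀ a₀ x (fun _ => b) v = b := by
  have := (h.smear_exp_pos hx a₀ v).ne'
  simp only [tilt, mul_comm _ b, smear_const_mul]
  field_simp

lemma tilt_nonneg (a₀ : ℝ) {f : E → ℝ} (hf : ∀ v, 0 ≤ f v) (v : E) :
    0 ≤ tilt μ V₀ a₀ x f v :=
  div_nonneg (integral_nonneg fun _ => mul_nonneg (Real.exp_pos _).le (hf _))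
    (integral_nonneg fun _ => (Real.exp_pos _).le)

variable {t₀ : ℝ} {X' : E → ℝ} {X₁ X₂ : E → E → ℝ} {Q : E →₀ ℝ} {a' : ℝ}

lemma Jet.linTame (h : Jet t₀ X X' X₁ X₂) (hl : LinGrowth (𝓝[≠] t₀) X) : LinTame (X t₀) :=
  ⟨h.slope.base, hl.limit h.slope.tame⟩

/-- The derivatives of the free energy `a⁻¹ log E exp (a X)`. -/
lemma Jet.fold (h : Jet t₀ X X' X₁ X₂) (hl : LinGrowth (𝓝[≠] t₀) X) (hV : Heat t₀ μ V Q)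
    (ha : HasDerivAt a a' t₀) (ha0 : a t₀ ≠ 0) :
    Jet t₀ (fun τ => fold μ (V τ) (a τ) (X τ))
      (fun v => tilt μ (V t₀) (a t₀) (X t₀)
          (fun v => X' v + quad Q fun w => X₂ w v + a t₀ * X₁ w v ^ 2) v +
        a' * ((tilt μ (V t₀) (a t₀) (X t₀) (X t₀) v - Interp.fold μ (V t₀) (a t₀) (X t₀) v) / a t₀))
      (fun w => tilt μ (V t₀) (a t₀) (X t₀) (X₁ w))
      (fun w v => tilt μ (V t₀) (a t₀) (X t₀) (fun v => X₂ w v + a t₀ * X₁ w v ^ 2) v -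
        a t₀ * tilt μ (V t₀) (a t₀) (X t₀) (X₁ w) v ^ 2) := by
  have hat : Tendsto a (𝓝[≠] t₀) (𝓝 (a t₀)) := ha.continuousAt.tendsto.mono_left inf_le_left
  have hx := h.linTame hl
  have hp := PosGrowth.smear (h.slope.tame.exp_mul hl hat) (hl.scalar_mul hat).posGrowth_exp
    hV.driven
  have he := hx.exp_mul (a t₀)
  have hY : ∀ w, TameFn fun v => X₂ w v + a t₀ * X₁ w v ^ 2 := fun w => by
    simpa only [pow_two] using (h.tame₂ w).add (((h.tame₁ w).mul (h.tame₁ w)).const_mul _)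
  refine (((h.exp hl ha).heat hV).log hp ha ha0).congr (fun v => ?_) (fun w v => ?_) fun w v => ?_
  -- The part with `a'` is separated: together with the derivative of the factor `a⁻¹` it becomes
  -- the difference between the tilted mean of `X` and the free energy.
  · have e : (fun v => Real.exp (a t₀ * X t₀ v) * (a' * X t₀ v + a t₀ * X' v) + quad Q fun w =>
        Real.exp (a t₀ * X t₀ v) * (a t₀ * (X₂ w v + a t₀ * X₁ w v ^ 2))) = fun v =>
        a t₀ * (Real.exp (a t₀ * X t₀ v) * (X' v + quad Q fun w => X₂ w v + a t₀ * X₁ w v ^ 2)) +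
          a' * (Real.exp (a t₀ * X t₀ v) * X t₀ v) := by
      funext v
      rw [quad_const_mul, quad_const_mul]
      ring
    rw [e, hV.driven.smear_add ((he.mul (h.slope.tame_deriv.add (.quad hY))).const_mul _)
      ((he.mul hx.tame).const_mul _), smear_const_mul, smear_const_mul]
    simp only [tilt, Interp.fold]
    field_simp
    ring
  · simp only [tilt, mul_left_comm _ (a t₀), smear_const_mul]
    field_simp
  · simp only [tilt, mul_left_comm _ (a t₀), smear_const_mul]
    field_simp

end FoldLemmas

section FoldSumLemmas

variable {ι : Type*} [Fintype ι] [Nonempty ι] {l : Filter ℝ} {X : ι → ℝ → E → ℝ} {x : ι → E → ℝ}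
  {a : ℝ → ℝ} {a₀ : ℝ}

lemma foldSum_linGrowth (hl : ∀ i, LinGrowth l (X i))
    (ha : Tendsto a l (𝓝 a₀)) (ha0 : a₀ ≠ 0) :
    LinGrowth l fun τ => foldSum (a τ) fun i => X i τ :=
  (PosGrowth.sum Finset.univ_nonempty fun i _ =>
    ((hl i).scalar_mul ha).posGrowth_exp).linGrowth_log.scalar_mul (ha.inv₀ ha0)

lemma foldSum_tameLim [l.NeBot] (hX : ∀ i, TameLim l (X i) (x i))
    (hl : ∀ i, LinGrowth l (X i)) (ha : Tendsto a l (𝓝 a₀)) (ha0 : a₀ ≠ 0) :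
    TameLim l (fun τ => foldSum (a τ) fun i => X i τ) (foldSum a₀ x) :=
  (TameLim.of_scalar (ha.inv₀ ha0)).mul
    ((TameLim.sum _ fun i _ => (hX i).exp_mul (hl i) ha).log
    (PosGrowth.sum Finset.univ_nonempty fun i _ => ((hl i).scalar_mul ha).posGrowth_exp))

lemma LinTame.foldSum (hx : ∀ i, LinTame (x i)) (ha0 : a₀ ≠ 0) : LinTame (foldSum a₀ x) :=
  ⟨(foldSum_tameLim (l := pure 0) (fun i => TameLim.const (hx i).tame) (fun i => (hx i).lin)
    tendsto_const_nhds ha0).limit,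
    foldSum_linGrowth (fun i => (hx i).lin) tendsto_const_nhds ha0⟩

lemma sum_exp_pos (a₀ : ℝ) (x : ι → E → ℝ) (v : E) : 0 < ∑ i, Real.exp (a₀ * x i v) :=
  Finset.sum_pos (fun _ _ => Real.exp_pos _) Finset.univ_nonempty

lemma LinTame.tameFn_tiltSum (hx : ∀ i, LinTame (x i)) (a₀ : ℝ) {f : ι → E → ℝ}
    (hf : ∀ i, TameFn (f i)) : TameFn (tiltSum a₀ x f) := by
  have h1 := TameFn.sum Finset.univ fun i _ => ((hx i).exp_mul a₀).mul (hf i)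
  have h2 := ((TameLim.const (l := pure 0) (TameFn.sum Finset.univ fun i _ =>
    (hx i).exp_mul a₀)).inv (PosGrowth.sum Finset.univ_nonempty fun i _ =>
      (hx i).posGrowth_exp a₀)).limit
  rw [show tiltSum a₀ x f = _ from funext fun v => div_eq_mul_inv _ _]
  exact h1.mul h2

variable {t₀ : ℝ} {X' : ι → E → ℝ} {X₁ X₂ : ι → E → E → ℝ} {a' : ℝ}

/-- The derivatives of the free energy `a⁻¹ log ∑ exp (a X)`. -/
lemma Jet.foldSum (h : ∀ i, Jet t₀ (X i) (X' i) (X₁ i) (X₂ i))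
    (hl : ∀ i, LinGrowth (𝓝[≠] t₀) (X i)) (ha : HasDerivAt a a' t₀) (ha0 : a t₀ ≠ 0) :
    Jet t₀ (fun τ => foldSum (a τ) fun i => X i τ)
      (fun v => tiltSum (a t₀) (fun i => X i t₀) X' v +
        a' * ((tiltSum (a t₀) (fun i => X i t₀) (fun i => X i t₀) v -
          Interp.foldSum (a t₀) (fun i => X i t₀) v) / a t₀))
      (fun w => tiltSum (a t₀) (fun i => X i t₀) (fun i => X₁ i w))
      (fun w v => tiltSum (a t₀) (fun i => X i t₀) (fun i v => X₂ i w v + a t₀ * X₁ i w v ^ 2) v -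
        a t₀ * tiltSum (a t₀) (fun i => X i t₀) (fun i => X₁ i w) v ^ 2) := by
  have hat : Tendsto a (𝓝[≠] t₀) (𝓝 (a t₀)) := ha.continuousAt.tendsto.mono_left inf_le_left
  have hp := PosGrowth.sum (s := Finset.univ) Finset.univ_nonempty fun i _ =>
    ((hl i).scalar_mul hat).posGrowth_exp
  refine ((Jet.sum Finset.univ fun i _ => (h i).exp (hl i) ha).log hp ha ha0).congr (fun v => ?_)
    (fun w v => ?_) fun w v => ?_
  · have e : ∀ i, Real.exp (a t₀ * X i t₀ v) * (a' * X i t₀ v + a t₀ * X' i v) =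
        a' * (Real.exp (a t₀ * X i t₀ v) * X i t₀ v) +
          a t₀ * (Real.exp (a t₀ * X i t₀ v) * X' i v) := fun i => by ring
    simp only [e, Finset.sum_add_distrib, ← Finset.mul_sum, tiltSum, Interp.foldSum]
    field_simp
    ring
  · simp only [tiltSum, mul_left_comm _ (a t₀), ← Finset.mul_sum]
    field_simp
  · simp only [tiltSum, mul_left_comm _ (a t₀), ← Finset.mul_sum]
    field_simp

end FoldSumLemmas

end Jets

end Interp

namespace Interp

/-! ### The recursion of free energies -/

/-- Variances of the Gaussian terms at each level, variance of the matrix term, and the exponents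
`m_k`. -/
structure Par where
  u4 : ℕ → ℝ
  u2 : ℕ → ℝ
  h : ℕ → ℝ
  g : ℝ
  m : ℕ → ℝ

end Interp

namespace Blirp

open Interp

variable {n : ℕ} (B : Blirp n)

/-- Values of the random field, indexed by `i₁, i₂`. -/
abbrev Field : Type := Fin B.l → Fin B.l → ℝ

instance : IsProbabilityMeasure B.levelLaw := by unfold levelLaw; infer_instance

instance : IsProbabilityMeasure B.matrixLaw := by unfold matrixLaw; infer_instance

/-- The contribution of `U_k` to the field. -/
def lvl (c : Par) (k : ℕ) (u : B.Level) : B.Field := fun i₁ i₂ =>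
  √(c.u4 k) * u.1 + √(c.u2 k) * ((B.y i₂).ofLp ⬝ᵥ u.2.1) + √(c.h k) * (u.2.2 ⬝ᵥ (B.x i₁).ofLp)

/-- The contribution of `G` to the field. -/
def matField (c : Par) (G : Fin B.m → Fin n → ℝ) : B.Field := fun i₁ i₂ =>
  √c.g * ((B.y i₂).ofLp ⬝ᵥ (Matrix.of G *ᵥ (B.x i₁).ofLp))

/-- A single standard normal entry of `u^(2,k)`, of `h^(k)` or of `G` moves the field along one
fixed direction; these are the directions, and the entries of `u^(4,k)` move it along the constant
field `1`. -/
def dirY (a : Fin B.m) : B.Field := fun _ i₂ => (B.y i₂).ofLp a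

def dirX (b : Fin n) : B.Field := fun i₁ _ => (B.x i₁).ofLp b

def dirXY (a : Fin B.m) (b : Fin n) : B.Field := fun i₁ i₂ => (B.y i₂).ofLp a * (B.x i₁).ofLp b

/-- Half the derivative of the covariance of the level `k`, as a measure on directions. -/
def lvlQ (c' : Par) (k : ℕ) : B.Field →₀ ℝ :=
  Finsupp.single 1 (c'.u4 k / 2) + (∑ a, Finsupp.single (B.dirY a) (c'.u2 k / 2) +
    ∑ b, Finsupp.single (B.dirX b) (c'.h k / 2))

def matQ (c' : Par) : B.Field →₀ ℝ := ∑ a, ∑ b, Finsupp.single (B.dirXY a b) (c'.g / 2)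

/-- In this form a level is a sum of independent one-dimensional Gaussians along fixed directions,
to which the one-dimensional heat flow and its products apply. -/
lemma lvl_eq (c : Par) (k : ℕ) (u : B.Level) :
    B.lvl c k u = (√(c.u4 k) * u.1) • (1 : B.Field) +
      (∑ a, (√(c.u2 k) * u.2.1 a) • B.dirY a + ∑ b, (√(c.h k) * u.2.2 b) • B.dirX b) := by
  funext i₁ i₂
  simp only [lvl, dotProduct, Pi.add_apply, Pi.smul_apply, Finset.sum_apply, smul_eq_mul, dirY,
    dirX, Finset.mul_sum, Pi.one_apply, mul_one, add_assoc]
  congr 2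
  · exact Finset.sum_congr rfl fun a _ => by ring
  · exact Finset.sum_congr rfl fun a _ => by ring

lemma matField_eq (c : Par) (G : Fin B.m → Fin n → ℝ) :
    B.matField c G = ∑ a, ∑ b, (√c.g * G a b) • B.dirXY a b := by
  funext i₁ i₂
  simp only [matField, dotProduct, Matrix.mulVec, Finset.sum_apply, Pi.smul_apply, smul_eq_mul,
    dirXY, Finset.mul_sum, Matrix.of_apply]
  exact Finset.sum_congr rfl fun a _ => Finset.sum_congr rfl fun b _ => by ring

lemma driven_lvl {l : Filter ℝ} {c : ℝ → Par} {c₀ : Par} (k : ℕ)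
    (h4 : Tendsto (fun τ => (c τ).u4 k) l (𝓝 (c₀.u4 k)))
    (h2 : Tendsto (fun τ => (c τ).u2 k) l (𝓝 (c₀.u2 k)))
    (h3 : Tendsto (fun τ => (c τ).h k) l (𝓝 (c₀.h k))) :
    Driven l B.levelLaw (fun τ => B.lvl (c τ) k) (B.lvl c₀ k) := by
  have := (driven_gaussian (1 : B.Field) h4).prod
    ((Driven.pi fun a => driven_gaussian (B.dirY a) h2).prod
      (Driven.pi fun b => driven_gaussian (B.dirX b) h3))
  rw [show B.lvl c₀ k = _ from funext (B.lvl_eq c₀ k),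
    show (fun τ => B.lvl (c τ) k) = _ from funext fun τ => funext (B.lvl_eq (c τ) k)]
  exact this

lemma driven_lvl_const {l : Filter ℝ} (c₀ : Par) (k : ℕ) :
    Driven l B.levelLaw (fun _ => B.lvl c₀ k) (B.lvl c₀ k) :=
  B.driven_lvl (c := fun _ => c₀) k tendsto_const_nhds tendsto_const_nhds tendsto_const_nhds

lemma heat_lvl {t₀ : ℝ} {c : ℝ → Par} {c' : Par} (k : ℕ)
    (h4 : HasDerivAt (fun τ => (c τ).u4 k) (c'.u4 k) t₀) (h4' : ∀ᶠ τ in 𝓝 t₀, 0 ≤ (c τ).u4 k)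
    (h2 : HasDerivAt (fun τ => (c τ).u2 k) (c'.u2 k) t₀) (h2' : ∀ᶠ τ in 𝓝 t₀, 0 ≤ (c τ).u2 k)
    (h3 : HasDerivAt (fun τ => (c τ).h k) (c'.h k) t₀) (h3' : ∀ᶠ τ in 𝓝 t₀, 0 ≤ (c τ).h k) :
    Heat t₀ B.levelLaw (fun τ => B.lvl (c τ) k) (B.lvlQ c' k) := by
  have := (heat_gaussian (1 : B.Field) h4 h4').prod
    ((Heat.pi fun a => heat_gaussian (B.dirY a) h2 h2').prod
      (Heat.pi fun b => heat_gaussian (B.dirX b) h3 h3'))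
  rw [show (fun τ => B.lvl (c τ) k) = _ from funext fun τ => funext (B.lvl_eq (c τ) k)]
  exact this

lemma driven_matField {l : Filter ℝ} {c : ℝ → Par} {c₀ : Par}
    (h : Tendsto (fun τ => (c τ).g) l (𝓝 c₀.g)) :
    Driven l B.matrixLaw (fun τ => B.matField (c τ)) (B.matField c₀) := by
  have := Driven.pi fun a => Driven.pi fun b => driven_gaussian (B.dirXY a b) h
  rw [show B.matField c₀ = _ from funext (B.matField_eq c₀),
    show (fun τ => B.matField (c τ)) = _ from funext fun τ => funext (B.matField_eq (c τ))]
  exact this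

lemma driven_matField_const {l : Filter ℝ} (c₀ : Par) :
    Driven l B.matrixLaw (fun _ => B.matField c₀) (B.matField c₀) :=
  B.driven_matField (c := fun _ => c₀) tendsto_const_nhds

lemma heat_matField {t₀ : ℝ} {c : ℝ → Par} {c' : Par}
    (h : HasDerivAt (fun τ => (c τ).g) c'.g t₀) (h' : ∀ᶠ τ in 𝓝 t₀, 0 ≤ (c τ).g) :
    Heat t₀ B.matrixLaw (fun τ => B.matField (c τ)) (B.matQ c') := by
  have := Heat.pi fun a => Heat.pi fun b => heat_gaussian (B.dirXY a b) h h'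
  rw [show (fun τ => B.matField (c τ)) = _ from funext fun τ => funext (B.matField_eq (c τ))]
  exact this

/-! #### The innermost free energies -/

/-- `β D₀^{(i₁,i₂,i₃)}` as a function of the field. -/
def lnA (i₁ i₃ i₂ : Fin B.l) (v : B.Field) : ℝ := B.β * (v i₁ i₂ + B.f (B.xbar i₃) (B.x i₁))

def lnC (i₃ i₁ : Fin B.l) : B.Field → ℝ := foldSum 1 (B.lnA i₁ i₃)

/-- The factor `s` undoes the normalization of the free energy, so this is `log Z`, with no sign
condition on `s`. -/
def lnZ (i₃ : Fin B.l) (v : B.Field) : ℝ := B.s * foldSum B.s (B.lnC i₃) v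

/-- The subscripts `₁` and `₂` mark first and second derivatives in the direction `w`, written as
Gibbs means and variances so that replicas can be read off; this convention continues for all free
energies. -/
def lnC₁ (i₃ i₁ : Fin B.l) (w : B.Field) : B.Field → ℝ :=
  tiltSum 1 (B.lnA i₁ i₃) fun i₂ _ => B.β * w i₁ i₂

def lnC₂ (i₃ i₁ : Fin B.l) (w v : B.Field) : ℝ :=
  tiltSum 1 (B.lnA i₁ i₃) (fun i₂ _ => (B.β * w i₁ i₂) ^ 2) v - B.lnC₁ i₃ i₁ w v ^ 2

def lnZ₁ (i₃ : Fin B.l) (w v : B.Field) : ℝ :=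
  B.s * tiltSum B.s (B.lnC i₃) (fun i₁ => B.lnC₁ i₃ i₁ w) v

def lnZ₂ (i₃ : Fin B.l) (w v : B.Field) : ℝ :=
  B.s * tiltSum B.s (B.lnC i₃) (fun i₁ v => B.lnC₂ i₃ i₁ w v + B.s * B.lnC₁ i₃ i₁ w v ^ 2) v -
    B.lnZ₁ i₃ w v ^ 2

lemma linTame_lnA (i₁ i₃ i₂ : Fin B.l) : LinTame (B.lnA i₁ i₃ i₂) := by
  have hc : Continuous (B.lnA i₁ i₃ i₂) := by unfold lnA; fun_prop
  have hl : LinGrowth (pure 0) fun _ => B.lnA i₁ i₃ i₂ := by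
    refine ⟨|B.β| * (1 + |B.f (B.xbar i₃) (B.x i₁)|), (eventually_pure).2 fun v => ?_⟩
    change |B.β * (v i₁ i₂ + B.f (B.xbar i₃) (B.x i₁))| ≤ _
    rw [abs_mul, mul_assoc]
    have h1 : |v i₁ i₂| ≤ ‖v‖ := (norm_le_pi_norm (v i₁) i₂).trans (norm_le_pi_norm v i₁)
    gcongr
    refine (abs_add_le _ _).trans ?_
    nlinarith [norm_nonneg v, abs_nonneg (B.f (B.xbar i₃) (B.x i₁)),
      mul_nonneg (norm_nonneg v) (abs_nonneg (B.f (B.xbar i₃) (B.x i₁)))]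
  obtain ⟨K, hK⟩ := hl.exp_bound
  exact ⟨⟨hc, K, (eventually_pure).1 hK⟩, hl⟩

lemma jet_lnA (t₀ : ℝ) (i₁ i₃ i₂ : Fin B.l) :
    Jet t₀ (fun _ => B.lnA i₁ i₃ i₂) (fun _ => 0) (fun w _ => B.β * w i₁ i₂) (fun _ _ => 0) := by
  refine ⟨.const (B.linTame_lnA i₁ i₃ i₂).tame, fun w => ?_, fun w => HasDir.const _⟩
  refine ⟨by simpa using (B.linTame_lnA i₁ i₃ i₂).tame, ?_⟩
  refine (TameLim.const (TameFn.const (B.β * w i₁ i₂))).congr' ?_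
  filter_upwards [self_mem_nhdsWithin] with ε hε v
  have : ε ≠ 0 := hε
  simp only [lnA, Pi.add_apply, Pi.smul_apply, smul_eq_mul]
  field_simp
  ring

variable [Nonempty (Fin B.l)]

lemma jet_lnC (t₀ : ℝ) (i₃ i₁ : Fin B.l) :
    Jet t₀ (fun _ => B.lnC i₃ i₁) (fun _ => 0) (B.lnC₁ i₃ i₁) (B.lnC₂ i₃ i₁) := by
  refine (Jet.foldSum (fun i₂ => B.jet_lnA t₀ i₁ i₃ i₂) (fun i₂ => ?_)
    (hasDerivAt_const t₀ (1 : ℝ)) one_ne_zero).congr (fun v => ?_) (fun w v => rfl) fun w v => ?_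
  · exact (B.linTame_lnA i₁ i₃ i₂).lin.elim fun K hK => ⟨K, .of_forall fun _ =>
      (eventually_pure).1 hK⟩
  · simp [tiltSum]
  · simp [lnC₂, lnC₁]

lemma LinTame.linGrowth {E : Type*} [NormedAddCommGroup E] {f : E → ℝ} (h : LinTame f)
    (l : Filter ℝ) : LinGrowth l fun _ => f :=
  h.lin.elim fun K hK => ⟨K, .of_forall fun _ => (eventually_pure).1 hK⟩

lemma linTame_lnC (i₃ i₁ : Fin B.l) : LinTame (B.lnC i₃ i₁) :=
  LinTame.foldSum (fun i₂ => B.linTame_lnA i₁ i₃ i₂) one_ne_zero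

variable {B}

lemma jet_lnZ (hs : B.s ≠ 0) (t₀ : ℝ) (i₃ : Fin B.l) :
    Jet t₀ (fun _ => B.lnZ i₃) (fun _ => 0) (B.lnZ₁ i₃) (B.lnZ₂ i₃) := by
  refine ((Jet.foldSum (fun i₁ => B.jet_lnC t₀ i₃ i₁)
    (fun i₁ => LinTame.linGrowth (B.linTame_lnC i₃ i₁) _)
    (hasDerivAt_const t₀ B.s) hs).const_mul B.s).congr (fun v => ?_) (fun w v => rfl) fun w v => ?_
  · simp [tiltSum]
  · simp only [lnZ₂, lnZ₁]
    ring

lemma linTame_lnZ (hs : B.s ≠ 0) (i₃ : Fin B.l) : LinTame (B.lnZ i₃) :=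
  ⟨(jet_lnZ hs 0 i₃).slope.base, (LinTame.foldSum (fun i₁ => B.linTame_lnC i₃ i₁)
    hs).lin.scalar_mul tendsto_const_nhds⟩

variable (B)

/-! #### The levels -/

/-- The logarithm of `E_{U_1} Z^{m_1}` divided by `m_1`, for each `i₃` separately; the sum over `i₃`
with the power `p` comes on top of it in `freeX`. -/
def freeH (c : Par) (i₃ : Fin B.l) : B.Field → ℝ := fold B.levelLaw (B.lvl c 1) (c.m 1) (B.lnZ i₃)

/-- The free energy `m_k⁻¹ log ζ_k` as a function of the field. -/
def freeX (c : Par) : ℕ → B.Field → ℝ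
  | 0 => fun _ => 0
  | 1 => fun v => B.p * foldSum (B.p * c.m 1) (B.freeH c) v
  | k + 2 => fold B.levelLaw (B.lvl c (k + 2)) (c.m (k + 2)) (freeX c (k + 1))

/-- `Φ_{U_1}^{(i₃)}` as an operator on functions of the field. -/
def tilt1 (c : Par) (i₃ : Fin B.l) : (B.Field → ℝ) → B.Field → ℝ :=
  tilt B.levelLaw (B.lvl c 1) (c.m 1) (B.lnZ i₃)

/-- The average over `i₃` with the weights `γ₀₀(i₃)`. -/
def tilt00 (c : Par) : (Fin B.l → B.Field → ℝ) → B.Field → ℝ := tiltSum (B.p * c.m 1) (B.freeH c)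

/-- `Φ_{U_k}`, `k ≥ 2`, as an operator on functions of the field. -/
def tiltX (c : Par) (k : ℕ) : (B.Field → ℝ) → B.Field → ℝ :=
  tilt B.levelLaw (B.lvl c k) (c.m k) (B.freeX c (k - 1))

def freeH₁ (c : Par) (i₃ : Fin B.l) (w : B.Field) : B.Field → ℝ := B.tilt1 c i₃ (B.lnZ₁ i₃ w)

def freeH₂ (c : Par) (i₃ : Fin B.l) (w v : B.Field) : ℝ :=
  B.tilt1 c i₃ (fun v => B.lnZ₂ i₃ w v + c.m 1 * B.lnZ₁ i₃ w v ^ 2) v -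
    c.m 1 * B.freeH₁ c i₃ w v ^ 2

def freeX₁ (c : Par) : ℕ → B.Field → B.Field → ℝ
  | 0 => fun _ _ => 0
  | 1 => fun w v => B.p * B.tilt00 c (fun i₃ => B.freeH₁ c i₃ w) v
  | k + 2 => fun w => B.tiltX c (k + 2) (freeX₁ c (k + 1) w)

/-- First derivatives are merely averaged from level to level. Second derivatives gain at each level
the tilted variance of the first ones, multiplied by the exponent. -/
def freeX₂ (c : Par) : ℕ → B.Field → B.Field → ℝ
  | 0 => fun _ _ => 0
  | 1 => fun w v => B.p * (B.tilt00 c (fun i₃ v => B.freeH₂ c i₃ w v +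
      B.p * c.m 1 * B.freeH₁ c i₃ w v ^ 2) v -
      B.p * c.m 1 * B.tilt00 c (fun i₃ => B.freeH₁ c i₃ w) v ^ 2)
  | k + 2 => fun w v =>
      B.tiltX c (k + 2) (fun v => freeX₂ c (k + 1) w v + c.m (k + 2) * B.freeX₁ c (k + 1) w v ^ 2) v
        - c.m (k + 2) * B.freeX₁ c (k + 2) w v ^ 2

/-- The derivative of `freeH` along a curve of parameters with the derivative `Q` of the covariances
and the derivative `m'` of the exponents. -/
def freeHDeriv (c : Par) (Q : ℕ → B.Field →₀ ℝ) (m' : ℕ → ℝ) (i₃ : Fin B.l) (v : B.Field) : ℝ :=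
  B.tilt1 c i₃ (fun v => quad (Q 1) fun w => B.lnZ₂ i₃ w v + c.m 1 * B.lnZ₁ i₃ w v ^ 2) v +
    m' 1 * ((B.tilt1 c i₃ (B.lnZ i₃) v - B.freeH c i₃ v) / c.m 1)

/-- The derivative of `freeX` along a curve of parameters. -/
def freeXDeriv (c : Par) (Q : ℕ → B.Field →₀ ℝ) (m' : ℕ → ℝ) : ℕ → B.Field → ℝ
  | 0 => fun _ => 0
  | 1 => fun v => B.p * (B.tilt00 c (B.freeHDeriv c Q m') v +
      B.p * m' 1 * ((B.tilt00 c (B.freeH c) v - foldSum (B.p * c.m 1) (B.freeH c) v) /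
        (B.p * c.m 1)))
  | k + 2 => fun v => B.tiltX c (k + 2) (fun v => freeXDeriv c Q m' (k + 1) v +
      quad (Q (k + 2)) fun w => B.freeX₂ c (k + 1) w v + c.m (k + 2) * B.freeX₁ c (k + 1) w v ^ 2) v
      + m' (k + 2) * ((B.tiltX c (k + 2) (B.freeX c (k + 1)) v - B.freeX c (k + 2) v) / c.m (k + 2))

end Blirp

/-! ### Curves of parameters and smoothness of the recursion -/

namespace Interp

/-- The limit of parameters in the levels `1, …, r`. -/
structure Par.Tends (c : ℝ → Par) (c₀ : Par) (l : Filter ℝ) (r : ℕ) : Prop where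
  u4 : ∀ k, 1 ≤ k → k ≤ r + 1 → Tendsto (fun τ => (c τ).u4 k) l (𝓝 (c₀.u4 k))
  u2 : ∀ k, 1 ≤ k → k ≤ r + 1 → Tendsto (fun τ => (c τ).u2 k) l (𝓝 (c₀.u2 k))
  h : ∀ k, 1 ≤ k → k ≤ r + 1 → Tendsto (fun τ => (c τ).h k) l (𝓝 (c₀.h k))
  g : Tendsto (fun τ => (c τ).g) l (𝓝 c₀.g)
  m : ∀ k, 1 ≤ k → k ≤ r → Tendsto (fun τ => (c τ).m k) l (𝓝 (c₀.m k))
  ne : ∀ k, 1 ≤ k → k ≤ r → c₀.m k ≠ 0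

/-- The derivative of a curve of parameters with nonnegative variances. -/
structure Par.HasDeriv (c : ℝ → Par) (c' : Par) (t₀ : ℝ) (r : ℕ) : Prop where
  u4 : ∀ k, 1 ≤ k → k ≤ r + 1 →
    HasDerivAt (fun τ => (c τ).u4 k) (c'.u4 k) t₀ ∧ ∀ᶠ τ in 𝓝 t₀, 0 ≤ (c τ).u4 k
  u2 : ∀ k, 1 ≤ k → k ≤ r + 1 →
    HasDerivAt (fun τ => (c τ).u2 k) (c'.u2 k) t₀ ∧ ∀ᶠ τ in 𝓝 t₀, 0 ≤ (c τ).u2 k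
  h : ∀ k, 1 ≤ k → k ≤ r + 1 →
    HasDerivAt (fun τ => (c τ).h k) (c'.h k) t₀ ∧ ∀ᶠ τ in 𝓝 t₀, 0 ≤ (c τ).h k
  g : HasDerivAt (fun τ => (c τ).g) c'.g t₀ ∧ ∀ᶠ τ in 𝓝 t₀, 0 ≤ (c τ).g
  m : ∀ k, 1 ≤ k → k ≤ r → HasDerivAt (fun τ => (c τ).m k) (c'.m k) t₀
  ne : ∀ k, 1 ≤ k → k ≤ r → (c t₀).m k ≠ 0

/-- The exponents in the levels `1, …, r` do not vanish. -/
def Par.Regular (c : Par) (r : ℕ) : Prop := ∀ k, 1 ≤ k → k ≤ r → c.m k ≠ 0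

end Interp

namespace Blirp

open Interp

variable {n : ℕ} {B : Blirp n} [Nonempty (Fin B.l)] {r : ℕ}

/-- The two properties are carried through the induction together: convergence of `exp (m X)` needs
linear growth of `X`, and the logarithm of the average restores linear growth. -/
lemma freeX_tame {l : Filter ℝ} [l.IsCountablyGenerated] [l.NeBot] {c : ℝ → Par} {c₀ : Par}
    (hp : B.p ≠ 0) (hs : B.s ≠ 0) (hc : Par.Tends c c₀ l r) (k : ℕ) (hk : 1 ≤ k) (hkr : k ≤ r) :
    TameLim l (fun τ => B.freeX (c τ) k) (B.freeX c₀ k) ∧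
      LinGrowth l fun τ => B.freeX (c τ) k := by
  induction k, hk using Nat.le_induction with
  | base =>
    have hd := B.driven_lvl 1 (hc.u4 1 le_rfl (by omega)) (hc.u2 1 le_rfl (by omega))
      (hc.h 1 le_rfl (by omega))
    have hm := hc.m 1 le_rfl hkr
    have hm0 := hc.ne 1 le_rfl hkr
    have h1 : ∀ i₃, TameLim l (fun τ => B.freeH (c τ) i₃) (B.freeH c₀ i₃) := fun i₃ =>
      fold_tameLim (.const (linTame_lnZ hs i₃).tame) (LinTame.linGrowth (linTame_lnZ hs i₃) _)
        hd hm hm0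
    have h2 : ∀ i₃, LinGrowth l fun τ => B.freeH (c τ) i₃ := fun i₃ =>
      fold_linGrowth (.const (linTame_lnZ hs i₃).tame) (LinTame.linGrowth (linTame_lnZ hs i₃) _)
        hd hm hm0
    exact ⟨(foldSum_tameLim h1 h2 (hm.const_mul B.p) (mul_ne_zero hp hm0)).const_mul B.p,
      (foldSum_linGrowth h2 (hm.const_mul B.p) (mul_ne_zero hp hm0)).scalar_mul
        tendsto_const_nhds⟩
  | succ k hk ih =>
    obtain ⟨k, rfl⟩ := Nat.exists_eq_add_of_le' hk
    obtain ⟨h1, h2⟩ := ih (by omega)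
    have hd := B.driven_lvl (k + 2) (hc.u4 (k + 2) (by omega) (by omega))
      (hc.u2 (k + 2) (by omega) (by omega)) (hc.h (k + 2) (by omega) (by omega))
    exact ⟨fold_tameLim h1 h2 hd (hc.m _ (by omega) hkr) (hc.ne _ (by omega) hkr),
      fold_linGrowth h1 h2 hd (hc.m _ (by omega) hkr) (hc.ne _ (by omega) hkr)⟩

lemma _root_.Interp.Par.HasDeriv.tends {c : ℝ → Par} {c' : Par} {t₀ : ℝ}
    (hc : Par.HasDeriv c c' t₀ r) : Par.Tends c (c t₀) (𝓝[≠] t₀) r where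
  u4 k h1 h2 := (hc.u4 k h1 h2).1.continuousAt.tendsto.mono_left nhdsWithin_le_nhds
  u2 k h1 h2 := (hc.u2 k h1 h2).1.continuousAt.tendsto.mono_left nhdsWithin_le_nhds
  h k h1 h2 := (hc.h k h1 h2).1.continuousAt.tendsto.mono_left nhdsWithin_le_nhds
  g := hc.g.1.continuousAt.tendsto.mono_left nhdsWithin_le_nhds
  m k h1 h2 := (hc.m k h1 h2).continuousAt.tendsto.mono_left nhdsWithin_le_nhds
  ne := hc.ne

lemma _root_.Interp.Par.Regular.tends {c : Par} (hc : c.Regular r) (l : Filter ℝ) :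
    Par.Tends (fun _ => c) c l r where
  u4 _ _ _ := tendsto_const_nhds
  u2 _ _ _ := tendsto_const_nhds
  h _ _ _ := tendsto_const_nhds
  g := tendsto_const_nhds
  m _ _ _ := tendsto_const_nhds
  ne := hc

lemma linTame_freeX {c : Par} (hp : B.p ≠ 0) (hs : B.s ≠ 0) (hc : c.Regular r) (k : ℕ)
    (hkr : k ≤ r) : LinTame (B.freeX c k) := by
  rcases Nat.eq_zero_or_pos k with rfl | hk
  · exact ⟨TameFn.const 0, 0, by simp [freeX]⟩
  · have := freeX_tame hp hs (hc.tends (pure 0)) k hk hkr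
    exact ⟨this.1.limit, this.2⟩

lemma linTame_freeH {c : Par} (hs : B.s ≠ 0) (hm : c.m 1 ≠ 0) (i₃ : Fin B.l) :
    LinTame (B.freeH c i₃) :=
  (B.driven_lvl_const (l := pure 0) c 1).linTame_fold (linTame_lnZ hs i₃) hm

lemma jet_freeH {c : ℝ → Par} {c' : Par} {t₀ : ℝ} (hs : B.s ≠ 0) (hr : 1 ≤ r)
    (hc : Par.HasDeriv c c' t₀ r) (i₃ : Fin B.l) :
    Jet t₀ (fun τ => B.freeH (c τ) i₃) (B.freeHDeriv (c t₀) (B.lvlQ c') c'.m i₃)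
      (B.freeH₁ (c t₀) i₃) (B.freeH₂ (c t₀) i₃) := by
  have hh := B.heat_lvl 1 (hc.u4 1 le_rfl (by omega)).1 (hc.u4 1 le_rfl (by omega)).2
    (hc.u2 1 le_rfl (by omega)).1 (hc.u2 1 le_rfl (by omega)).2
    (hc.h 1 le_rfl (by omega)).1 (hc.h 1 le_rfl (by omega)).2
  refine (Jet.fold (jet_lnZ hs t₀ i₃) (LinTame.linGrowth (linTame_lnZ hs i₃) _) hh
    (hc.m 1 le_rfl hr) (hc.ne 1 le_rfl hr)).congr (fun v => ?_) (fun w v => rfl) fun w v => rfl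
  simp only [zero_add]
  rfl

lemma jet_freeX {c : ℝ → Par} {c' : Par} {t₀ : ℝ} (hp : B.p ≠ 0) (hs : B.s ≠ 0)
    (hc : Par.HasDeriv c c' t₀ r) (k : ℕ) (hk : 1 ≤ k) (hkr : k ≤ r) :
    Jet t₀ (fun τ => B.freeX (c τ) k) (B.freeXDeriv (c t₀) (B.lvlQ c') c'.m k)
      (B.freeX₁ (c t₀) k) (B.freeX₂ (c t₀) k) := by
  induction k, hk using Nat.le_induction with
  | base =>
    refine ((Jet.foldSum (fun i₃ => jet_freeH hs hkr hc i₃) (fun i₃ => ?_)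
      ((hc.m 1 le_rfl hkr).const_mul B.p) (mul_ne_zero hp (hc.ne 1 le_rfl hkr))).const_mul
        B.p).congr (fun v => rfl) (fun w v => rfl) fun w v => rfl
    exact fold_linGrowth (.const (linTame_lnZ hs i₃).tame)
      (LinTame.linGrowth (linTame_lnZ hs i₃) _)
      (B.driven_lvl 1 (hc.tends.u4 1 le_rfl (by omega)) (hc.tends.u2 1 le_rfl (by omega))
      (hc.tends.h 1 le_rfl (by omega))) (hc.tends.m 1 le_rfl hkr) (hc.ne 1 le_rfl hkr)
  | succ k hk ih =>
    obtain ⟨k, rfl⟩ := Nat.exists_eq_add_of_le' hk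
    have hk2 : k + 2 ≤ r + 1 := by omega
    have hh := B.heat_lvl (k + 2) (hc.u4 _ (by omega) hk2).1 (hc.u4 _ (by omega) hk2).2
      (hc.u2 _ (by omega) hk2).1 (hc.u2 _ (by omega) hk2).2
      (hc.h _ (by omega) hk2).1 (hc.h _ (by omega) hk2).2
    exact (Jet.fold (ih (by omega)) (freeX_tame hp hs hc.tends (k + 1) (by omega) (by omega)).2 hh
      (hc.m (k + 2) (by omega) hkr) (hc.ne (k + 2) (by omega) hkr)).congr (fun v => rfl)
      (fun w v => rfl) fun w v => rfl

end Blirp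

namespace Blirp

open Interp

/-! ### The frozen quantities as functions of the field -/

section

variable {n : ℕ} (B : Blirp n)

/-- The part of the field that depends on `G` and on `U_{k+1}, …, U_{r+1}` only. -/
def rest (c : Par) (r : ℕ) (G : Fin B.m → Fin n → ℝ) (k : ℕ) (U : B.Noise) : B.Field :=
  B.matField c G + ∑ j ∈ Finset.Icc (k + 1) (r + 1), B.lvl c j (U j)

/-- The weights of the Gibbs measure `γ₀`. -/
def weight0 (i₁ i₂ i₃ : Fin B.l) (v : B.Field) : ℝ :=
  Real.exp (B.s * B.lnC i₃ i₁ v) / (∑ j, Real.exp (B.s * B.lnC i₃ j v)) *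
    (Real.exp (B.lnA i₁ i₃ i₂ v) / ∑ j, Real.exp (B.lnA i₁ i₃ j v))

/-- The weights `γ₀₀`. -/
def weight00 (c : Par) (i₃ : Fin B.l) (v : B.Field) : ℝ :=
  Real.exp (B.p * c.m 1 * B.freeH c i₃ v) / ∑ j, Real.exp (B.p * c.m 1 * B.freeH c j v)

/-- The composition `Φ_{U_k} ⋯ Φ_{U_j}` on functions of the field. -/
def tiltProd (c : Par) (j : ℕ) (f : B.Field → ℝ) : ℕ → B.Field → ℝ
  | 0 => f
  | k + 1 => if j ≤ k + 1 then B.tiltX c (k + 1) (tiltProd c j f k) else f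

def replicaWeight (c : Par) (k : ℕ) (a : Fin B.l × Fin B.l × Fin B.l) : B.Field → ℝ :=
  B.tiltProd c 2 (fun v => B.weight00 c a.2.2 v *
    B.tilt1 c a.2.2 (B.weight0 a.1 a.2.1 a.2.2) v) k

/-- `E_{G, U_{r+1}}` on functions of the field. -/
def topMean (c : Par) (r : ℕ) (f : B.Field → ℝ) : ℝ :=
  smear B.matrixLaw (B.matField c) (smear B.levelLaw (B.lvl c (r + 1)) f) 0

/-- The exponent, as a function of `U`, derives from the field with parameters `c`. -/
def FieldRep (c : Par) (r : ℕ) (G : Fin B.m → Fin n → ℝ)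
    (D : B.Noise → Fin B.l → Fin B.l → Fin B.l → ℝ) : Prop :=
  ∀ U i₁ i₂ i₃, D U i₁ i₂ i₃ = B.rest c r G 0 U i₁ i₂ + B.f (B.xbar i₃) (B.x i₁)

variable {B} {c : Par} {r : ℕ} {G : Fin B.m → Fin n → ℝ}

lemma rest_update {k : ℕ} (hk : 1 ≤ k) (hkr : k ≤ r + 1) (U : B.Noise) (u : B.Level) :
    B.rest c r G (k - 1) (Function.update U k u) = B.rest c r G k U + B.lvl c k u := by
  have e : Finset.Icc (k - 1 + 1) (r + 1) = insert k (Finset.Icc (k + 1) (r + 1)) := by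
    ext j; simp; omega
  rw [rest, rest, e, Finset.sum_insert (by simp), Function.update_self]
  have : ∑ j ∈ Finset.Icc (k + 1) (r + 1), B.lvl c j (Function.update U k u j) =
      ∑ j ∈ Finset.Icc (k + 1) (r + 1), B.lvl c j (U j) := by
    refine Finset.sum_congr rfl fun j hj => ?_
    rw [Function.update_of_ne]
    rintro rfl
    simp at hj
  rw [this]
  abel

lemma rest_update_self {k : ℕ} (U : B.Noise) (u : B.Level) :
    B.rest c r G k (Function.update U k u) = B.rest c r G k U := by
  rw [rest, rest]
  congr 1
  refine Finset.sum_congr rfl fun j hj => ?_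
  rw [Function.update_of_ne]
  rintro rfl
  simp at hj

/-- The randomness enters only through a sum of contributions, so resampling `U_k` translates the
argument by an independent Gaussian vector. This is the bridge from conditional expectations to
convolutions on the space of fields. -/
lemma EU_eq {k : ℕ} (hk : 1 ≤ k) (hkr : k ≤ r + 1) {F : B.Noise → ℝ} {f : B.Field → ℝ}
    (h : ∀ U, F U = f (B.rest c r G (k - 1) U)) (U : B.Noise) :
    B.EU k F U = smear B.levelLaw (B.lvl c k) f (B.rest c r G k U) := by
  simp only [EU, h, rest_update hk hkr, smear]

lemma EGU_eq {F : (Fin B.m → Fin n → ℝ) → B.Noise → ℝ} {f : B.Field → ℝ}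
    (h : ∀ G U, F G U = f (B.rest c r G r U)) : B.EGU r F = B.topMean c r f := by
  unfold EGU topMean
  rw [smear]
  congr 1
  funext G
  rw [EU_eq (c := c) (G := G) (r := r) (by omega) le_rfl (f := f) (h G)]
  -- After `U_{r+1}` is integrated out no level is left, and only the matrix term remains: the base
  -- point is irrelevant.
  simp [rest]

variable [Nonempty (Fin B.l)] {D : B.Noise → Fin B.l → Fin B.l → Fin B.l → ℝ}

lemma A_eq (hD : B.FieldRep c r G D) (i₁ i₂ i₃ : Fin B.l) (U : B.Noise) :
    B.A D i₁ i₂ i₃ U = Real.exp (B.lnA i₁ i₃ i₂ (B.rest c r G 0 U)) := by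
  rw [A, hD, lnA]

lemma exp_lnC (i₃ i₁ : Fin B.l) (v : B.Field) :
    Real.exp (B.lnC i₃ i₁ v) = ∑ i₂, Real.exp (B.lnA i₁ i₃ i₂ v) := by
  have := sum_exp_pos 1 (B.lnA i₁ i₃) v
  simp only [one_mul] at this
  simp only [lnC, foldSum, inv_one, one_mul]
  rw [Real.exp_log this]

lemma exp_lnZ (hs : B.s ≠ 0) (i₃ : Fin B.l) (v : B.Field) :
    Real.exp (B.lnZ i₃ v) = ∑ i₁, Real.exp (B.s * B.lnC i₃ i₁ v) := by
  rw [lnZ, foldSum, mul_inv_cancel_left₀ hs, Real.exp_log (sum_exp_pos B.s (B.lnC i₃) v)]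

lemma C_eq (hD : B.FieldRep c r G D) (i₁ i₃ : Fin B.l) (U : B.Noise) :
    B.C D i₁ i₃ U = Real.exp (B.lnC i₃ i₁ (B.rest c r G 0 U)) := by
  rw [C, exp_lnC]
  exact Finset.sum_congr rfl fun i₂ _ => A_eq hD ..

lemma C_rpow (hD : B.FieldRep c r G D) (i₁ i₃ : Fin B.l) (U : B.Noise) :
    B.C D i₁ i₃ U ^ B.s = Real.exp (B.s * B.lnC i₃ i₁ (B.rest c r G 0 U)) := by
  rw [C_eq hD, ← Real.exp_mul, mul_comm]

lemma Z_eq (hs : B.s ≠ 0) (hD : B.FieldRep c r G D) (i₃ : Fin B.l) (U : B.Noise) :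
    B.Z D i₃ U = Real.exp (B.lnZ i₃ (B.rest c r G 0 U)) := by
  rw [Z, exp_lnZ hs]
  exact Finset.sum_congr rfl fun i₁ _ => C_rpow hD ..

lemma Z_rpow (hs : B.s ≠ 0) (hD : B.FieldRep c r G D) (a : ℝ) (i₃ : Fin B.l) (U : B.Noise) :
    B.Z D i₃ U ^ a = Real.exp (a * B.lnZ i₃ (B.rest c r G 0 U)) := by
  rw [Z_eq hs hD, ← Real.exp_mul, mul_comm]

lemma gamma0_eq (hs : B.s ≠ 0) (hD : B.FieldRep c r G D) (i₁ i₂ i₃ : Fin B.l) (U : B.Noise) :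
    B.gamma0 D i₁ i₂ i₃ U = B.weight0 i₁ i₂ i₃ (B.rest c r G 0 U) := by
  rw [gamma0, C_rpow hD, Z_eq hs hD, exp_lnZ hs, A_eq hD, C_eq hD, exp_lnC, weight0]

lemma exp_freeH (hs : B.s ≠ 0) (hm : c.m 1 ≠ 0) (i₃ : Fin B.l) (v : B.Field) :
    Real.exp (c.m 1 * B.freeH c i₃ v) =
      smear B.levelLaw (B.lvl c 1) (fun v => Real.exp (c.m 1 * B.lnZ i₃ v)) v := by
  rw [freeH, fold, mul_inv_cancel_left₀ hm, Real.exp_log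
    ((B.driven_lvl_const (l := pure 0) c 1).smear_exp_pos (linTame_lnZ hs i₃) _ v)]

lemma EU_Z_eq (hs : B.s ≠ 0) (hm : c.m 1 ≠ 0) (hD : B.FieldRep c r G D) (i₃ : Fin B.l)
    (U : B.Noise) : B.EU 1 (fun V => B.Z D i₃ V ^ c.m 1) U =
      Real.exp (c.m 1 * B.freeH c i₃ (B.rest c r G 1 U)) := by
  rw [exp_freeH hs hm]
  exact EU_eq le_rfl (by omega) (fun U => Z_rpow hs hD _ i₃ U) U

lemma EU_Z_rpow (hs : B.s ≠ 0) (hm : c.m 1 ≠ 0) (hD : B.FieldRep c r G D) (i₃ : Fin B.l)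
    (U : B.Noise) : B.EU 1 (fun V => B.Z D i₃ V ^ c.m 1) U ^ B.p =
      Real.exp (B.p * c.m 1 * B.freeH c i₃ (B.rest c r G 1 U)) := by
  rw [EU_Z_eq hs hm hD, ← Real.exp_mul]
  ring_nf

lemma gamma00_eq (hs : B.s ≠ 0) (hm : c.m 1 ≠ 0) (hD : B.FieldRep c r G D) (i₃ : Fin B.l)
    (U : B.Noise) : B.gamma00 c.m D i₃ U = B.weight00 c i₃ (B.rest c r G 1 U) := by
  rw [gamma00, weight00, EU_Z_rpow hs hm hD]
  congr 1
  exact Finset.sum_congr rfl fun j _ => EU_Z_rpow hs hm hD ..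

lemma Phi1_eq (hs : B.s ≠ 0) (hm : c.m 1 ≠ 0) (hD : B.FieldRep c r G D) (i₃ : Fin B.l)
    {F : B.Noise → ℝ} {f : B.Field → ℝ} (hF : ∀ U, F U = f (B.rest c r G 0 U)) (U : B.Noise) :
    B.Phi1 c.m D i₃ F U = B.tilt1 c i₃ f (B.rest c r G 1 U) := by
  have h1 : B.Phi1 c.m D i₃ F U = ∫ u, Real.exp (c.m 1 * B.lnZ i₃ (B.rest c r G 1 U +
      B.lvl c 1 u)) / Real.exp (c.m 1 * B.freeH c i₃ (B.rest c r G 1 U)) *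
        f (B.rest c r G 1 U + B.lvl c 1 u) ∂B.levelLaw := by
    have h0 : ∀ u, B.rest c r G 0 (Function.update U 1 u) = B.rest c r G 1 U + B.lvl c 1 u :=
      fun u => rest_update le_rfl (by omega) U u
    simp only [Phi1]
    rw [EU]
    refine integral_congr_ae (.of_forall fun u => ?_)
    simp only [hF]
    rw [Z_rpow hs hD, EU_Z_eq hs hm hD, rest_update_self, h0]
  rw [h1, tilt1, tilt, ← exp_freeH hs hm, smear, ← integral_div]
  congr 1
  funext u
  ring

lemma exp_freeX_one (hp : B.p ≠ 0) (hm : c.m 1 ≠ 0) (v : B.Field) :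
    Real.exp (c.m 1 * B.freeX c 1 v) = ∑ i₃, Real.exp (B.p * c.m 1 * B.freeH c i₃ v) := by
  change Real.exp (c.m 1 * (B.p * ((B.p * c.m 1)⁻¹ * Real.log _))) = _
  rw [← mul_assoc, ← mul_assoc, mul_comm (c.m 1) B.p,
    mul_inv_cancel₀ (mul_ne_zero hp hm), one_mul, Real.exp_log (sum_exp_pos _ _ v)]

lemma exp_freeX_succ (hp : B.p ≠ 0) (hs : B.s ≠ 0) (hc : c.Regular r) {k : ℕ} (hk : 2 ≤ k)
    (hkr : k ≤ r) (v : B.Field) :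
    Real.exp (c.m k * B.freeX c k v) =
      smear B.levelLaw (B.lvl c k) (fun v => Real.exp (c.m k * B.freeX c (k - 1) v)) v := by
  obtain ⟨k, rfl⟩ := Nat.exists_eq_add_of_le' hk
  rw [freeX, fold, mul_inv_cancel_left₀ (hc _ (by omega) hkr), Real.exp_log
    ((B.driven_lvl_const (l := pure 0) c (k + 2)).smear_exp_pos
      (linTame_freeX hp hs hc (k + 1) (by omega)) _ v)]
  rfl

/-- The exponent `m_k / m_{k-1}` turns `exp (m_{k-1} X)` into `exp (m_k X)`, so after normalization
by `m_k` each level of the recursion is a free energy of the previous one. -/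
lemma zeta_eq (hp : B.p ≠ 0) (hs : B.s ≠ 0) (hc : c.Regular r) (hD : B.FieldRep c r G D) (k : ℕ)
    (hk : 1 ≤ k) (hkr : k ≤ r) (U : B.Noise) :
    B.zeta c.m D k U = Real.exp (c.m k * B.freeX c k (B.rest c r G k U)) := by
  induction k, hk using Nat.le_induction generalizing U with
  | base =>
    rw [exp_freeX_one hp (hc 1 le_rfl hkr)]
    exact Finset.sum_congr rfl fun i₃ _ => EU_Z_rpow hs (hc 1 le_rfl hkr) hD i₃ U
  | succ k hk ih =>
    obtain ⟨k, rfl⟩ := Nat.exists_eq_add_of_le' hk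
    rw [exp_freeX_succ hp hs hc (by omega) hkr]
    refine EU_eq (by omega) (by omega) (fun V => ?_) U
    have := hc (k + 1) (by omega) (by omega)
    rw [ih (by omega), ← Real.exp_mul]
    congr 1
    field_simp
    exact mul_comm _ _

lemma Phi_eq (hp : B.p ≠ 0) (hs : B.s ≠ 0) (hc : c.Regular r) (hD : B.FieldRep c r G D) {k : ℕ}
    (hk : 2 ≤ k) (hkr : k ≤ r) {F : B.Noise → ℝ} {f : B.Field → ℝ}
    (hF : ∀ U, F U = f (B.rest c r G (k - 1) U)) (U : B.Noise) :
    B.Phi c.m D k F U = B.tiltX c k f (B.rest c r G k U) := by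
  have hm := hc (k - 1) (by omega) (by omega)
  have h1 : B.Phi c.m D k F U = ∫ u, Real.exp (c.m k * B.freeX c (k - 1) (B.rest c r G k U +
      B.lvl c k u)) / Real.exp (c.m k * B.freeX c k (B.rest c r G k U)) *
        f (B.rest c r G k U + B.lvl c k u) ∂B.levelLaw := by
    simp only [Phi]
    rw [EU]
    refine integral_congr_ae (.of_forall fun u => ?_)
    simp only [hF]
    rw [zeta_eq hp hs hc hD k (by omega) hkr, zeta_eq hp hs hc hD (k - 1) (by omega) (by omega),
      rest_update_self, rest_update (by omega) (by omega), ← Real.exp_mul]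
    congr 3
    field_simp
  rw [h1, tiltX, tilt, ← exp_freeX_succ hp hs hc hk hkr, smear, ← integral_div]
  congr 1
  funext u
  ring

lemma PhiProd_eq (hp : B.p ≠ 0) (hs : B.s ≠ 0) (hc : c.Regular r) (hD : B.FieldRep c r G D)
    {j : ℕ} (hj : 1 ≤ j) {F : B.Noise → ℝ} {f : B.Field → ℝ}
    (hF : ∀ U, F U = f (B.rest c r G j U)) (k : ℕ) (hk : j ≤ k) (hkr : k ≤ r) (U : B.Noise) :
    B.PhiProd c.m D (j + 1) F k U = B.tiltProd c (j + 1) f k (B.rest c r G k U) := by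
  induction k, hk using Nat.le_induction generalizing U with
  | base =>
    obtain ⟨j, rfl⟩ := Nat.exists_eq_add_of_le' hj
    simp [PhiProd, tiltProd, hF]
  | succ k hk ih =>
    rw [PhiProd, tiltProd, if_pos (by omega), if_pos (by omega)]
    exact Phi_eq hp hs hc hD (by omega) hkr (fun U => ih (by omega) U) U

lemma replica_eq (hp : B.p ≠ 0) (hs : B.s ≠ 0) (hc : c.Regular r) (hD : B.FieldRep c r G D)
    {k : ℕ} (hk : 1 ≤ k) (hkr : k ≤ r) (i₁ i₂ i₃ : Fin B.l) (U : B.Noise) :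
    B.replica c.m D k i₁ i₂ i₃ U = B.replicaWeight c k (i₁, i₂, i₃) (B.rest c r G k U) := by
  have hm := hc 1 le_rfl (by omega)
  refine PhiProd_eq hp hs hc hD le_rfl (fun U => ?_) k hk hkr U
  rw [gamma00_eq hs hm hD, Phi1_eq hs hm hD i₃ (fun U => gamma0_eq hs hD i₁ i₂ i₃ U)]

/-! #### Regularity and linearity -/

lemma tameFn_weight0 (i₁ i₂ i₃ : Fin B.l) : TameFn (B.weight0 i₁ i₂ i₃) := by
  classical
  have h1 := LinTame.tameFn_tiltSum (fun i₂ => B.linTame_lnA i₁ i₃ i₂) 1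
    (f := fun j _ => if j = i₂ then 1 else 0) (fun j => TameFn.const _)
  have h2 := LinTame.tameFn_tiltSum (fun i₁ => B.linTame_lnC i₃ i₁) B.s
    (f := fun j _ => if j = i₁ then 1 else 0) (fun j => TameFn.const _)
  -- Gibbs weights are Gibbs averages of indicator functions, so their regularity is that of
  -- averages.
  have e : B.weight0 i₁ i₂ i₃ = fun v => tiltSum B.s (B.lnC i₃) (fun j _ => if j = i₁ then 1 else 0)
      v * tiltSum 1 (B.lnA i₁ i₃) (fun j _ => if j = i₂ then 1 else 0) v := by
    funext v
    simp [weight0, tiltSum]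
  rw [e]
  exact h2.mul h1

lemma tameFn_weight00 (hs : B.s ≠ 0) (hm : c.m 1 ≠ 0) (i₃ : Fin B.l) :
    TameFn (B.weight00 c i₃) := by
  classical
  have h2 := LinTame.tameFn_tiltSum (fun i₃ => linTame_freeH hs hm i₃) (B.p * c.m 1)
    (f := fun j _ => if j = i₃ then 1 else 0) (fun j => TameFn.const _)
  have e : B.weight00 c i₃ = tiltSum (B.p * c.m 1) (B.freeH c) (fun j _ => if j = i₃ then 1 else 0)
      := by
    funext v
    simp [weight00, tiltSum]
  rwa [e]

lemma tilt00_eq_sum (f : Fin B.l → B.Field → ℝ) (v : B.Field) :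
    B.tilt00 c f v = ∑ i₃, B.weight00 c i₃ v * f i₃ v := by
  rw [tilt00, tiltSum, Finset.sum_div]
  exact Finset.sum_congr rfl fun i₃ _ => by rw [weight00]; ring

lemma sum_weight00 (v : B.Field) : ∑ i₃, B.weight00 c i₃ v = 1 := by
  simp only [weight00, ← Finset.sum_div]
  exact div_self (sum_exp_pos _ _ v).ne'

lemma sum_weight0 (i₃ : Fin B.l) (v : B.Field) : ∑ i₁, ∑ i₂, B.weight0 i₁ i₂ i₃ v = 1 := by
  have h1 : ∀ i₁, 0 < ∑ i₂, Real.exp (B.lnA i₁ i₃ i₂ v) := fun i₁ => by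
    simpa using sum_exp_pos 1 (B.lnA i₁ i₃) v
  simp only [weight0, ← Finset.mul_sum, ← Finset.sum_div]
  simp only [div_self (h1 _).ne', mul_one, ← Finset.sum_div]
  exact div_self (sum_exp_pos _ _ v).ne'

lemma weight0_nonneg (i₁ i₂ i₃ : Fin B.l) (v : B.Field) : 0 ≤ B.weight0 i₁ i₂ i₃ v := by
  unfold weight0; positivity

lemma weight00_nonneg (i₃ : Fin B.l) (v : B.Field) : 0 ≤ B.weight00 c i₃ v := by
  unfold weight00; positivity

lemma tameFn_tilt1 (hs : B.s ≠ 0) (i₃ : Fin B.l) {f : B.Field → ℝ} (hf : TameFn f) :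
    TameFn (B.tilt1 c i₃ f) :=
  (B.driven_lvl_const (l := pure 0) c 1).tameFn_tilt (linTame_lnZ hs i₃) _ hf

lemma tameFn_tilt00 (hs : B.s ≠ 0) (hm : c.m 1 ≠ 0) {f : Fin B.l → B.Field → ℝ}
    (hf : ∀ i₃, TameFn (f i₃)) : TameFn (B.tilt00 c f) :=
  LinTame.tameFn_tiltSum (fun i₃ => linTame_freeH hs hm i₃) _ hf

lemma tilt1_sum (hs : B.s ≠ 0) (i₃ : Fin B.l) {ι : Type*} (s : Finset ι) {f : ι → B.Field → ℝ}
    (hf : ∀ i ∈ s, TameFn (f i)) (v : B.Field) :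
    B.tilt1 c i₃ (fun v => ∑ i ∈ s, f i v) v = ∑ i ∈ s, B.tilt1 c i₃ (f i) v :=
  (B.driven_lvl_const (l := pure 0) c 1).tilt_sum (linTame_lnZ hs i₃) _ s hf v

lemma tilt1_const_mul (i₃ : Fin B.l) (b : ℝ) (f : B.Field → ℝ) (v : B.Field) :
    B.tilt1 c i₃ (fun v => b * f v) v = b * B.tilt1 c i₃ f v := tilt_const_mul ..

lemma tilt1_const (hs : B.s ≠ 0) (i₃ : Fin B.l) (b : ℝ) (v : B.Field) :
    B.tilt1 c i₃ (fun _ => b) v = b :=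
  (B.driven_lvl_const (l := pure 0) c 1).tilt_const (linTame_lnZ hs i₃) _ b v

lemma tilt00_const (b : ℝ) (v : B.Field) : B.tilt00 c (fun _ _ => b) v = b := by
  rw [tilt00_eq_sum, ← Finset.sum_mul, sum_weight00, one_mul]

/-! ### Linearity, positivity and normalization of the operators `Φ` -/

section TiltX

lemma sum_rotate (F : Fin B.l → Fin B.l → Fin B.l → ℝ) :
    ∑ i, ∑ j, ∑ k, F i j k = ∑ k, ∑ i, ∑ j, F i j k :=
  (Finset.sum_congr rfl fun _ _ => Finset.sum_comm).trans Finset.sum_comm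

lemma tameFn_tiltX (hp : B.p ≠ 0) (hs : B.s ≠ 0) (hc : c.Regular r) {k : ℕ} (hk : k ≤ r)
    {f : B.Field → ℝ} (hf : TameFn f) : TameFn (B.tiltX c k f) :=
  (B.driven_lvl_const (l := pure 0) c k).tameFn_tilt (linTame_freeX hp hs hc _ (by omega)) _ hf

lemma tiltX_sum (hp : B.p ≠ 0) (hs : B.s ≠ 0) (hc : c.Regular r) {k : ℕ} (hk : k ≤ r)
    {ι : Type*} (s : Finset ι) {f : ι → B.Field → ℝ} (hf : ∀ i ∈ s, TameFn (f i)) (v : B.Field) :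
    B.tiltX c k (fun v => ∑ i ∈ s, f i v) v = ∑ i ∈ s, B.tiltX c k (f i) v :=
  (B.driven_lvl_const (l := pure 0) c k).tilt_sum (linTame_freeX hp hs hc _ (by omega)) _ s hf v

lemma tiltX_add (hp : B.p ≠ 0) (hs : B.s ≠ 0) (hc : c.Regular r) {k : ℕ} (hk : k ≤ r)
    {f g : B.Field → ℝ} (hf : TameFn f) (hg : TameFn g) (v : B.Field) :
    B.tiltX c k (fun v => f v + g v) v = B.tiltX c k f v + B.tiltX c k g v :=
  (B.driven_lvl_const (l := pure 0) c k).tilt_add (linTame_freeX hp hs hc _ (by omega)) _ hf hg v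

lemma tiltX_const_mul (k : ℕ) (b : ℝ) (f : B.Field → ℝ) (v : B.Field) :
    B.tiltX c k (fun v => b * f v) v = b * B.tiltX c k f v := tilt_const_mul ..

lemma tiltX_const (hp : B.p ≠ 0) (hs : B.s ≠ 0) (hc : c.Regular r) {k : ℕ} (hk : k ≤ r) (b : ℝ)
    (v : B.Field) : B.tiltX c k (fun _ => b) v = b :=
  (B.driven_lvl_const (l := pure 0) c k).tilt_const (linTame_freeX hp hs hc _ (by omega)) _ b v

lemma tiltX_quad (hp : B.p ≠ 0) (hs : B.s ≠ 0) (hc : c.Regular r) {k : ℕ} (hk : k ≤ r)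
    (Q : B.Field →₀ ℝ) {φ : B.Field → B.Field → ℝ} (hφ : ∀ w, TameFn (φ w)) (v : B.Field) :
    B.tiltX c k (fun v => quad Q fun w => φ w v) v = quad Q fun w => B.tiltX c k (φ w) v :=
  (B.driven_lvl_const (l := pure 0) c k).tilt_quad (linTame_freeX hp hs hc _ (by omega)) _ Q hφ v

lemma tiltX_nonneg (k : ℕ) {f : B.Field → ℝ} (hf : ∀ v, 0 ≤ f v) (v : B.Field) :
    0 ≤ B.tiltX c k f v := tilt_nonneg _ hf v

lemma tiltProd_of_lt {j k : ℕ} (h : k < j) (f : B.Field → ℝ) : B.tiltProd c j f k = f := by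
  cases k with
  | zero => rfl
  | succ k => rw [tiltProd, if_neg (by omega)]

lemma tiltProd_succ {j k : ℕ} (h : j ≤ k + 1) (f : B.Field → ℝ) :
    B.tiltProd c j f (k + 1) = B.tiltX c (k + 1) (B.tiltProd c j f k) := by
  rw [tiltProd, if_pos h]

lemma tameFn_tiltProd (hp : B.p ≠ 0) (hs : B.s ≠ 0) (hc : c.Regular r) {k : ℕ} (hk : k ≤ r)
    (j : ℕ) {f : B.Field → ℝ} (hf : TameFn f) : TameFn (B.tiltProd c j f k) := by
  induction k with
  | zero => exact hf
  | succ k ih =>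
    rw [tiltProd]
    split_ifs
    · exact tameFn_tiltX hp hs hc hk (ih (by omega))
    · exact hf

lemma tiltProd_sum (hp : B.p ≠ 0) (hs : B.s ≠ 0) (hc : c.Regular r) {k : ℕ} (hk : k ≤ r)
    (j : ℕ) {ι : Type*} (s : Finset ι) {f : ι → B.Field → ℝ} (hf : ∀ i ∈ s, TameFn (f i))
    (v : B.Field) :
    B.tiltProd c j (fun v => ∑ i ∈ s, f i v) k v = ∑ i ∈ s, B.tiltProd c j (f i) k v := by
  induction k generalizing v with
  | zero => rfl
  | succ k ih =>
    simp only [tiltProd]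
    split_ifs
    · rw [show B.tiltProd c j (fun v => ∑ i ∈ s, f i v) k = _ from funext (ih (by omega)),
        tiltX_sum hp hs hc hk s fun i hi => tameFn_tiltProd hp hs hc (by omega) j (hf i hi)]
    · rfl

lemma tiltProd_add (hp : B.p ≠ 0) (hs : B.s ≠ 0) (hc : c.Regular r) {k : ℕ} (hk : k ≤ r)
    (j : ℕ) {f g : B.Field → ℝ} (hf : TameFn f) (hg : TameFn g) (v : B.Field) :
    B.tiltProd c j (fun v => f v + g v) k v = B.tiltProd c j f k v + B.tiltProd c j g k v := by
  -- The sum of two functions is treated as a finite sum indexed by `Bool`.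
  have := tiltProd_sum (c := c) hp hs hc hk j Finset.univ
    (f := fun b : Bool => if b then f else g) (by simp [hf, hg]) v
  simpa using this

lemma tiltProd_const_mul (j k : ℕ) (b : ℝ) (f : B.Field → ℝ) (v : B.Field) :
    B.tiltProd c j (fun v => b * f v) k v = b * B.tiltProd c j f k v := by
  induction k generalizing v with
  | zero => rfl
  | succ k ih =>
    simp only [tiltProd]
    split_ifs
    · rw [show B.tiltProd c j (fun v => b * f v) k = _ from funext ih, tiltX_const_mul]
    · rfl

lemma tiltProd_const (hp : B.p ≠ 0) (hs : B.s ≠ 0) (hc : c.Regular r) {k : ℕ} (hk : k ≤ r)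
    (j : ℕ) (b : ℝ) (v : B.Field) : B.tiltProd c j (fun _ => b) k v = b := by
  induction k generalizing v with
  | zero => rfl
  | succ k ih =>
    simp only [tiltProd]
    split_ifs
    · rw [show B.tiltProd c j (fun _ => b) k = _ from funext (ih (by omega)),
        tiltX_const hp hs hc hk]
    · rfl

lemma tiltProd_nonneg (j k : ℕ) {f : B.Field → ℝ} (hf : ∀ v, 0 ≤ f v) (v : B.Field) :
    0 ≤ B.tiltProd c j f k v := by
  induction k generalizing v with
  | zero => exact hf v
  | succ k ih =>
    rw [tiltProd]
    split_ifs
    · exact tiltX_nonneg _ ih v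
    · exact hf v

lemma tameFn_replicaWeight (hp : B.p ≠ 0) (hs : B.s ≠ 0) (hc : c.Regular r) (hr : 1 ≤ r) {k : ℕ}
    (hk : k ≤ r) (a : Fin B.l × Fin B.l × Fin B.l) : TameFn (B.replicaWeight c k a) :=
  tameFn_tiltProd hp hs hc hk 2
    ((tameFn_weight00 hs (hc 1 le_rfl hr) _).mul (tameFn_tilt1 hs _ (tameFn_weight0 _ _ _)))

lemma replicaWeight_nonneg (k : ℕ) (a : Fin B.l × Fin B.l × Fin B.l) (v : B.Field) :
    0 ≤ B.replicaWeight c k a v :=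
  tiltProd_nonneg _ _ (fun v => mul_nonneg (weight00_nonneg _ v)
    (tilt_nonneg _ (weight0_nonneg _ _ _) v)) v

/-- Every operator in the composition preserves constants, and the weights `γ₀` and `γ₀₀` each sum
to one. -/
lemma sum_replicaWeight (hp : B.p ≠ 0) (hs : B.s ≠ 0) (hc : c.Regular r) (hr : 1 ≤ r) {k : ℕ}
    (hk : k ≤ r) (v : B.Field) : ∑ a, B.replicaWeight c k a v = 1 := by
  have ht : ∀ i₁ i₂ i₃ : Fin B.l, TameFn (B.weight0 i₁ i₂ i₃) := tameFn_weight0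
  unfold replicaWeight
  rw [← tiltProd_sum hp hs hc hk 2 Finset.univ fun a _ =>
    (tameFn_weight00 hs (hc 1 le_rfl hr) _).mul (tameFn_tilt1 hs _ (ht _ _ _))]
  have e : (fun v => ∑ a : Fin B.l × Fin B.l × Fin B.l, B.weight00 c a.2.2 v *
      B.tilt1 c a.2.2 (B.weight0 a.1 a.2.1 a.2.2) v) = fun _ => 1 := by
    funext v
    simp only [Fintype.sum_prod_type]
    have e1 : ∀ i₃, ∑ i₁, ∑ i₂, B.tilt1 c i₃ (B.weight0 i₁ i₂ i₃) v = 1 := fun i₃ => by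
      have h1 := tilt1_const (c := c) hs i₃ 1 v
      rw [show (fun _ : B.Field => (1 : ℝ)) = _ from (funext (sum_weight0 i₃)).symm, tilt1_sum hs i₃
        Finset.univ fun i₁ _ => TameFn.sum _ fun i₂ _ => ht i₁ i₂ i₃] at h1
      rw [← h1]
      exact Finset.sum_congr rfl fun i₁ _ => (tilt1_sum hs i₃ _ (fun i₂ _ => ht i₁ i₂ i₃) v).symm
    calc ∑ i₁, ∑ i₂, ∑ i₃, B.weight00 c i₃ v * B.tilt1 c i₃ (B.weight0 i₁ i₂ i₃) v
        = ∑ i₃, B.weight00 c i₃ v * ∑ i₁, ∑ i₂, B.tilt1 c i₃ (B.weight0 i₁ i₂ i₃) v := by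
          simp only [Finset.mul_sum]
          exact sum_rotate _
      _ = 1 := by simp only [e1, mul_one, sum_weight00]
  rw [e]
  exact tiltProd_const hp hs hc hk 2 1 v

end TiltX

/-! ### The outermost expectation over `G` and `U_{r+1}` -/

section TopMean

lemma topMean_sum (c : Par) (r : ℕ) {ι : Type*} (s : Finset ι) {f : ι → B.Field → ℝ}
    (hf : ∀ i ∈ s, TameFn (f i)) :
    B.topMean c r (fun v => ∑ i ∈ s, f i v) = ∑ i ∈ s, B.topMean c r (f i) := by
  have hd := B.driven_lvl_const (l := pure 0) c (r + 1)
  unfold topMean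
  rw [show smear B.levelLaw (B.lvl c (r + 1)) (fun v => ∑ i ∈ s, f i v) = _ from
    funext (hd.smear_sum s hf)]
  exact (B.driven_matField_const (l := pure 0) c).smear_sum s
    (fun i hi => hd.tameFn_smear (hf i hi)) 0

lemma topMean_add (c : Par) (r : ℕ) {f g : B.Field → ℝ} (hf : TameFn f) (hg : TameFn g) :
    B.topMean c r (fun v => f v + g v) = B.topMean c r f + B.topMean c r g := by
  have := topMean_sum c r Finset.univ (f := fun b : Bool => if b then f else g) (by simp [hf, hg])
  simpa using this

lemma topMean_const_mul (c : Par) (r : ℕ) (b : ℝ) (f : B.Field → ℝ) :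
    B.topMean c r (fun v => b * f v) = b * B.topMean c r f := by
  unfold topMean
  rw [show smear B.levelLaw (B.lvl c (r + 1)) (fun v => b * f v) = _ from
    funext (smear_const_mul b f)]
  exact smear_const_mul ..

lemma topMean_const (c : Par) (r : ℕ) (b : ℝ) : B.topMean c r (fun _ => b) = b := by
  simp [topMean, smear]

lemma topMean_nonneg (c : Par) (r : ℕ) {f : B.Field → ℝ} (hf : ∀ v, 0 ≤ f v) :
    0 ≤ B.topMean c r f :=
  integral_nonneg fun _ => integral_nonneg fun _ => hf _

end TopMean

/-! ### The three kinds of two-replica averages -/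

section Averages

/-- Averages with respect to the product of two replicas at level `k`. -/
def pairAvg (B : Blirp n) (c : Par) (k : ℕ) (F : Fin B.l → Fin B.l → Fin B.l → Fin B.l → ℝ)
    (v : B.Field) : ℝ :=
  ∑ a : Fin B.l × Fin B.l × Fin B.l, ∑ b : Fin B.l × Fin B.l × Fin B.l,
    F a.1 a.2.1 b.1 b.2.1 * (B.replicaWeight c k a v * B.replicaWeight c k b v)

/-- Averages with respect to two replicas with common `i₃` and `U_1`. -/
def innerAvg (B : Blirp n) (c : Par) (F : Fin B.l → Fin B.l → Fin B.l → Fin B.l → ℝ)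
    (v : B.Field) : ℝ :=
  ∑ a : Fin B.l × Fin B.l, ∑ b : Fin B.l × Fin B.l, ∑ i₃, F a.1 a.2 b.1 b.2 *
    (B.weight00 c i₃ v *
      B.tilt1 c i₃ (fun v => B.weight0 a.1 a.2 i₃ v * B.weight0 b.1 b.2 i₃ v) v)

/-- Averages with respect to two replicas with common `i₃` and independent `U_1`. -/
def splitAvg (B : Blirp n) (c : Par) (F : Fin B.l → Fin B.l → Fin B.l → Fin B.l → ℝ)
    (v : B.Field) : ℝ :=
  ∑ a : Fin B.l × Fin B.l, ∑ b : Fin B.l × Fin B.l, ∑ i₃, F a.1 a.2 b.1 b.2 *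
    (B.weight00 c i₃ v *
      (B.tilt1 c i₃ (B.weight0 a.1 a.2 i₃) v * B.tilt1 c i₃ (B.weight0 b.1 b.2 i₃) v))

lemma tameFn_inner (hs : B.s ≠ 0) (hm : c.m 1 ≠ 0) (a b : Fin B.l × Fin B.l) (i₃ : Fin B.l) :
    TameFn fun v => B.weight00 c i₃ v *
      B.tilt1 c i₃ (fun v => B.weight0 a.1 a.2 i₃ v * B.weight0 b.1 b.2 i₃ v) v :=
  (tameFn_weight00 hs hm _).mul (tameFn_tilt1 hs _ ((tameFn_weight0 _ _ _).mul (tameFn_weight0 _ _ _)))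

lemma tameFn_split (hs : B.s ≠ 0) (hm : c.m 1 ≠ 0) (a b : Fin B.l × Fin B.l) (i₃ : Fin B.l) :
    TameFn fun v => B.weight00 c i₃ v *
      (B.tilt1 c i₃ (B.weight0 a.1 a.2 i₃) v * B.tilt1 c i₃ (B.weight0 b.1 b.2 i₃) v) :=
  (tameFn_weight00 hs hm _).mul ((tameFn_tilt1 hs _ (tameFn_weight0 _ _ _)).mul
    (tameFn_tilt1 hs _ (tameFn_weight0 _ _ _)))

lemma tameFn_pairAvg (hp : B.p ≠ 0) (hs : B.s ≠ 0) (hc : c.Regular r) (hr : 1 ≤ r) {k : ℕ}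
    (hk : k ≤ r) (F : Fin B.l → Fin B.l → Fin B.l → Fin B.l → ℝ) : TameFn (B.pairAvg c k F) :=
  TameFn.sum _ fun a _ => TameFn.sum _ fun b _ => ((tameFn_replicaWeight hp hs hc hr hk a).mul
    (tameFn_replicaWeight hp hs hc hr hk b)).const_mul _

lemma tameFn_innerAvg (hs : B.s ≠ 0) (hm : c.m 1 ≠ 0)
    (F : Fin B.l → Fin B.l → Fin B.l → Fin B.l → ℝ) : TameFn (B.innerAvg c F) :=
  TameFn.sum _ fun a _ => TameFn.sum _ fun b _ => TameFn.sum _ fun i₃ _ =>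
    (tameFn_inner hs hm a b i₃).const_mul _

lemma tameFn_splitAvg (hs : B.s ≠ 0) (hm : c.m 1 ≠ 0)
    (F : Fin B.l → Fin B.l → Fin B.l → Fin B.l → ℝ) : TameFn (B.splitAvg c F) :=
  TameFn.sum _ fun a _ => TameFn.sum _ fun b _ => TameFn.sum _ fun i₃ _ =>
    (tameFn_split hs hm a b i₃).const_mul _

/-- By linearity the finite sums over replicas move inside the operators, so an average is a
composition of operators applied to a single function of the field. This is the shape in which the
derivative formula delivers it. -/
lemma avg_ge_two_eq (hp : B.p ≠ 0) (hs : B.s ≠ 0) (hc : c.Regular r)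
    (hD : B.FieldRep c r G D) {j : ℕ} (hj : 1 ≤ j) (hjr : j ≤ r)
    (F : Fin B.l → Fin B.l → Fin B.l → Fin B.l → ℝ) (U : B.Noise) :
    B.avg c.m D r (j + 1) F U = B.tiltProd c (j + 1) (B.pairAvg c j F) r (B.rest c r G r U) := by
  have hr : 1 ≤ r := hj.trans hjr
  have ht := fun a => tameFn_replicaWeight (c := c) hp hs hc hr hjr a
  unfold pairAvg
  rw [avg, if_neg (by omega), tiltProd_sum hp hs hc le_rfl _ _ fun a _ =>
    TameFn.sum _ fun b _ => ((ht a).mul (ht b)).const_mul _]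
  rw [Finset.sum_congr rfl fun a _ => tiltProd_sum hp hs hc le_rfl _ _ (fun b _ =>
    ((ht a).mul (ht b)).const_mul _) _]
  simp only [tiltProd_const_mul, Fintype.sum_prod_type]
  refine Finset.sum_congr rfl fun i₁ _ => Finset.sum_congr rfl fun i₂ _ =>
    Finset.sum_congr rfl fun i₃ _ => Finset.sum_congr rfl fun p₁ _ => Finset.sum_congr rfl
    fun p₂ _ => Finset.sum_congr rfl fun p₃ _ => ?_
  rw [mul_comm]
  congr 1
  exact PhiProd_eq hp hs hc hD hj (fun U => by
    rw [Nat.add_sub_cancel, replica_eq hp hs hc hD hj hjr, replica_eq hp hs hc hD hj hjr])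
    r hjr le_rfl U

lemma avg_one_eq (hp : B.p ≠ 0) (hs : B.s ≠ 0) (hc : c.Regular r) (hr : 1 ≤ r)
    (hD : B.FieldRep c r G D)
    (F : Fin B.l → Fin B.l → Fin B.l → Fin B.l → ℝ) (U : B.Noise) :
    B.avg c.m D r 1 F U = B.tiltProd c 2 (B.innerAvg c F) r (B.rest c r G r U) := by
  have hm := hc 1 le_rfl hr
  have ht := fun a b i₃ => tameFn_inner (c := c) hs hm a b i₃
  unfold innerAvg
  rw [avg, if_pos rfl, tiltProd_sum hp hs hc le_rfl _ _ fun a _ =>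
    TameFn.sum _ fun b _ => TameFn.sum _ fun i₃ _ => (ht a b i₃).const_mul _]
  rw [Finset.sum_congr rfl fun a _ => tiltProd_sum hp hs hc le_rfl _ _ (fun b _ =>
    TameFn.sum _ fun i₃ _ => (ht a b i₃).const_mul _) _]
  rw [Finset.sum_congr rfl fun a _ => Finset.sum_congr rfl fun b _ =>
    tiltProd_sum hp hs hc le_rfl _ _ (fun i₃ _ => (ht a b i₃).const_mul _) _]
  simp only [tiltProd_const_mul, Fintype.sum_prod_type]
  refine Finset.sum_congr rfl fun i₁ _ => Finset.sum_congr rfl fun i₂ _ =>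
    Finset.sum_congr rfl fun p₁ _ => Finset.sum_congr rfl
    fun p₂ _ => Finset.sum_congr rfl fun i₃ _ => ?_
  rw [mul_comm]
  congr 1
  exact PhiProd_eq hp hs hc hD le_rfl (fun U => by
    rw [gamma00_eq hs hm hD, Phi1_eq hs hm hD i₃
      (f := fun v => B.weight0 i₁ i₂ i₃ v * B.weight0 p₁ p₂ i₃ v) fun U => by
        rw [gamma0_eq hs hD, gamma0_eq hs hD]]) r hr le_rfl U

lemma avg22_eq (hp : B.p ≠ 0) (hs : B.s ≠ 0) (hc : c.Regular r) (hr : 1 ≤ r)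
    (hD : B.FieldRep c r G D)
    (F : Fin B.l → Fin B.l → Fin B.l → Fin B.l → ℝ) (U : B.Noise) :
    B.avg22 c.m D r F U = B.tiltProd c 2 (B.splitAvg c F) r (B.rest c r G r U) := by
  have hm := hc 1 le_rfl hr
  have ht := fun a b i₃ => tameFn_split (c := c) hs hm a b i₃
  unfold splitAvg
  rw [avg22, tiltProd_sum hp hs hc le_rfl _ _ fun a _ =>
    TameFn.sum _ fun b _ => TameFn.sum _ fun i₃ _ => (ht a b i₃).const_mul _]
  rw [Finset.sum_congr rfl fun a _ => tiltProd_sum hp hs hc le_rfl _ _ (fun b _ =>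
    TameFn.sum _ fun i₃ _ => (ht a b i₃).const_mul _) _]
  rw [Finset.sum_congr rfl fun a _ => Finset.sum_congr rfl fun b _ =>
    tiltProd_sum hp hs hc le_rfl _ _ (fun i₃ _ => (ht a b i₃).const_mul _) _]
  simp only [tiltProd_const_mul, Fintype.sum_prod_type]
  refine Finset.sum_congr rfl fun i₁ _ => Finset.sum_congr rfl fun i₂ _ =>
    Finset.sum_congr rfl fun p₁ _ => Finset.sum_congr rfl
    fun p₂ _ => Finset.sum_congr rfl fun i₃ _ => ?_
  rw [mul_comm]
  congr 1
  exact PhiProd_eq hp hs hc hD le_rfl (fun U => by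
    rw [gamma00_eq hs hm hD, Phi1_eq hs hm hD i₃ fun U => gamma0_eq hs hD _ _ _ U,
      Phi1_eq hs hm hD i₃ fun U => gamma0_eq hs hD _ _ _ U]) r hr le_rfl U

end Averages

end

/-! #### The parameters of the interpolating functions -/

section Params

variable {n : ℕ}

/-- The parameters of `ψ`. -/
def parOf (Λ : Lifting) (t : ℝ) : Par where
  u4 k := t * (Λ.p (k - 1) * Λ.q (k - 1) - Λ.p k * Λ.q k)
  u2 k := (1 - t) * (Λ.p (k - 1) - Λ.p k)
  h k := (1 - t) * (Λ.q (k - 1) - Λ.q k)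
  g := t
  m := Λ.m

/-- The parameters of `ψ_S`. -/
def parS (Λ : Lifting) (t : ℝ) : Par := { parOf Λ t with u4 := 0 }

variable {B : Blirp n} {r : ℕ} {Λ : Lifting} {t : ℝ}

lemma fieldRep_D0S (hx : ∀ i, ‖B.x i‖ = 1) (hy : ∀ i, ‖B.y i‖ = 1) (ht : t ∈ Set.Icc (0 : ℝ) 1)
    (G : Fin B.m → Fin n → ℝ) : B.FieldRep (parS Λ t) r G (B.D0S r Λ t G) := by
  intro U i₁ i₂ i₃
  have h1 : 0 ≤ 1 - t := by linarith [ht.2]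
  simp only [D0S, hx, hy, rest, matField, lvl, parS, parOf, Pi.add_apply, Finset.sum_apply,
    Pi.zero_apply, Real.sqrt_zero, zero_mul, zero_add, mul_one, Real.sqrt_mul h1,
    Finset.sum_add_distrib, dotProduct_sum, sum_dotProduct, dotProduct_smul, smul_dotProduct,
    smul_eq_mul, Finset.mul_sum, mul_assoc, add_assoc]

/-- Unit norms remove the prefactors, and for `t` in the unit interval the root of `t` or `1 - t`
times a difference of lifting parameters splits, so each coefficient is the root of one variance. -/
lemma fieldRep_D0 (hx : ∀ i, ‖B.x i‖ = 1) (hy : ∀ i, ‖B.y i‖ = 1) (ht : t ∈ Set.Icc (0 : ℝ) 1)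
    (G : Fin B.m → Fin n → ℝ) : B.FieldRep (parOf Λ t) r G (B.D0 r Λ t G) := by
  intro U i₁ i₂ i₃
  have h1 : 0 ≤ 1 - t := by linarith [ht.2]
  simp only [D0, D0S, hx, hy, rest, matField, lvl, parOf, Pi.add_apply, Finset.sum_apply,
    zero_add, mul_one, Real.sqrt_mul h1, Real.sqrt_mul ht.1,
    Finset.sum_add_distrib, dotProduct_sum, sum_dotProduct, dotProduct_smul, smul_dotProduct,
    smul_eq_mul, Finset.mul_sum, mul_assoc]
  ring

/-- The mean free energy, as a function of the parameters. -/
def meanFree (B : Blirp n) (r : ℕ) (c : Par) : ℝ :=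
  1 / (B.p * |B.s| * √n) * B.topMean c r (B.freeX c r)

lemma EGU_log_zeta [Nonempty (Fin B.l)] {c : Par} (hp : B.p ≠ 0) (hs : B.s ≠ 0)
    (hc : c.Regular r) (hr : 1 ≤ r)
    {D : (Fin B.m → Fin n → ℝ) → B.Noise → Fin B.l → Fin B.l → Fin B.l → ℝ}
    (hD : ∀ G, B.FieldRep c r G (D G)) :
    B.EGU r (fun G U => 1 / (B.p * |B.s| * √n * c.m r) * Real.log (B.zeta c.m (D G) r U)) =
      B.meanFree r c := by
  have hm := hc r hr le_rfl
  rw [meanFree, ← topMean_const_mul]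
  refine EGU_eq (c := c) fun G U => ?_
  rw [zeta_eq hp hs hc (hD G) r hr le_rfl, Real.log_exp]
  field_simp

lemma psi_eq [Nonempty (Fin B.l)] (hp : B.p ≠ 0) (hs : B.s ≠ 0)
    (hΛ : (parOf Λ t).Regular r) (hr : 1 ≤ r) (hx : ∀ i, ‖B.x i‖ = 1) (hy : ∀ i, ‖B.y i‖ = 1)
    (ht : t ∈ Set.Icc (0 : ℝ) 1) : B.psi r Λ t = B.meanFree r (parOf Λ t) :=
  EGU_log_zeta hp hs hΛ hr (fieldRep_D0 hx hy ht)

lemma psiS_eq [Nonempty (Fin B.l)] (hp : B.p ≠ 0) (hs : B.s ≠ 0)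
    (hΛ : (parOf Λ t).Regular r) (hr : 1 ≤ r) (hx : ∀ i, ‖B.x i‖ = 1) (hy : ∀ i, ‖B.y i‖ = 1)
    (ht : t ∈ Set.Icc (0 : ℝ) 1) : B.psiS r Λ t = B.meanFree r (parS Λ t) :=
  EGU_log_zeta (c := parS Λ t) hp hs hΛ hr (fieldRep_D0S hx hy ht)

lemma meanAvg_succ_eq [Nonempty (Fin B.l)] (hp : B.p ≠ 0) (hs : B.s ≠ 0)
    (hΛ : (parOf Λ t).Regular r) (hx : ∀ i, ‖B.x i‖ = 1) (hy : ∀ i, ‖B.y i‖ = 1)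
    (ht : t ∈ Set.Icc (0 : ℝ) 1) {j : ℕ} (hj : 1 ≤ j) (hjr : j ≤ r)
    (F : Fin B.l → Fin B.l → Fin B.l → Fin B.l → ℝ) :
    B.meanAvg r Λ t (j + 1) F = B.topMean (parOf Λ t) r
      (B.tiltProd (parOf Λ t) (j + 1) (B.pairAvg (parOf Λ t) j F) r) :=
  EGU_eq fun G U => avg_ge_two_eq hp hs hΛ (fieldRep_D0 hx hy ht G) hj hjr F U

lemma meanAvg_one_eq [Nonempty (Fin B.l)] (hp : B.p ≠ 0) (hs : B.s ≠ 0)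
    (hΛ : (parOf Λ t).Regular r) (hr : 1 ≤ r) (hx : ∀ i, ‖B.x i‖ = 1) (hy : ∀ i, ‖B.y i‖ = 1)
    (ht : t ∈ Set.Icc (0 : ℝ) 1) (F : Fin B.l → Fin B.l → Fin B.l → Fin B.l → ℝ) :
    B.meanAvg r Λ t 1 F = B.topMean (parOf Λ t) r
      (B.tiltProd (parOf Λ t) 2 (B.innerAvg (parOf Λ t) F) r) :=
  EGU_eq fun G U => avg_one_eq hp hs hΛ hr (fieldRep_D0 hx hy ht G) F U

lemma meanAvg22_eq [Nonempty (Fin B.l)] (hp : B.p ≠ 0) (hs : B.s ≠ 0)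
    (hΛ : (parOf Λ t).Regular r) (hr : 1 ≤ r) (hx : ∀ i, ‖B.x i‖ = 1) (hy : ∀ i, ‖B.y i‖ = 1)
    (ht : t ∈ Set.Icc (0 : ℝ) 1) (F : Fin B.l → Fin B.l → Fin B.l → Fin B.l → ℝ) :
    B.meanAvg22 r Λ t F = B.topMean (parOf Λ t) r
      (B.tiltProd (parOf Λ t) 2 (B.splitAvg (parOf Λ t) F) r) :=
  EGU_eq fun G U => avg22_eq hp hs hΛ hr (fieldRep_D0 hx hy ht G) F U

end Params

end Blirp

namespace Blirp

open Interp

/-! ### The derivative of the mean free energy -/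

variable {n : ℕ} {B : Blirp n} [Nonempty (Fin B.l)] {r : ℕ}

lemma tendsto_meanFree {l : Filter ℝ} [l.IsCountablyGenerated] [l.NeBot] {c : ℝ → Par} {c₀ : Par}
    (hp : B.p ≠ 0) (hs : B.s ≠ 0) (hr : 1 ≤ r) (hc : Par.Tends c c₀ l r) :
    Tendsto (fun τ => B.meanFree r (c τ)) l (𝓝 (B.meanFree r c₀)) := by
  have h1 := (freeX_tame hp hs hc r hr le_rfl).1
  have h2 := h1.smear (B.driven_lvl (r + 1) (hc.u4 _ (by omega) le_rfl) (hc.u2 _ (by omega) le_rfl)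
    (hc.h _ (by omega) le_rfl))
  have h3 := h2.smear (B.driven_matField hc.g)
  exact (h3.tendsto 0).const_mul _

/-- The last level and the matrix are averaged without a logarithm, so they contribute second
derivatives only and no squares of first derivatives. -/
lemma hasDerivAt_meanFree_aux {c : ℝ → Par} {c' : Par} {t₀ : ℝ} (hp : B.p ≠ 0) (hs : B.s ≠ 0)
    (hr : 1 ≤ r) (hc : Par.HasDeriv c c' t₀ r) :
    HasDerivAt (fun τ => B.meanFree r (c τ))
      (1 / (B.p * |B.s| * √n) * B.topMean (c t₀) r fun v =>
        B.freeXDeriv (c t₀) (B.lvlQ c') c'.m r v +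
          quad (B.matQ c' + B.lvlQ c' (r + 1)) fun w => B.freeX₂ (c t₀) r w v) t₀ := by
  have hr1 : 1 ≤ r + 1 := by omega
  have hj := jet_freeX hp hs hc r hr le_rfl
  have hh := B.heat_lvl (r + 1) (hc.u4 _ hr1 le_rfl).1 (hc.u4 _ hr1 le_rfl).2
      (hc.u2 _ hr1 le_rfl).1 (hc.u2 _ hr1 le_rfl).2 (hc.h _ hr1 le_rfl).1 (hc.h _ hr1 le_rfl).2
  have hg := B.heat_matField hc.g.1 hc.g.2
  refine ((((hj.heat hh).heat hg).slope.hasDerivAt 0).const_mul _).congr_deriv ?_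
  unfold topMean
  congr 2
  have hX₂ := hj.tame₂
  funext v
  rw [← hh.driven.smear_quad _ hX₂, ← hh.driven.smear_add
    (hj.slope.tame_deriv.add (.quad hX₂)) (.quad hX₂)]
  congr 1
  funext v
  rw [quad_add_left]
  ring

/-! #### Regularity -/

variable {c : Par}

lemma tameFn_lnZ₁ (hs : B.s ≠ 0) (i₃ : Fin B.l) (w : B.Field) : TameFn (B.lnZ₁ i₃ w) :=
  (jet_lnZ hs 0 i₃).tame₁ w

lemma tameFn_lnZ₂ (hs : B.s ≠ 0) (i₃ : Fin B.l) (w : B.Field) : TameFn (B.lnZ₂ i₃ w) :=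
  (jet_lnZ hs 0 i₃).tame₂ w

lemma _root_.Interp.TameFn.sq {E : Type*} [NormedAddCommGroup E] {f : E → ℝ} (h : TameFn f) :
    TameFn fun v => f v ^ 2 := by
  simpa only [pow_two] using h.mul h

lemma tameFn_freeH₁ (hs : B.s ≠ 0) (i₃ : Fin B.l) (w : B.Field) : TameFn (B.freeH₁ c i₃ w) :=
  tameFn_tilt1 hs i₃ (tameFn_lnZ₁ hs i₃ w)

lemma tameFn_freeH₂ (hs : B.s ≠ 0) (i₃ : Fin B.l) (w : B.Field) : TameFn (B.freeH₂ c i₃ w) :=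
  (tameFn_tilt1 hs i₃ ((tameFn_lnZ₂ hs i₃ w).add ((tameFn_lnZ₁ hs i₃ w).sq.const_mul _))).sub
    ((tameFn_freeH₁ hs i₃ w).sq.const_mul _)

lemma tameFn_freeX₁ (hp : B.p ≠ 0) (hs : B.s ≠ 0) (hc : c.Regular r) (k : ℕ) (hk : k ≤ r)
    (w : B.Field) : TameFn (B.freeX₁ c k w) := by
  induction k with
  | zero => exact TameFn.const 0
  | succ k ih =>
    cases k with
    | zero => exact (tameFn_tilt00 hs (hc 1 le_rfl hk) fun i₃ => tameFn_freeH₁ hs i₃ w).const_mul _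
    | succ k => exact tameFn_tiltX hp hs hc hk (ih (by omega))

lemma tameFn_freeX₂ (hp : B.p ≠ 0) (hs : B.s ≠ 0) (hc : c.Regular r) (k : ℕ) (hk : k ≤ r)
    (w : B.Field) : TameFn (B.freeX₂ c k w) := by
  induction k with
  | zero => exact TameFn.const 0
  | succ k ih =>
    cases k with
    | zero =>
      have hm := hc 1 le_rfl hk
      exact ((tameFn_tilt00 hs hm fun i₃ => (tameFn_freeH₂ hs i₃ w).add
        ((tameFn_freeH₁ hs i₃ w).sq.const_mul _)).sub
          ((tameFn_tilt00 hs hm fun i₃ => tameFn_freeH₁ hs i₃ w).sq.const_mul _)).const_mul _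
    | succ k =>
      have h1 := (tameFn_freeX₁ hp hs hc (k + 1) (by omega) w).sq.const_mul (c.m (k + 2))
      have h2 := (tameFn_freeX₁ hp hs hc (k + 2) hk w).sq.const_mul (c.m (k + 2))
      exact (tameFn_tiltX hp hs hc hk ((ih (by omega)).add h1)).sub h2

lemma tameFn_freeX_add (hp : B.p ≠ 0) (hs : B.s ≠ 0) (hc : c.Regular r) (k : ℕ) (hk : k ≤ r)
    (a : ℝ) (w : B.Field) : TameFn fun v => B.freeX₂ c k w v + a * B.freeX₁ c k w v ^ 2 :=
  (tameFn_freeX₂ hp hs hc k hk w).add ((tameFn_freeX₁ hp hs hc k hk w).sq.const_mul _)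

lemma _root_.Interp.TameFn.div_const {E : Type*} [NormedAddCommGroup E] {f : E → ℝ} (h : TameFn f)
    (a : ℝ) : TameFn fun v => f v / a := by
  simpa only [div_eq_inv_mul] using h.const_mul a⁻¹

lemma tameFn_freeHDeriv (hs : B.s ≠ 0) (hm : c.m 1 ≠ 0) (Q : ℕ → B.Field →₀ ℝ) (m' : ℕ → ℝ)
    (i₃ : Fin B.l) : TameFn (B.freeHDeriv c Q m' i₃) :=
  (tameFn_tilt1 hs i₃ (.quad fun w => (tameFn_lnZ₂ hs i₃ w).add
    ((tameFn_lnZ₁ hs i₃ w).sq.const_mul _))).add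
    ((((tameFn_tilt1 hs i₃ (linTame_lnZ hs i₃).tame).sub
      (linTame_freeH hs hm i₃).tame).div_const _).const_mul _)

lemma tameFn_freeXDeriv (hp : B.p ≠ 0) (hs : B.s ≠ 0) (hc : c.Regular r) (Q : ℕ → B.Field →₀ ℝ)
    (m' : ℕ → ℝ) (k : ℕ) (hk : k ≤ r) : TameFn (B.freeXDeriv c Q m' k) := by
  induction k with
  | zero => exact TameFn.const 0
  | succ k ih =>
    cases k with
    | zero =>
      have hm := hc 1 le_rfl hk
      exact ((tameFn_tilt00 hs hm fun i₃ => tameFn_freeHDeriv hs hm Q m' i₃).add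
        ((((tameFn_tilt00 hs hm fun i₃ => (linTame_freeH hs hm i₃).tame).sub
          (LinTame.foldSum (fun i₃ => linTame_freeH hs hm i₃)
            (mul_ne_zero hp hm)).tame).div_const _).const_mul _)).const_mul _
    | succ k =>
      exact (tameFn_tiltX hp hs hc hk ((ih (by omega)).add (.quad fun w =>
        tameFn_freeX_add hp hs hc (k + 1) (by omega) _ w))).add
        ((((tameFn_tiltX hp hs hc hk (linTame_freeX hp hs hc (k + 1) (by omega)).tame).sub
          (linTame_freeX hp hs hc (k + 2) hk).tame).div_const _).const_mul _)

/-! #### The dependence on the derivative of the exponents -/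

/-- The free energy up to level `k` does not involve the later exponent `m_j`. -/
lemma freeXDeriv_single_of_lt (hp : B.p ≠ 0) (hs : B.s ≠ 0) (hc : c.Regular r) {j k : ℕ}
    (hjk : k < j) (hk : k ≤ r) (v : B.Field) : B.freeXDeriv c 0 (Pi.single j 1) k v = 0 := by
  induction k generalizing v with
  | zero => rfl
  | succ k ih =>
    cases k with
    | zero =>
      have h1 : (Pi.single j 1 : ℕ → ℝ) 1 = 0 := Pi.single_eq_of_ne (by omega) _
      have h2 : B.freeHDeriv c 0 (Pi.single j 1) = fun _ _ => 0 := by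
        funext i₃ v
        simp only [freeHDeriv, h1, Pi.zero_apply, quad_zero_left, tilt1_const hs]
        ring
      simp only [freeXDeriv, h1, h2, tilt00_const]
      ring
    | succ k =>
      have h1 : (Pi.single j 1 : ℕ → ℝ) (k + 2) = 0 := Pi.single_eq_of_ne (by omega) _
      simp only [freeXDeriv, h1, Pi.zero_apply, quad_zero_left,
        ih (by omega) (by omega), tiltX_const hp hs hc hk]
      ring

/-- The derivative is linear in the pair formed by the covariance derivatives and the exponent
derivatives. Isolating the directions of the single exponents lets stationarity be used for one
`m_k` at a time. -/
lemma freeXDeriv_split (hp : B.p ≠ 0) (hs : B.s ≠ 0) (hc : c.Regular r) (Q : ℕ → B.Field →₀ ℝ)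
    (m' : ℕ → ℝ) (k : ℕ) (hk : 1 ≤ k) (hkr : k ≤ r) (v : B.Field) :
    B.freeXDeriv c Q m' k v = B.freeXDeriv c Q 0 k v +
      ∑ j ∈ Finset.Icc 1 k, m' j * B.freeXDeriv c 0 (Pi.single j 1) k v := by
  induction k, hk using Nat.le_induction generalizing v with
  | base =>
    have h1 : ∀ i₃, B.freeHDeriv c Q m' i₃ v = B.freeHDeriv c Q 0 i₃ v +
        m' 1 * B.freeHDeriv c 0 (Pi.single 1 1) i₃ v := fun i₃ => by
      simp only [freeHDeriv, Pi.zero_apply, quad_zero_left, tilt1_const hs, Pi.single_eq_same]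
      ring
    have h2 : B.tilt00 c (B.freeHDeriv c Q m') v = B.tilt00 c (B.freeHDeriv c Q 0) v +
        m' 1 * B.tilt00 c (B.freeHDeriv c 0 (Pi.single 1 1)) v := by
      simp only [tilt00_eq_sum, h1, mul_add, Finset.sum_add_distrib, Finset.mul_sum]
      congr 1
      exact Finset.sum_congr rfl fun i₃ _ => by ring
    simp only [freeXDeriv, Finset.Icc_self, Finset.sum_singleton, h2, Pi.zero_apply,
      Pi.single_eq_same]
    ring
  | succ k hk ih =>
    obtain ⟨k, rfl⟩ := Nat.exists_eq_add_of_le' hk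
    have hk1 : k + 1 ≤ r := by omega
    have hX : ∀ Q m', TameFn (B.freeXDeriv c Q m' (k + 1)) := fun Q m' =>
      tameFn_freeXDeriv hp hs hc Q m' (k + 1) hk1
    have hq : TameFn fun v => quad (Q (k + 2)) fun w =>
        B.freeX₂ c (k + 1) w v + c.m (k + 2) * B.freeX₁ c (k + 1) w v ^ 2 :=
      .quad fun w => tameFn_freeX_add hp hs hc (k + 1) hk1 _ w
    have e1 : ∀ j ∈ Finset.Icc 1 (k + 1), B.freeXDeriv c 0 (Pi.single j 1) (k + 2) v =
        B.tiltX c (k + 2) (B.freeXDeriv c 0 (Pi.single j 1) (k + 1)) v := fun j hj => by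
      have h1 : (Pi.single j 1 : ℕ → ℝ) (k + 2) = 0 :=
        Pi.single_eq_of_ne (by have := (Finset.mem_Icc.1 hj).2; omega) _
      rw [freeXDeriv]
      simp only [h1, Pi.zero_apply, quad_zero_left, add_zero, zero_mul]
    have e2 : B.freeXDeriv c 0 (Pi.single (k + 2) 1) (k + 2) v =
        (B.tiltX c (k + 2) (B.freeX c (k + 1)) v - B.freeX c (k + 2) v) / c.m (k + 2) := by
      rw [freeXDeriv]
      simp only [freeXDeriv_single_of_lt hp hs hc (show k + 1 < k + 2 by omega) hk1, Pi.zero_apply,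
        quad_zero_left, add_zero, tiltX_const hp hs hc hkr, Pi.single_eq_same, one_mul, zero_add]
    rw [Finset.sum_Icc_succ_top (by omega), e2, Finset.sum_congr rfl fun j hj => by rw [e1 j hj]]
    have e3 : (fun v => B.freeXDeriv c Q m' (k + 1) v + quad (Q (k + 2)) fun w =>
        B.freeX₂ c (k + 1) w v + c.m (k + 2) * B.freeX₁ c (k + 1) w v ^ 2) = fun v =>
        (B.freeXDeriv c Q 0 (k + 1) v + quad (Q (k + 2)) fun w =>
          B.freeX₂ c (k + 1) w v + c.m (k + 2) * B.freeX₁ c (k + 1) w v ^ 2) +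
        ∑ j ∈ Finset.Icc 1 (k + 1), m' j * B.freeXDeriv c 0 (Pi.single j 1) (k + 1) v := by
      funext v
      rw [ih hk1]
      ring
    simp only [freeXDeriv]
    rw [e3, tiltX_add hp hs hc hkr ((hX _ _).add hq)
      (TameFn.sum _ fun j _ => (hX _ _).const_mul _),
      tiltX_sum hp hs hc hkr _ fun j _ => (hX _ _).const_mul _]
    simp only [tiltX_const_mul, Pi.zero_apply, zero_mul, add_zero, add_assoc]

/-! #### The recursion for the derivative in the covariances -/

/-- Half the derivative of the covariance of the levels `k, …, r + 1` and of the matrix term. -/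
def tailQ (B : Blirp n) (c' : Par) (r k : ℕ) : B.Field →₀ ℝ :=
  B.matQ c' + ∑ j ∈ Finset.Icc k (r + 1), B.lvlQ c' j

lemma tailQ_succ {c' : Par} {k : ℕ} (hk : k ≤ r + 1) :
    B.tailQ c' r k = B.lvlQ c' k + B.tailQ c' r (k + 1) := by
  have e : Finset.Icc k (r + 1) = insert k (Finset.Icc (k + 1) (r + 1)) := by
    ext j; simp; omega
  rw [tailQ, tailQ, e, Finset.sum_insert (by simp)]
  abel

/-- The contribution of the innermost levels to the derivative. -/
def baseDeriv (B : Blirp n) (c c' : Par) (r : ℕ) (v : B.Field) : ℝ :=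
  B.p * B.tilt00 c (fun i₃ => B.tilt1 c i₃ fun v => quad (B.tailQ c' r 1) fun w =>
    B.lnZ₂ i₃ w v + c.m 1 * B.lnZ₁ i₃ w v ^ 2) v -
  B.p * c.m 1 * (1 - B.p) *
    B.tilt00 c (fun i₃ v => quad (B.tailQ c' r 2) fun w => B.freeH₁ c i₃ w v ^ 2) v

lemma tameFn_baseDeriv (hs : B.s ≠ 0) (hm : c.m 1 ≠ 0) (c' : Par) :
    TameFn (B.baseDeriv c c' r) :=
  ((tameFn_tilt00 hs hm fun i₃ => tameFn_tilt1 hs i₃ (.quad fun w =>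
    (tameFn_lnZ₂ hs i₃ w).add ((tameFn_lnZ₁ hs i₃ w).sq.const_mul _))).const_mul _).sub
  ((tameFn_tilt00 hs hm fun i₃ => .quad fun w => (tameFn_freeH₁ hs i₃ w).sq).const_mul _)

/-- Summation by parts over the levels. The second derivative at a level is the tilted `X₂ + m X₁²`
of the level below minus `m X₁²` with the same exponent. Adding the next exponent times `X₁²` leaves
a difference of consecutive exponents times the square of first derivatives. The tilted remainder
joins the covariance of this level to the tail, which reproduces the left side one level lower. -/
lemma freeXDeriv_add_tail (hp : B.p ≠ 0) (hs : B.s ≠ 0) (hc : c.Regular r) (c' : Par) (k : ℕ)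
    (hk : 1 ≤ k) (hkr : k ≤ r) (v : B.Field) :
    B.freeXDeriv c (B.lvlQ c') 0 k v + quad (B.tailQ c' r (k + 1)) (fun w =>
        B.freeX₂ c k w v + c.m (k + 1) * B.freeX₁ c k w v ^ 2) =
      B.tiltProd c 2 (B.baseDeriv c c' r) k v + ∑ j ∈ Finset.Icc 1 k, (c.m (j + 1) - c.m j) *
        B.tiltProd c (j + 1) (fun v => quad (B.tailQ c' r (j + 1)) fun w =>
          B.freeX₁ c j w v ^ 2) k v := by
  induction k, hk using Nat.le_induction generalizing v with
  | base =>
    have hd := B.driven_lvl_const (l := pure 0) c 1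
    have hlnZ : ∀ i₃ w, TameFn fun v => B.lnZ₂ i₃ w v + c.m 1 * B.lnZ₁ i₃ w v ^ 2 := fun i₃ w =>
      (tameFn_lnZ₂ hs i₃ w).add ((tameFn_lnZ₁ hs i₃ w).sq.const_mul _)
    have e1 : ∀ (i₃ : Fin B.l) (Q : B.Field →₀ ℝ) (v : B.Field), B.tilt1 c i₃ (fun v => quad Q
        fun w => B.lnZ₂ i₃ w v + c.m 1 * B.lnZ₁ i₃ w v ^ 2) v = quad Q fun w => B.tilt1 c i₃
        (fun v => B.lnZ₂ i₃ w v + c.m 1 * B.lnZ₁ i₃ w v ^ 2) v := fun i₃ Q v =>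
      hd.tilt_quad (linTame_lnZ hs i₃) _ Q (hlnZ i₃) v
    rw [tiltProd_of_lt (by omega), Finset.Icc_self, Finset.sum_singleton,
      tiltProd_of_lt (by omega)]
    -- The innermost level has two folds, over `U_1` and over `i₃`, with exponents `m_1` and `p
    -- m_1`. Their mismatch yields the extra term with the factor `1 - p`.
    have e2 : ∀ w, B.freeX₂ c 1 w v + c.m (1 + 1) * B.freeX₁ c 1 w v ^ 2 =
        (B.p * ∑ i₃, B.weight00 c i₃ v * (B.tilt1 c i₃ (fun v => B.lnZ₂ i₃ w v +
          c.m 1 * B.lnZ₁ i₃ w v ^ 2) v) - B.p * c.m 1 * (1 - B.p) *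
          ∑ i₃, B.weight00 c i₃ v * B.freeH₁ c i₃ w v ^ 2) +
        (c.m 2 - c.m 1) * B.freeX₁ c 1 w v ^ 2 := fun w => by
      have e3 : (∑ i₃, B.weight00 c i₃ v * (B.freeH₂ c i₃ w v +
          B.p * c.m 1 * B.freeH₁ c i₃ w v ^ 2)) =
          (∑ i₃, B.weight00 c i₃ v * (B.tilt1 c i₃ (fun v => B.lnZ₂ i₃ w v +
            c.m 1 * B.lnZ₁ i₃ w v ^ 2) v)) - c.m 1 * (1 - B.p) *
          ∑ i₃, B.weight00 c i₃ v * B.freeH₁ c i₃ w v ^ 2 := by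
        rw [Finset.mul_sum, ← Finset.sum_sub_distrib]
        refine Finset.sum_congr rfl fun i₃ _ => ?_
        rw [freeH₂]
        ring
      simp only [freeX₂, freeX₁, tilt00_eq_sum]
      rw [e3]
      ring
    simp only [e2, quad_add, quad_sub, quad_const_mul, quad_sum]
    simp only [freeXDeriv, freeHDeriv, baseDeriv, tilt00_eq_sum, Pi.zero_apply, zero_mul, add_zero,
      mul_zero, e1]
    simp only [tailQ_succ (B := B) (r := r) (c' := c') (show 1 ≤ r + 1 by omega),
      quad_add_left, mul_add, Finset.sum_add_distrib]
    ring
  | succ k hk ih =>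
    obtain ⟨k, rfl⟩ := Nat.exists_eq_add_of_le' hk
    have hk1 : k + 1 ≤ r := by omega
    have hm := hc 1 le_rfl (by omega)
    have hY := fun w => tameFn_freeX_add hp hs hc (k + 1) hk1 (c.m (k + 2)) w
    have hX : TameFn (B.freeXDeriv c (B.lvlQ c') 0 (k + 1)) :=
      tameFn_freeXDeriv hp hs hc _ _ (k + 1) hk1
    have hT : ∀ j, j ≤ k + 1 → TameFn (B.tiltProd c (j + 1) (fun v =>
        quad (B.tailQ c' r (j + 1)) fun w => B.freeX₁ c j w v ^ 2) (k + 1)) := fun j hj =>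
      tameFn_tiltProd hp hs hc hk1 _ (.quad fun w =>
        (tameFn_freeX₁ hp hs hc j (by omega) w).sq)
    have hbase : TameFn (B.tiltProd c 2 (B.baseDeriv c c' r) (k + 1)) :=
      tameFn_tiltProd hp hs hc hk1 _ (tameFn_baseDeriv hs hm c')
    have e1 : B.freeXDeriv c (B.lvlQ c') 0 (k + 2) v + quad (B.tailQ c' r (k + 3)) (fun w =>
        B.freeX₂ c (k + 2) w v + c.m (k + 3) * B.freeX₁ c (k + 2) w v ^ 2) =
        B.tiltX c (k + 2) (fun v => B.freeXDeriv c (B.lvlQ c') 0 (k + 1) v +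
          quad (B.tailQ c' r (k + 2)) (fun w =>
            B.freeX₂ c (k + 1) w v + c.m (k + 2) * B.freeX₁ c (k + 1) w v ^ 2)) v +
        (c.m (k + 3) - c.m (k + 2)) *
          quad (B.tailQ c' r (k + 3)) fun w => B.freeX₁ c (k + 2) w v ^ 2 := by
      have e2 : ∀ w, B.freeX₂ c (k + 2) w v + c.m (k + 3) * B.freeX₁ c (k + 2) w v ^ 2 =
          B.tiltX c (k + 2) (fun v => B.freeX₂ c (k + 1) w v +
            c.m (k + 2) * B.freeX₁ c (k + 1) w v ^ 2) v +
          (c.m (k + 3) - c.m (k + 2)) * B.freeX₁ c (k + 2) w v ^ 2 := fun w => by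
        rw [freeX₂]
        ring
      simp only [e2, quad_add, quad_const_mul]
      rw [freeXDeriv, ← tiltX_quad hp hs hc hkr _ hY]
      simp only [Pi.zero_apply, zero_mul, add_zero]
      rw [← add_assoc, ← tiltX_add hp hs hc hkr (hX.add (.quad hY)) (.quad hY)]
      congr 2
      funext v
      rw [tailQ_succ (show k + 2 ≤ r + 1 by omega)]
      simp only [quad_add, quad_const_mul, quad_add_left]
      ring
    rw [Finset.sum_Icc_succ_top (by omega), tiltProd_succ (by omega),
      tiltProd_of_lt (show k + 1 + 1 < k + 1 + 1 + 1 by omega), ← add_assoc]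
    refine e1.trans ?_
    congr 1
    rw [show (fun v => B.freeXDeriv c (B.lvlQ c') 0 (k + 1) v + quad (B.tailQ c' r (k + 2))
      (fun w => B.freeX₂ c (k + 1) w v + c.m (k + 2) * B.freeX₁ c (k + 1) w v ^ 2)) = _ from
      funext (ih hk1), tiltX_add hp hs hc hkr hbase (TameFn.sum _ fun j hj =>
        (hT j (Finset.mem_Icc.1 hj).2).const_mul _), tiltX_sum hp hs hc hkr _ fun j hj =>
        (hT j (Finset.mem_Icc.1 hj).2).const_mul _]
    congr 1
    refine Finset.sum_congr rfl fun j hj => ?_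
    rw [tiltX_const_mul, tiltProd_succ (k := k + 1) (by have := (Finset.mem_Icc.1 hj).2; omega)]

end Blirp

namespace Blirp

open Interp

/-! ### The derivative of the mean free energy in terms of the replica averages -/

/-- The square of an average is an average over two independent replicas; contracting with `Q` then
leaves the covariance between the two. -/
lemma quad_sq_sum {E ι : Type*} [NormedAddCommGroup E] [NormedSpace ℝ E]
    [Fintype ι] (Q : E →₀ ℝ) (b : ℝ)
    (x : E → ι → ℝ) (ρ : ι → ℝ) :
    quad Q (fun w => (b * ∑ i, x w i * ρ i) ^ 2) =
      b ^ 2 * ∑ i, ∑ j, quad Q (fun w => x w i * x w j) * (ρ i * ρ j) := by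
  have e : (fun w => (b * ∑ i, x w i * ρ i) ^ 2) = fun w =>
      b ^ 2 * ∑ i, ∑ j, (ρ i * ρ j) * (x w i * x w j) := by
    funext w
    rw [mul_pow, pow_two (∑ i, _), Finset.sum_mul_sum]
    congr 1
    exact Finset.sum_congr rfl fun i _ => Finset.sum_congr rfl fun j _ => by ring
  rw [e, quad_const_mul, quad_sum]
  congr 1
  refine Finset.sum_congr rfl fun i _ => ?_
  rw [quad_sum]
  refine Finset.sum_congr rfl fun j _ => ?_
  rw [quad_const_mul, mul_comm]

lemma tiltSum_eq_sum {E ι : Type*} [Fintype ι] (a : ℝ) (X : ι → E → ℝ)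
    (f : ι → E → ℝ) (v : E) : tiltSum a X f v =
      ∑ i, f i v * (Real.exp (a * X i v) / ∑ j, Real.exp (a * X j v)) := by
  rw [tiltSum, Finset.sum_div]
  exact Finset.sum_congr rfl fun i _ => by ring

variable {n : ℕ} {B : Blirp n} [Nonempty (Fin B.l)] {r : ℕ} {c c' : Par}

/-- The covariance of the field with the covariance form `Q`. -/
def kernel (B : Blirp n) (Q : B.Field →₀ ℝ) (i₁ i₂ p₁ p₂ : Fin B.l) : ℝ :=
  quad Q fun w => w i₁ i₂ * w p₁ p₂

lemma lnC₁_eq (i₃ i₁ : Fin B.l) (w v : B.Field) : B.lnC₁ i₃ i₁ w v =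
    B.β * ∑ i₂, w i₁ i₂ * (Real.exp (1 * B.lnA i₁ i₃ i₂ v) /
      ∑ j, Real.exp (1 * B.lnA i₁ i₃ j v)) := by
  rw [lnC₁, tiltSum_eq_sum, Finset.mul_sum]
  exact Finset.sum_congr rfl fun i _ => by ring

lemma lnZ₁_eq (i₃ : Fin B.l) (w v : B.Field) : B.lnZ₁ i₃ w v =
    B.s * B.β * ∑ a : Fin B.l × Fin B.l, w a.1 a.2 * B.weight0 a.1 a.2 i₃ v := by
  rw [lnZ₁, tiltSum_eq_sum, Fintype.sum_prod_type]
  simp only [lnC₁_eq, Finset.sum_mul, Finset.mul_sum, weight0, one_mul]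
  refine Finset.sum_congr rfl fun i₁ _ => Finset.sum_congr rfl fun i₂ _ => ?_
  ring

lemma freeH₁_eq (hs : B.s ≠ 0) (i₃ : Fin B.l) (w v : B.Field) : B.freeH₁ c i₃ w v =
    B.s * B.β * ∑ a : Fin B.l × Fin B.l, w a.1 a.2 * B.tilt1 c i₃ (B.weight0 a.1 a.2 i₃) v := by
  rw [freeH₁, show B.lnZ₁ i₃ w = _ from funext (lnZ₁_eq i₃ w), tilt1_const_mul,
    tilt1_sum hs i₃ _ fun a _ => (tameFn_weight0 _ _ _).const_mul _]
  simp only [tilt1_const_mul]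

/-- The first derivative of a free energy is the mean of the direction under the measure of one
replica, so squares of first derivatives become averages over replica pairs. -/
lemma freeX₁_eq (hp : B.p ≠ 0) (hs : B.s ≠ 0) (hc : c.Regular r) (k : ℕ) (hk : 1 ≤ k)
    (hkr : k ≤ r) (w v : B.Field) : B.freeX₁ c k w v = B.p * B.s * B.β *
      ∑ a : Fin B.l × Fin B.l × Fin B.l, w a.1 a.2.1 * B.replicaWeight c k a v := by
  induction k, hk using Nat.le_induction generalizing v with
  | base =>
    simp only [freeX₁, tilt00_eq_sum, freeH₁_eq hs, replicaWeight,
      tiltProd_of_lt (show 1 < 2 by omega), Fintype.sum_prod_type]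
    rw [← (sum_rotate fun i₁ i₂ i₃ => w i₁ i₂ * (B.weight00 c i₃ v *
      B.tilt1 c i₃ (B.weight0 i₁ i₂ i₃) v)).symm]
    simp only [Finset.mul_sum]
    refine Finset.sum_congr rfl fun i₃ _ => Finset.sum_congr rfl fun i₁ _ =>
      Finset.sum_congr rfl fun i₂ _ => by ring
  | succ k hk ih =>
    obtain ⟨k, rfl⟩ := Nat.exists_eq_add_of_le' hk
    have ht := fun a => tameFn_replicaWeight (B := B) (k := k + 1) hp hs hc (by omega) (by omega) a
    change B.tiltX c (k + 2) (B.freeX₁ c (k + 1) w) v = _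
    rw [show B.freeX₁ c (k + 1) w = _ from funext (ih (by omega)), tiltX_const_mul,
      tiltX_sum hp hs hc hkr _ fun a _ => (ht a).const_mul _]
    simp only [tiltX_const_mul]
    congr 1

lemma quad_freeX₁_sq (hp : B.p ≠ 0) (hs : B.s ≠ 0) (hc : c.Regular r) (k : ℕ) (hk : 1 ≤ k)
    (hkr : k ≤ r) (Q : B.Field →₀ ℝ) (v : B.Field) :
    (quad Q fun w => B.freeX₁ c k w v ^ 2) =
      (B.p * B.s * B.β) ^ 2 * B.pairAvg c k (B.kernel Q) v := by
  simp only [freeX₁_eq hp hs hc k hk hkr]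
  exact quad_sq_sum Q _ (fun w (a : Fin B.l × Fin B.l × Fin B.l) => w a.1 a.2.1) _

lemma tilt00_quad_freeH₁_sq (hs : B.s ≠ 0) (Q : B.Field →₀ ℝ) (v : B.Field) :
    B.tilt00 c (fun i₃ v => quad Q fun w => B.freeH₁ c i₃ w v ^ 2) v =
      (B.s * B.β) ^ 2 * B.splitAvg c (B.kernel Q) v := by
  simp only [freeH₁_eq hs, tilt00_eq_sum]
  simp only [quad_sq_sum Q _ (fun w (a : Fin B.l × Fin B.l) => w a.1 a.2)]
  simp only [splitAvg]
  rw [Finset.sum_congr rfl fun a _ => Finset.sum_comm, Finset.sum_comm, Finset.mul_sum]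
  refine Finset.sum_congr rfl fun i₃ _ => ?_
  simp only [Finset.mul_sum]
  refine Finset.sum_congr rfl fun a _ => Finset.sum_congr rfl fun b _ => ?_
  simp only [kernel]
  ring

lemma tilt00_tilt1_quad_lnZ₁_sq (hs : B.s ≠ 0) (Q : B.Field →₀ ℝ) (v : B.Field) :
    B.tilt00 c (fun i₃ => B.tilt1 c i₃ fun v => quad Q fun w => B.lnZ₁ i₃ w v ^ 2) v =
      (B.s * B.β) ^ 2 * B.innerAvg c (B.kernel Q) v := by
  have ht : ∀ (i₃ : Fin B.l) (a b : Fin B.l × Fin B.l), TameFn fun v =>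
      B.weight0 a.1 a.2 i₃ v * B.weight0 b.1 b.2 i₃ v := fun i₃ a b =>
    (tameFn_weight0 _ _ _).mul (tameFn_weight0 _ _ _)
  simp only [lnZ₁_eq, tilt00_eq_sum]
  simp only [quad_sq_sum Q _ (fun w (a : Fin B.l × Fin B.l) => w a.1 a.2)]
  simp only [innerAvg]
  rw [Finset.sum_congr rfl fun a _ => Finset.sum_comm, Finset.sum_comm, Finset.mul_sum]
  refine Finset.sum_congr rfl fun i₃ _ => ?_
  rw [tilt1_const_mul, tilt1_sum hs i₃ _ fun a _ => TameFn.sum _ fun b _ => (ht i₃ a b).const_mul _,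
    Finset.sum_congr rfl fun a _ => tilt1_sum hs i₃ _ (fun b _ => (ht i₃ a b).const_mul _) _]
  simp only [tilt1_const_mul, Finset.mul_sum]
  refine Finset.sum_congr rfl fun a _ => Finset.sum_congr rfl fun b _ => ?_
  simp only [kernel]
  ring

/-- Inside `C` both replicas share `i₁`, where the kernel vanishes, so all second order terms from
the sum over `i₂` disappear, as do the squares of derivatives of `log C`. Only the square of the
derivative of `log Z` survives, with the coefficient `m - 1`. -/
lemma quad_lnZ₂_add (Q : B.Field →₀ ℝ) (hQ : ∀ i₁ i₂ p₂, B.kernel Q i₁ i₂ i₁ p₂ = 0)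
    (m : ℝ) (i₃ : Fin B.l) (v : B.Field) :
    (quad Q fun w => B.lnZ₂ i₃ w v + m * B.lnZ₁ i₃ w v ^ 2) =
      -(1 - m) * quad Q fun w => B.lnZ₁ i₃ w v ^ 2 := by
  have h1 : ∀ i₁, (quad Q fun w => B.lnC₁ i₃ i₁ w v ^ 2) = 0 := fun i₁ => by
    simp only [lnC₁_eq]
    rw [quad_sq_sum Q B.β (fun w i₂ => w i₁ i₂)]
    have : ∀ i j, (quad Q fun w => w i₁ i * w i₁ j) = 0 := hQ i₁
    simp [this]
  have h2 : ∀ i₁, (quad Q fun w => tiltSum 1 (B.lnA i₁ i₃)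
      (fun i₂ _ => (B.β * w i₁ i₂) ^ 2) v) = 0 := fun i₁ => by
    have e : ∀ w : B.Field, ∀ i₂, (B.β * w i₁ i₂) ^ 2 * (Real.exp (1 * B.lnA i₁ i₃ i₂ v) /
        ∑ j, Real.exp (1 * B.lnA i₁ i₃ j v)) = B.β ^ 2 * (Real.exp (1 * B.lnA i₁ i₃ i₂ v) /
        ∑ j, Real.exp (1 * B.lnA i₁ i₃ j v)) * (w i₁ i₂ * w i₁ i₂) := fun w i₂ => by ring
    have : ∀ i, (quad Q fun w => w i₁ i * w i₁ i) = 0 := fun i => hQ i₁ i i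
    simp only [tiltSum_eq_sum, e, quad_sum, quad_const_mul, this, mul_zero, Finset.sum_const_zero]
  have h3 : ∀ w, B.lnZ₂ i₃ w v + m * B.lnZ₁ i₃ w v ^ 2 = B.s * (∑ i₁,
      (Real.exp (B.s * B.lnC i₃ i₁ v) / ∑ j, Real.exp (B.s * B.lnC i₃ j v)) *
      (tiltSum 1 (B.lnA i₁ i₃) (fun i₂ _ => (B.β * w i₁ i₂) ^ 2) v +
        (B.s - 1) * B.lnC₁ i₃ i₁ w v ^ 2)) + -(1 - m) * B.lnZ₁ i₃ w v ^ 2 := fun w => by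
    rw [lnZ₂, tiltSum_eq_sum]
    simp only [lnC₂]
    have : ∀ i₁, (tiltSum 1 (B.lnA i₁ i₃) (fun i₂ _ => (B.β * w i₁ i₂) ^ 2) v -
        B.lnC₁ i₃ i₁ w v ^ 2 + B.s * B.lnC₁ i₃ i₁ w v ^ 2) *
        (Real.exp (B.s * B.lnC i₃ i₁ v) / ∑ j, Real.exp (B.s * B.lnC i₃ j v)) =
        (Real.exp (B.s * B.lnC i₃ i₁ v) / ∑ j, Real.exp (B.s * B.lnC i₃ j v)) *
      (tiltSum 1 (B.lnA i₁ i₃) (fun i₂ _ => (B.β * w i₁ i₂) ^ 2) v +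
        (B.s - 1) * B.lnC₁ i₃ i₁ w v ^ 2) := fun i₁ => by ring
    rw [Finset.sum_congr rfl fun i₁ _ => this i₁]
    ring
  simp only [h3, quad_add, quad_const_mul, quad_sum, h1, h2, mul_zero, add_zero,
    Finset.sum_const_zero, zero_add]

lemma baseDeriv_eq (hs : B.s ≠ 0)
    (hQ : ∀ i₁ i₂ p₂, B.kernel (B.tailQ c' r 1) i₁ i₂ i₁ p₂ = 0) (v : B.Field) :
    B.baseDeriv c c' r v = B.p * (B.s * B.β) ^ 2 *
      (-(1 - c.m 1) * B.innerAvg c (B.kernel (B.tailQ c' r 1)) v +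
        -(c.m 1 * (1 - B.p)) * B.splitAvg c (B.kernel (B.tailQ c' r 2)) v) := by
  have e : B.tilt00 c (fun i₃ => B.tilt1 c i₃ fun v => -(1 - c.m 1) * quad (B.tailQ c' r 1)
      fun w => B.lnZ₁ i₃ w v ^ 2) v = -(1 - c.m 1) * B.tilt00 c (fun i₃ => B.tilt1 c i₃ fun v =>
        quad (B.tailQ c' r 1) fun w => B.lnZ₁ i₃ w v ^ 2) v := by
    simp only [tilt00_eq_sum, tilt1_const_mul, Finset.mul_sum]
    exact Finset.sum_congr rfl fun i₃ _ => by ring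
  simp only [baseDeriv, quad_lnZ₂_add _ hQ, e, tilt00_tilt1_quad_lnZ₁_sq hs,
    tilt00_quad_freeH₁_sq hs]
  ring

/-- The contribution of the covariances to the derivative of the mean free energy, for the
kernels `K k` of the levels `k, …, r + 1`. -/
def covDeriv (B : Blirp n) (r : ℕ) (c : Par)
    (K : ℕ → Fin B.l → Fin B.l → Fin B.l → Fin B.l → ℝ) : ℝ :=
  -(1 - c.m 1) * B.topMean c r (B.tiltProd c 2 (B.innerAvg c (K 1)) r) +
    -(c.m 1 * (1 - B.p)) * B.topMean c r (B.tiltProd c 2 (B.splitAvg c (K 2)) r) +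
    ∑ j ∈ Finset.Icc 1 r, (c.m (j + 1) - c.m j) * B.p *
      B.topMean c r (B.tiltProd c (j + 1) (B.pairAvg c j (K (j + 1))) r)

/-- The derivative of the mean free energy in the exponent `m_k`. -/
def expDeriv (B : Blirp n) (r : ℕ) (c : Par) (k : ℕ) : ℝ :=
  1 / (B.p * |B.s| * √n) * B.topMean c r (B.freeXDeriv c 0 (Pi.single k 1) r)

/-- The formula covers every regular curve of parameters whose full covariance derivative vanishes
on equal `i₁`. It is used along the interpolation path and along curves that move one exponent only.
-/
theorem hasDerivAt_meanFree {c : ℝ → Par} {c' : Par} {t₀ : ℝ} (hp : B.p ≠ 0) (hs : B.s ≠ 0)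
    (hr : 1 ≤ r) (hc : Par.HasDeriv c c' t₀ r) (hm : (c t₀).m (r + 1) = 0)
    (hQ : ∀ i₁ i₂ p₂, B.kernel (B.tailQ c' r 1) i₁ i₂ i₁ p₂ = 0) :
    HasDerivAt (fun τ => B.meanFree r (c τ))
      (1 / (B.p * |B.s| * √n) * (B.p * (B.s * B.β) ^ 2) *
          B.covDeriv r (c t₀) (fun k => B.kernel (B.tailQ c' r k)) +
        ∑ k ∈ Finset.Icc 1 r, c'.m k * B.expDeriv r (c t₀) k) t₀ := by
  have hc₀ : (c t₀).Regular r := hc.ne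
  refine (hasDerivAt_meanFree_aux hp hs hr hc).congr_deriv ?_
  generalize c t₀ = c at hm hc₀
  have hm1 := hc₀ 1 le_rfl hr
  have e1 : ∀ v, B.freeXDeriv c (B.lvlQ c') c'.m r v +
      quad (B.matQ c' + B.lvlQ c' (r + 1)) (fun w => B.freeX₂ c r w v) =
      B.p * (B.s * B.β) ^ 2 *
        (-(1 - c.m 1) * B.tiltProd c 2 (B.innerAvg c (B.kernel (B.tailQ c' r 1))) r v +
          -(c.m 1 * (1 - B.p)) *
            B.tiltProd c 2 (B.splitAvg c (B.kernel (B.tailQ c' r 2))) r v +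
        ∑ j ∈ Finset.Icc 1 r, (c.m (j + 1) - c.m j) * B.p *
          B.tiltProd c (j + 1) (B.pairAvg c j (B.kernel (B.tailQ c' r (j + 1)))) r v) +
      ∑ k ∈ Finset.Icc 1 r, c'.m k * B.freeXDeriv c 0 (Pi.single k 1) r v := fun v => by
    have h1 := freeXDeriv_add_tail hp hs hc₀ c' r hr le_rfl v
    have h2 : B.tailQ c' r (r + 1) = B.matQ c' + B.lvlQ c' (r + 1) := by simp [tailQ]
    -- With `m_{r+1} = 0` the tail identity at the top level contains exactly the second derivatives
    -- produced by the plain outermost expectations.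
    simp only [h2, hm, zero_mul, add_zero] at h1
    rw [freeXDeriv_split hp hs hc₀ _ _ r hr le_rfl, add_right_comm, h1,
      show B.baseDeriv c c' r = _ from funext (baseDeriv_eq hs hQ), tiltProd_const_mul,
      tiltProd_add hp hs hc₀ le_rfl _ ((tameFn_innerAvg hs hm1 _).const_mul _)
        ((tameFn_splitAvg hs hm1 _).const_mul _), tiltProd_const_mul, tiltProd_const_mul,
      mul_add, mul_add, mul_add, Finset.mul_sum]
    congr 2
    refine Finset.sum_congr rfl fun j hj => ?_
    rw [show (fun v => quad (B.tailQ c' r (j + 1)) fun w => B.freeX₁ c j w v ^ 2) = _ from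
      funext (quad_freeX₁_sq hp hs hc₀ j (Finset.mem_Icc.1 hj).1 (Finset.mem_Icc.1 hj).2 _),
      tiltProd_const_mul]
    ring
  have t1 := tameFn_tiltProd (k := r) hp hs hc₀ le_rfl 2
    (tameFn_innerAvg hs hm1 (B.kernel (B.tailQ c' r 1)))
  have t2 := tameFn_tiltProd (k := r) hp hs hc₀ le_rfl 2
    (tameFn_splitAvg hs hm1 (B.kernel (B.tailQ c' r 2)))
  have t3 : ∀ j ∈ Finset.Icc 1 r, TameFn fun v => (c.m (j + 1) - c.m j) * B.p *
      B.tiltProd c (j + 1) (B.pairAvg c j (B.kernel (B.tailQ c' r (j + 1)))) r v := fun j hj =>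
    (tameFn_tiltProd (k := r) hp hs hc₀ le_rfl (j + 1) (tameFn_pairAvg hp hs hc₀ hr
      (Finset.mem_Icc.1 hj).2 _)).const_mul _
  have t4 : ∀ k ∈ Finset.Icc 1 r, TameFn fun v =>
      c'.m k * B.freeXDeriv c 0 (Pi.single k 1) r v := fun k _ =>
    (tameFn_freeXDeriv hp hs hc₀ _ _ r le_rfl).const_mul _
  rw [show (fun v => B.freeXDeriv c (B.lvlQ c') c'.m r v + quad (B.matQ c' + B.lvlQ c' (r + 1))
    fun w => B.freeX₂ c r w v) = _ from funext e1,
    topMean_add _ _ ((((t1.const_mul _).add (t2.const_mul _)).add (TameFn.sum _ t3)).const_mul _)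
      (TameFn.sum _ t4), topMean_const_mul,
    topMean_add _ _ ((t1.const_mul _).add (t2.const_mul _)) (TameFn.sum _ t3),
    topMean_add _ _ (t1.const_mul _) (t2.const_mul _), topMean_sum _ _ _ t3, topMean_sum _ _ _ t4]
  simp only [topMean_const_mul, covDeriv, expDeriv, Finset.mul_sum, mul_add, mul_assoc]
  congr 1
  exact Finset.sum_congr rfl fun k _ => by ring

end Blirp

namespace Blirp

open Interp

/-! ### Averages over two replicas -/

variable {n : ℕ} {B : Blirp n} {r : ℕ} {Λ : Lifting} {t : ℝ}

/-- Normalized positive linear functionals on the functions of two replicas. -/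
structure IsAverage (B : Blirp n) (M : (Fin B.l → Fin B.l → Fin B.l → Fin B.l → ℝ) → ℝ) : Prop where
  add : ∀ F G, M (fun i₁ i₂ p₁ p₂ => F i₁ i₂ p₁ p₂ + G i₁ i₂ p₁ p₂) = M F + M G
  const_mul : ∀ (b : ℝ) F, M (fun i₁ i₂ p₁ p₂ => b * F i₁ i₂ p₁ p₂) = b * M F
  one : M (fun _ _ _ _ => 1) = 1
  nonneg : ∀ F, (∀ i₁ i₂ p₁ p₂, 0 ≤ F i₁ i₂ p₁ p₂) → 0 ≤ M F

section IsAverage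

variable {M : (Fin B.l → Fin B.l → Fin B.l → Fin B.l → ℝ) → ℝ}

lemma IsAverage.const (h : B.IsAverage M) (b : ℝ) : M (fun _ _ _ _ => b) = b := by
  simpa [h.one] using h.const_mul b fun _ _ _ _ => 1

lemma IsAverage.mono (h : B.IsAverage M) {F G : Fin B.l → Fin B.l → Fin B.l → Fin B.l → ℝ}
    (hFG : ∀ i₁ i₂ p₁ p₂, F i₁ i₂ p₁ p₂ ≤ G i₁ i₂ p₁ p₂) : M F ≤ M G := by
  have h1 := h.nonneg (fun i₁ i₂ p₁ p₂ => G i₁ i₂ p₁ p₂ + -1 * F i₁ i₂ p₁ p₂) fun i₁ i₂ p₁ p₂ => by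
    linarith [hFG i₁ i₂ p₁ p₂]
  rw [h.add, h.const_mul] at h1
  linarith

lemma IsAverage.abs_le (h : B.IsAverage M) {F G : Fin B.l → Fin B.l → Fin B.l → Fin B.l → ℝ}
    (hFG : ∀ i₁ i₂ p₁ p₂, |F i₁ i₂ p₁ p₂| ≤ G i₁ i₂ p₁ p₂) : |M F| ≤ M G := by
  have h1 := h.mono (F := fun i₁ i₂ p₁ p₂ => -1 * F i₁ i₂ p₁ p₂) (G := G) fun i₁ i₂ p₁ p₂ => by
    linarith [neg_le_abs (F i₁ i₂ p₁ p₂), hFG i₁ i₂ p₁ p₂]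
  rw [h.const_mul] at h1
  exact abs_le'.2 ⟨h.mono fun i₁ i₂ p₁ p₂ => (le_abs_self _).trans (hFG i₁ i₂ p₁ p₂), by linarith⟩

end IsAverage

/-! ### Positivity and normalization of the replica averages -/

section Instances

variable [Nonempty (Fin B.l)] {c : Par}

lemma isAverage_topMean (hp : B.p ≠ 0) (hs : B.s ≠ 0) (hc : c.Regular r) (j : ℕ)
    {N : (Fin B.l → Fin B.l → Fin B.l → Fin B.l → ℝ) → B.Field → ℝ} (hN : ∀ F, TameFn (N F))
    (hv : ∀ v, B.IsAverage fun F => N F v) :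
    B.IsAverage fun F => B.topMean c r (B.tiltProd c j (N F) r) where
  add F G := by
    have e : N (fun i₁ i₂ p₁ p₂ => F i₁ i₂ p₁ p₂ + G i₁ i₂ p₁ p₂) = fun v => N F v + N G v :=
      funext fun v => (hv v).add F G
    rw [e, show B.tiltProd c j (fun v => N F v + N G v) r = _ from
      funext (tiltProd_add hp hs hc le_rfl j (hN F) (hN G))]
    exact topMean_add _ _ (tameFn_tiltProd hp hs hc le_rfl j (hN F))
      (tameFn_tiltProd hp hs hc le_rfl j (hN G))
  const_mul b F := by
    have e : N (fun i₁ i₂ p₁ p₂ => b * F i₁ i₂ p₁ p₂) = fun v => b * N F v :=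
      funext fun v => (hv v).const_mul b F
    rw [e, show B.tiltProd c j (fun v => b * N F v) r = _ from funext (tiltProd_const_mul j r b _)]
    exact topMean_const_mul ..
  one := by
    have e : N (fun _ _ _ _ => 1) = fun _ => 1 := funext fun v => (hv v).one
    rw [e, show B.tiltProd c j (fun _ => 1) r = _ from
      funext (tiltProd_const hp hs hc le_rfl j 1)]
    exact topMean_const ..
  nonneg F hF := topMean_nonneg _ _ fun v => tiltProd_nonneg _ _ (fun v => (hv v).nonneg F hF) v

lemma isAverage_pairAvg (hp : B.p ≠ 0) (hs : B.s ≠ 0) (hc : c.Regular r) (hr : 1 ≤ r) {k : ℕ}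
    (hk : k ≤ r) (v : B.Field) : B.IsAverage fun F => B.pairAvg c k F v where
  add F G := by simp only [pairAvg, add_mul, Finset.sum_add_distrib]
  const_mul b F := by simp only [pairAvg, mul_assoc, Finset.mul_sum]
  one := by
    simp only [pairAvg, one_mul]
    rw [← Finset.sum_mul_sum, sum_replicaWeight hp hs hc hr hk, one_mul]
  nonneg F hF := Finset.sum_nonneg fun a _ => Finset.sum_nonneg fun b _ => mul_nonneg (hF _ _ _ _)
    (mul_nonneg (replicaWeight_nonneg _ _ _) (replicaWeight_nonneg _ _ _))

lemma sum_weight0_prod (i₃ : Fin B.l) (v : B.Field) :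
    ∑ a : Fin B.l × Fin B.l, B.weight0 a.1 a.2 i₃ v = 1 := by
  rw [Fintype.sum_prod_type, sum_weight0]

lemma isAverage_innerAvg (hs : B.s ≠ 0) (v : B.Field) : B.IsAverage fun F => B.innerAvg c F v where
  add F G := by simp only [innerAvg, add_mul, Finset.sum_add_distrib]
  const_mul b F := by simp only [innerAvg, mul_assoc, Finset.mul_sum]
  one := by
    have ht : ∀ (i₃ : Fin B.l) (a b : Fin B.l × Fin B.l), TameFn fun v =>
      B.weight0 a.1 a.2 i₃ v * B.weight0 b.1 b.2 i₃ v := fun i₃ a b =>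
        (tameFn_weight0 _ _ _).mul (tameFn_weight0 _ _ _)
    have e : ∀ i₃, ∑ a : Fin B.l × Fin B.l, ∑ b : Fin B.l × Fin B.l, B.tilt1 c i₃ (fun v =>
        B.weight0 a.1 a.2 i₃ v * B.weight0 b.1 b.2 i₃ v) v = 1 := fun i₃ => by
      rw [Finset.sum_congr rfl fun a _ => (tilt1_sum hs i₃ _ (fun b _ => ht i₃ a b) v).symm,
        ← tilt1_sum hs i₃ _ fun a _ => TameFn.sum _ fun b _ => ht i₃ a b]
      simp only [← Finset.sum_mul_sum, sum_weight0_prod, one_mul, tilt1_const hs]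
    simp only [innerAvg, one_mul]
    rw [Finset.sum_congr rfl fun a _ => Finset.sum_comm, Finset.sum_comm]
    simp only [← Finset.mul_sum, e, mul_one, sum_weight00]
  nonneg F hF := Finset.sum_nonneg fun a _ => Finset.sum_nonneg fun b _ => Finset.sum_nonneg
    fun i₃ _ => mul_nonneg (hF _ _ _ _) (mul_nonneg (weight00_nonneg _ _) (tilt_nonneg _ (fun v =>
      mul_nonneg (weight0_nonneg _ _ _ _) (weight0_nonneg _ _ _ _)) v))

lemma isAverage_splitAvg (hs : B.s ≠ 0) (v : B.Field) : B.IsAverage fun F => B.splitAvg c F v where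
  add F G := by simp only [splitAvg, add_mul, Finset.sum_add_distrib]
  const_mul b F := by simp only [splitAvg, mul_assoc, Finset.mul_sum]
  one := by
    have e : ∀ i₃, ∑ a : Fin B.l × Fin B.l, B.tilt1 c i₃ (B.weight0 a.1 a.2 i₃) v = 1 := fun i₃ => by
      rw [← tilt1_sum hs i₃ _ fun a _ => tameFn_weight0 _ _ _]
      simp only [sum_weight0_prod, tilt1_const hs]
    simp only [splitAvg, one_mul]
    rw [Finset.sum_congr rfl fun a _ => Finset.sum_comm, Finset.sum_comm]
    simp only [← Finset.mul_sum, e, mul_one, sum_weight00]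
  nonneg F hF := Finset.sum_nonneg fun a _ => Finset.sum_nonneg fun b _ => Finset.sum_nonneg
    fun i₃ _ => mul_nonneg (hF _ _ _ _) (mul_nonneg (weight00_nonneg _ _) (mul_nonneg
      (tilt_nonneg _ (weight0_nonneg _ _ _) v) (tilt_nonneg _ (weight0_nonneg _ _ _) v)))

end Instances

/-- The standing assumptions on a process and on lifting parameters at level `r`. -/
structure Standing (B : Blirp n) (r : ℕ) (Λ : Lifting) (t : ℝ) : Prop where
  p_ne : B.p ≠ 0
  s_ne : B.s ≠ 0
  r_pos : 1 ≤ r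
  nonempty : Nonempty (Fin B.l)
  x_norm : ∀ i, ‖B.x i‖ = 1
  y_norm : ∀ i, ‖B.y i‖ = 1
  mem : t ∈ Set.Icc (0 : ℝ) 1
  regular : (parOf Λ t).Regular r

section Standing

variable (h : B.Standing r Λ t)
include h

lemma Standing.isAverage {k : ℕ} (hk : 1 ≤ k) (hkr : k ≤ r + 1) :
    B.IsAverage (B.meanAvg r Λ t k) := by
  have := h.nonempty
  have hm := h.regular 1 le_rfl h.r_pos
  obtain ⟨k, rfl⟩ := Nat.exists_eq_add_of_le' hk
  rcases Nat.eq_zero_or_pos k with rfl | hk0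
  · rw [show B.meanAvg r Λ t (0 + 1) = _ from funext fun F => meanAvg_one_eq h.p_ne h.s_ne h.regular
      h.r_pos h.x_norm h.y_norm h.mem F]
    exact isAverage_topMean h.p_ne h.s_ne h.regular 2 (tameFn_innerAvg h.s_ne hm)
      (isAverage_innerAvg h.s_ne)
  · rw [show B.meanAvg r Λ t (k + 1) = _ from funext fun F => meanAvg_succ_eq h.p_ne h.s_ne
      h.regular h.x_norm h.y_norm h.mem hk0 (by omega) F]
    exact isAverage_topMean h.p_ne h.s_ne h.regular (k + 1)
      (tameFn_pairAvg h.p_ne h.s_ne h.regular h.r_pos (by omega))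
      (isAverage_pairAvg h.p_ne h.s_ne h.regular h.r_pos (by omega))

lemma Standing.isAverage22 : B.IsAverage (B.meanAvg22 r Λ t) := by
  have := h.nonempty
  have hm := h.regular 1 le_rfl h.r_pos
  rw [show B.meanAvg22 r Λ t = _ from funext fun F => meanAvg22_eq h.p_ne h.s_ne h.regular
    h.r_pos h.x_norm h.y_norm h.mem F]
  exact isAverage_topMean h.p_ne h.s_ne h.regular 2 (tameFn_splitAvg h.s_ne hm)
    (isAverage_splitAvg h.s_ne)

lemma Standing.normX_eq (i₁ p₁ : Fin B.l) : B.normX i₁ p₁ = 1 := by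
  simp [normX, h.x_norm]

lemma Standing.normY_eq (i₂ p₂ : Fin B.l) : B.normY i₂ p₂ = 1 := by
  simp [normY, h.y_norm]

lemma Standing.psi1_eq (h0 : Λ.p (r + 1) = 0) :
    B.psi1 r Λ t = -B.correction r Λ + B.psi r Λ t := by
  rw [psi1, correction, neg_mul]
  congr 2
  congr 1
  refine Finset.sum_congr rfl fun k hk => ?_
  obtain ⟨h1, h2⟩ := Finset.mem_Icc.1 hk
  simp only [h.normX_eq, h.normY_eq, mul_one, (h.isAverage h1 h2).one]
  rcases Nat.lt_or_ge k (r + 1) with h3 | h3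
  · rw [(h.isAverage (k := k + 1) (by omega) (by omega)).one, mul_one]
  -- The index `r + 2` of the last subtracted average lies outside the range of the normalized
  -- averages; its coefficient contains `p_{r+1} = 0`.
  · rw [show k = r + 1 by omega, h0]
    ring

lemma Standing.psi1_eq_meanFree (h0 : Λ.p (r + 1) = 0) :
    B.psi1 r Λ t = -B.correction r Λ + B.meanFree r (parOf Λ t) := by
  have := h.nonempty
  rw [h.psi1_eq h0, psi_eq h.p_ne h.s_ne h.regular h.r_pos h.x_norm h.y_norm h.mem]

/-- The covariance part of the derivative in terms of the averages. -/
lemma Standing.covDeriv_eq (K : ℕ → Fin B.l → Fin B.l → Fin B.l → Fin B.l → ℝ) :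
    B.covDeriv r (parOf Λ t) K = -(1 - Λ.m 1) * B.meanAvg r Λ t 1 (K 1) +
      -(Λ.m 1 * (1 - B.p)) * B.meanAvg22 r Λ t (K 2) +
      ∑ j ∈ Finset.Icc 1 r, (Λ.m (j + 1) - Λ.m j) * B.p * B.meanAvg r Λ t (j + 1) (K (j + 1)) := by
  have := h.nonempty
  rw [covDeriv, meanAvg_one_eq h.p_ne h.s_ne h.regular h.r_pos h.x_norm h.y_norm h.mem,
    meanAvg22_eq h.p_ne h.s_ne h.regular h.r_pos h.x_norm h.y_norm h.mem]
  congr 1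
  refine Finset.sum_congr rfl fun j hj => ?_
  obtain ⟨h1, h2⟩ := Finset.mem_Icc.1 hj
  rw [meanAvg_succ_eq h.p_ne h.s_ne h.regular h.x_norm h.y_norm h.mem h1 h2]
  rfl

lemma Standing.prefactor : 1 / (B.p * |B.s| * √n) * (B.p * (B.s * B.β) ^ 2) = 2 * B.pref := by
  have hp := h.p_ne
  have hs : |B.s| ≠ 0 := abs_ne_zero.2 h.s_ne
  rw [pref, show Real.sign B.s * B.s = |B.s| by
    rcases lt_or_gt_of_ne h.s_ne with h1 | h1
    · rw [Real.sign_of_neg h1, abs_of_neg h1, neg_one_mul]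
    · rw [Real.sign_of_pos h1, abs_of_pos h1, one_mul]]
  -- In dimension zero both sides vanish, as division by zero gives zero.
  rcases eq_or_ne (√(n : ℝ)) 0 with h0 | h0
  · simp [h0]
  · field_simp
    rw [sq_abs]

/-! #### Stationarity in the exponents -/

/-- Near `m_k`, `ψ₁` is the mean free energy minus the correction, and the correction is linear in
`m_k`. Moving `m_k` alone leaves all covariances fixed, so the stationarity equation identifies the
derivative of the free energy with that of the correction. -/
lemma Standing.expDeriv_eq (h0 : Λ.p (r + 1) = 0) (hm0 : Λ.m (r + 1) = 0) (hΛ : ∀ k, k ≤ r + 1 →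
      0 ≤ (parOf Λ t).u4 k ∧ 0 ≤ (parOf Λ t).u2 k ∧ 0 ≤ (parOf Λ t).h k) {k : ℕ} (hk : 1 ≤ k)
    (hkr : k ≤ r) (hM : B.StationaryM r Λ t k) : B.expDeriv r (parOf Λ t) k =
      B.pref * ((Λ.p (k - 1) * Λ.q (k - 1) - Λ.p k * Λ.q k) * omegaWeight k B.p) := by
  have := h.nonempty
  set L : ℝ → Lifting := fun μ => { Λ with m := Function.update Λ.m k μ } with hL
  have hLk : L (Λ.m k) = Λ := by simp [hL]
  have hLm : ∀ j, HasDerivAt (fun μ => (L μ).m j) ((Pi.single k 1 : ℕ → ℝ) j) (Λ.m k) := by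
    intro j
    rcases eq_or_ne j k with rfl | hj
    · simpa [hL] using hasDerivAt_id' (Λ.m j)
    · simpa [hL, Function.update_of_ne hj, hj] using hasDerivAt_const (Λ.m k) (Λ.m j)
  -- Only for nearby values, since the exponent must stay nonzero.
  have hst : ∀ᶠ μ in 𝓝 (Λ.m k), B.Standing r (L μ) t := by
    filter_upwards [isOpen_ne.mem_nhds (h.regular k hk hkr)] with μ hμ
    refine ⟨h.p_ne, h.s_ne, h.r_pos, h.nonempty, h.x_norm, h.y_norm, h.mem, fun j h1 h2 => ?_⟩
    change Function.update Λ.m k μ j ≠ 0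
    rcases eq_or_ne j k with rfl | hj
    · simpa using hμ
    · rw [Function.update_of_ne hj]
      exact h.regular j h1 h2
  have hcurve : Par.HasDeriv (fun μ => parOf (L μ) t) ⟨0, 0, 0, 0, Pi.single k 1⟩ (Λ.m k) r :=
    { u4 := fun j _ h2 => ⟨hasDerivAt_const (Λ.m k) ((parOf Λ t).u4 j),
        .of_forall fun _ => (hΛ j h2).1⟩
      u2 := fun j _ h2 => ⟨hasDerivAt_const (Λ.m k) ((parOf Λ t).u2 j),
        .of_forall fun _ => (hΛ j h2).2.1⟩
      h := fun j _ h2 => ⟨hasDerivAt_const (Λ.m k) ((parOf Λ t).h j),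
        .of_forall fun _ => (hΛ j h2).2.2⟩
      g := ⟨hasDerivAt_const _ _, .of_forall fun _ => h.mem.1⟩
      m := fun j _ _ => hLm j
      ne := by rw [hLk]; exact h.regular }
  have hQ : ∀ j, B.tailQ ⟨0, 0, 0, 0, Pi.single k 1⟩ r j = 0 := fun j => by
    simp [tailQ, matQ, lvlQ]
  have h1 := hasDerivAt_meanFree h.p_ne h.s_ne h.r_pos hcurve (by rw [hLk]; exact hm0)
    (by simp [hQ, kernel])
  rw [hLk, h.covDeriv_eq] at h1
  have hk0 : ∀ j, B.kernel (B.tailQ ⟨0, 0, 0, 0, Pi.single k 1⟩ r j) = fun _ _ _ _ => 0 :=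
    fun j => by funext; simp [hQ, kernel]
  have hz : ∀ j ∈ Finset.Icc 1 r, B.meanAvg r Λ t (j + 1) (fun _ _ _ _ => 0) = 0 := fun j hj =>
    (h.isAverage (k := j + 1) (by omega) (by have := (Finset.mem_Icc.1 hj).2; omega)).const 0
  simp only [hk0, (h.isAverage le_rfl (by omega)).const, h.isAverage22.const] at h1
  rw [Finset.sum_eq_zero fun j hj => by rw [hz j hj, mul_zero], Finset.sum_eq_single_of_mem k
    (Finset.mem_Icc.2 ⟨hk, hkr⟩) fun j _ hj => by simp [hj]] at h1
  have h2 : HasDerivAt (fun μ => B.correction r (L μ)) (B.pref *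
      ((Λ.p (k - 1) * Λ.q (k - 1) - Λ.p k * Λ.q k) * omegaWeight k B.p)) (Λ.m k) := by
    refine (HasDerivAt.const_mul B.pref (HasDerivAt.fun_sum (u := Finset.Icc 1 (r + 1))
      fun j _ => ((hLm j).const_mul (Λ.p (j - 1) * Λ.q (j - 1) - Λ.p j * Λ.q j)).mul_const
        (omegaWeight j B.p))).congr_deriv ?_
    rw [Finset.sum_eq_single_of_mem k (Finset.mem_Icc.2 ⟨hk, by omega⟩) fun j _ hj => by simp [hj]]
    simp
  have h3 : HasDerivAt (fun μ => B.psi1 r (L μ) t) _ (Λ.m k) :=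
    (h2.neg.add h1).congr_of_eventuallyEq (hst.mono fun μ hμ => hμ.psi1_eq_meanFree h0)
  have h4 := h3.unique hM
  simp at h4
  linarith

end Standing

end Blirp

open Interp

/-! ### Admissible lifting parameters -/

lemma Lifting.Admissible.p_nonneg {Λ : Lifting} {r : ℕ} (h : Λ.Admissible r) {k : ℕ}
    (hk : k ≤ r + 1) : 0 ≤ Λ.p k := by
  induction hk using Nat.decreasingInduction with
  | self => exact h.p_last.ge
  | of_succ k hk ih => exact ih.trans (h.p_anti k (by omega))

lemma Lifting.Admissible.q_nonneg {Λ : Lifting} {r : ℕ} (h : Λ.Admissible r) {k : ℕ}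
    (hk : k ≤ r + 1) : 0 ≤ Λ.q k := by
  induction hk using Nat.decreasingInduction with
  | self => exact h.q_last.ge
  | of_succ k hk ih => exact ih.trans (h.q_anti k (by omega))

lemma Lifting.Admissible.var_nonneg {Λ : Lifting} {r : ℕ} (h : Λ.Admissible r) {t : ℝ}
    (ht : t ∈ Set.Icc (0 : ℝ) 1) (k : ℕ) (hk : k ≤ r + 1) :
    0 ≤ (Blirp.parOf Λ t).u4 k ∧ 0 ≤ (Blirp.parOf Λ t).u2 k ∧ 0 ≤ (Blirp.parOf Λ t).h k := by
  have h1 : 0 ≤ 1 - t := by linarith [ht.2]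
  cases k with
  | zero => simp [Blirp.parOf]
  | succ k =>
    have hp := h.p_anti k (by omega)
    have hq := h.q_anti k (by omega)
    exact ⟨mul_nonneg ht.1 (sub_nonneg.2 (mul_le_mul hp hq (h.q_nonneg hk)
      (h.p_nonneg (by omega)))), mul_nonneg h1 (sub_nonneg.2 hp), mul_nonneg h1 (sub_nonneg.2 hq)⟩

namespace Blirp

variable {n : ℕ} {B : Blirp n} {r : ℕ}

/-! ### Covariance kernels -/

lemma kernel_add (Q Q' : B.Field →₀ ℝ) (i₁ i₂ p₁ p₂ : Fin B.l) :
    B.kernel (Q + Q') i₁ i₂ p₁ p₂ = B.kernel Q i₁ i₂ p₁ p₂ + B.kernel Q' i₁ i₂ p₁ p₂ :=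
  quad_add_left ..

lemma kernel_lvlQ (c' : Par) (k : ℕ) (i₁ i₂ p₁ p₂ : Fin B.l) :
    B.kernel (B.lvlQ c' k) i₁ i₂ p₁ p₂ = 1 / 2 * (c'.u4 k + c'.u2 k * inner ℝ (B.y p₂) (B.y i₂) +
      c'.h k * inner ℝ (B.x p₁) (B.x i₁)) := by
  simp only [kernel, lvlQ, quad_add_left, quad_sum_left, quad_single, dirX, dirY, Pi.one_apply,
    PiLp.inner_apply, RCLike.inner_apply, conj_trivial, mul_add, Finset.mul_sum]
  rw [add_assoc]
  congr 1
  · ring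
  congr 1 <;> exact Finset.sum_congr rfl fun a _ => by ring

lemma kernel_matQ (c' : Par) (i₁ i₂ p₁ p₂ : Fin B.l) :
    B.kernel (B.matQ c') i₁ i₂ p₁ p₂ = 1 / 2 * (c'.g * (inner ℝ (B.y p₂) (B.y i₂) *
      inner ℝ (B.x p₁) (B.x i₁))) := by
  simp only [kernel, matQ, quad_sum_left, quad_single, dirXY,
    PiLp.inner_apply, RCLike.inner_apply, conj_trivial]
  rw [Finset.sum_mul_sum]
  simp only [Finset.mul_sum]
  exact Finset.sum_congr rfl fun a _ => Finset.sum_congr rfl fun b _ => by ring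

lemma sum_Icc_telescope (U : ℕ → ℝ) {k N : ℕ} (hk : k ≤ N) :
    ∑ j ∈ Finset.Icc (k + 1) N, (U (j - 1) - U j) = U k - U N := by
  induction N, hk using Nat.le_induction with
  | base => simp
  | succ N hN ih =>
    rw [Finset.sum_Icc_succ_top (by omega), ih, Nat.add_sub_cancel]
    ring

lemma sum_Icc_by_parts (a b : ℕ → ℝ) (r : ℕ) :
    ∑ k ∈ Finset.Icc 1 (r + 1), (a (k - 1) - a k) * b k =
      a 0 * b 1 - a (r + 1) * b (r + 1) + ∑ k ∈ Finset.Icc 1 r, a k * (b (k + 1) - b k) := by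
  induction r with
  | zero => simp [sub_mul]
  | succ r ih =>
    rw [Finset.sum_Icc_succ_top (by omega), ih, Finset.sum_Icc_succ_top (by omega),
      Nat.add_sub_cancel]
    ring

/-- The variances are differences in `k`, so the covariance accumulated over the outer levels
telescopes and depends on the parameters number `k` and `r + 1` only. -/
lemma kernel_tailQ {c' : Par} {U Y X : ℕ → ℝ} (h4 : ∀ k, c'.u4 k = U (k - 1) - U k)
    (h2 : ∀ k, c'.u2 k = Y (k - 1) - Y k) (h3 : ∀ k, c'.h k = X (k - 1) - X k) {k : ℕ}
    (hk : k ≤ r + 1) (i₁ i₂ p₁ p₂ : Fin B.l) :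
    B.kernel (B.tailQ c' r (k + 1)) i₁ i₂ p₁ p₂ = 1 / 2 * ((U k - U (r + 1)) +
      (Y k - Y (r + 1)) * inner ℝ (B.y p₂) (B.y i₂) +
      (X k - X (r + 1)) * inner ℝ (B.x p₁) (B.x i₁) +
      c'.g * (inner ℝ (B.y p₂) (B.y i₂) * inner ℝ (B.x p₁) (B.x i₁))) := by
  have e : B.kernel (∑ j ∈ Finset.Icc (k + 1) (r + 1), B.lvlQ c' j) i₁ i₂ p₁ p₂ =
      ∑ j ∈ Finset.Icc (k + 1) (r + 1), B.kernel (B.lvlQ c' j) i₁ i₂ p₁ p₂ := quad_sum_left ..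
  rw [tailQ, kernel_add, kernel_matQ, e]
  simp only [kernel_lvlQ, h4, h2, h3, ← Finset.mul_sum, Finset.sum_add_distrib, ← Finset.sum_mul,
    sum_Icc_telescope _ hk]
  ring

/-! ### The derivative of `ψ₁` along a stationary curve -/

lemma omegaWeight_add_two (k : ℕ) (p : ℝ) : omegaWeight (k + 2) p = p := by
  simp [omegaWeight]

lemma omegaWeight_succ {k : ℕ} (hk : 1 ≤ k) (p : ℝ) : omegaWeight (k + 1) p = p := by
  rw [omegaWeight, if_neg (by omega)]

/-- A curve of lifting parameters in a neighbourhood of which everything is regular. -/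
structure StationaryCurve (B : Blirp n) (r : ℕ) (Λ : ℝ → Lifting) (t : ℝ) : Prop where
  standing : ∀ᶠ τ in 𝓝 t, B.Standing r (Λ τ) τ
  admissible : ∀ᶠ τ in 𝓝 t, (Λ τ).Admissible r
  p_diff : ∀ k, 1 ≤ k → k ≤ r → DifferentiableAt ℝ (fun τ => (Λ τ).p k) t
  q_diff : ∀ k, 1 ≤ k → k ≤ r → DifferentiableAt ℝ (fun τ => (Λ τ).q k) t
  m_diff : ∀ k, 1 ≤ k → k ≤ r → DifferentiableAt ℝ (fun τ => (Λ τ).m k) t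
  stationary : B.Stationary r (Λ t) t
  m_one : deriv (fun τ => (Λ τ).m 1) t = 0 ∨ B.StationaryM r (Λ t) t 1

lemma hasDerivAt_of_eventually_const {f : ℝ → ℝ} {a t : ℝ} (h : ∀ᶠ τ in 𝓝 t, f τ = a) :
    HasDerivAt f (deriv f t) t ∧ deriv f t = 0 := by
  have h1 : HasDerivAt f 0 t := (hasDerivAt_const t a).congr_of_eventuallyEq h
  rw [h1.deriv]
  exact ⟨h1, rfl⟩

lemma hasDerivAt_of_ends {f : ℕ → ℝ → ℝ} {r : ℕ} {t a b : ℝ}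
    (h : ∀ k, 1 ≤ k → k ≤ r → DifferentiableAt ℝ (f k) t)
    (h0 : ∀ᶠ τ in 𝓝 t, f 0 τ = a) (h1 : ∀ᶠ τ in 𝓝 t, f (r + 1) τ = b) (k : ℕ) (hk : k ≤ r + 1) :
    HasDerivAt (f k) (deriv (f k) t) t := by
  rcases Nat.eq_zero_or_pos k with rfl | h2
  · exact (hasDerivAt_of_eventually_const h0).1
  rcases Nat.lt_or_ge k (r + 1) with h3 | h3
  · exact (h k h2 (by omega)).hasDerivAt
  · rw [show k = r + 1 by omega]
    exact (hasDerivAt_of_eventually_const h1).1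

/-- The curve moves all parameters together with `t`. Every contribution of their velocities
cancels: against the correction, or by stationarity. What is left is the derivative at frozen
parameters, in which the accumulated covariance factors as a product of two overlap deviations. -/
theorem StationaryCurve.hasDerivAt_psi1 {Λ : ℝ → Lifting} {t : ℝ} (h : B.StationaryCurve r Λ t) :
    HasDerivAt (fun τ => B.psi1 r (Λ τ) τ) (B.pref / B.s * (B.phi r (Λ t) t 1 +
      B.phi22 r (Λ t) t + ∑ k ∈ Finset.Icc 1 r, B.phi r (Λ t) t (k + 1))) t := by
  have hS := h.standing.self_of_nhds
  have hA := h.admissible.self_of_nhds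
  have := hS.nonempty
  have hr := hS.r_pos
  set p' : ℕ → ℝ := fun k => deriv (fun τ => (Λ τ).p k) t
  set q' : ℕ → ℝ := fun k => deriv (fun τ => (Λ τ).q k) t
  set m' : ℕ → ℝ := fun k => deriv (fun τ => (Λ τ).m k) t
  have ep0 : ∀ᶠ τ in 𝓝 t, (Λ τ).p 0 = 1 := h.admissible.mono fun τ hτ => hτ.p_zero
  have eq0 : ∀ᶠ τ in 𝓝 t, (Λ τ).q 0 = 1 := h.admissible.mono fun τ hτ => hτ.q_zero
  have em0 : ∀ᶠ τ in 𝓝 t, (Λ τ).m 0 = 1 := h.admissible.mono fun τ hτ => hτ.m_zero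
  have ep1 : ∀ᶠ τ in 𝓝 t, (Λ τ).p (r + 1) = 0 := h.admissible.mono fun τ hτ => hτ.p_last
  have eq1 : ∀ᶠ τ in 𝓝 t, (Λ τ).q (r + 1) = 0 := h.admissible.mono fun τ hτ => hτ.q_last
  have em1 : ∀ᶠ τ in 𝓝 t, (Λ τ).m (r + 1) = 0 := h.admissible.mono fun τ hτ => hτ.m_last
  have dp : ∀ k ≤ r + 1, HasDerivAt (fun τ => (Λ τ).p k) (p' k) t :=
    hasDerivAt_of_ends (f := fun k τ => (Λ τ).p k) h.p_diff ep0 ep1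
  have dq : ∀ k ≤ r + 1, HasDerivAt (fun τ => (Λ τ).q k) (q' k) t :=
    hasDerivAt_of_ends (f := fun k τ => (Λ τ).q k) h.q_diff eq0 eq1
  have dm : ∀ k ≤ r + 1, HasDerivAt (fun τ => (Λ τ).m k) (m' k) t :=
    hasDerivAt_of_ends (f := fun k τ => (Λ τ).m k) h.m_diff em0 em1
  have p'0 : p' 0 = 0 := (hasDerivAt_of_eventually_const ep0).2
  have q'0 : q' 0 = 0 := (hasDerivAt_of_eventually_const eq0).2
  have p'1 : p' (r + 1) = 0 := (hasDerivAt_of_eventually_const ep1).2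
  have q'1 : q' (r + 1) = 0 := (hasDerivAt_of_eventually_const eq1).2
  have m'1 : m' (r + 1) = 0 := (hasDerivAt_of_eventually_const em1).2
  set w' : ℕ → ℝ := fun k => p' k * (Λ t).q k + (Λ t).p k * q' k with hw'
  have dw : ∀ k ≤ r + 1, HasDerivAt (fun τ => (Λ τ).p k * (Λ τ).q k) (w' k) t := fun k hk =>
    (dp k hk).mul (dq k hk)
  have w'0 : w' 0 = 0 := by simp [hw', p'0, q'0]
  have w'1 : w' (r + 1) = 0 := by simp [hw', p'1, q'1]
  -- the curve of parameters
  set U : ℕ → ℝ := fun k => (Λ t).p k * (Λ t).q k + t * w' k with hU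
  set Y : ℕ → ℝ := fun k => -(Λ t).p k + (1 - t) * p' k with hY
  set X : ℕ → ℝ := fun k => -(Λ t).q k + (1 - t) * q' k with hX
  set c' : Par := ⟨fun k => U (k - 1) - U k, fun k => Y (k - 1) - Y k, fun k => X (k - 1) - X k,
    1, m'⟩ with hc'
  have hvar := h.standing.and h.admissible
  have d1 : HasDerivAt (fun τ : ℝ => 1 - τ) (-1) t := (hasDerivAt_id' t).const_sub 1
  have hcurve : Par.HasDeriv (fun τ => parOf (Λ τ) τ) c' t r :=
    { u4 := fun k _ hk => ⟨((hasDerivAt_id' t).mul ((dw (k - 1) (by omega)).sub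
        (dw k hk))).congr_deriv (by simp only [hc', hU, Pi.sub_apply]; ring),
        hvar.mono fun τ hτ => (hτ.2.var_nonneg hτ.1.mem k hk).1⟩
      u2 := fun k _ hk => ⟨(d1.mul ((dp (k - 1) (by omega)).sub
        (dp k hk))).congr_deriv (by simp only [hc', hY, Pi.sub_apply]; ring),
        hvar.mono fun τ hτ => (hτ.2.var_nonneg hτ.1.mem k hk).2.1⟩
      h := fun k _ hk => ⟨(d1.mul ((dq (k - 1) (by omega)).sub
        (dq k hk))).congr_deriv (by simp only [hc', hX, Pi.sub_apply]; ring),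
        hvar.mono fun τ hτ => (hτ.2.var_nonneg hτ.1.mem k hk).2.2⟩
      g := ⟨hasDerivAt_id' t, hvar.mono fun τ hτ => hτ.1.mem.1⟩
      m := fun k _ hk => dm k (by omega)
      ne := hS.regular }
  have hK : ∀ k ≤ r, B.kernel (B.tailQ c' r (k + 1)) = fun i₁ i₂ p₁ p₂ =>
      1 / 2 * (B.devX ((Λ t).p k) i₁ p₁ * B.devY ((Λ t).q k) i₂ p₂) +
      (-(1 - t) * p' k / 2) * (B.normX i₁ p₁ * B.devY ((Λ t).q k) i₂ p₂) +
      (-(1 - t) * q' k / 2) * (B.normY i₂ p₂ * B.devX ((Λ t).p k) i₁ p₁) + w' k / 2 := by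
    intro k hk
    funext i₁ i₂ p₁ p₂
    rw [kernel_tailQ (c' := c') (U := U) (Y := Y) (X := X) (fun _ => rfl) (fun _ => rfl)
      (fun _ => rfl) (by omega)]
    simp only [devX, devY, hS.normX_eq, hS.normY_eq, hc', hU, hY, hX, hw', hA.p_last, hA.q_last,
      p'1, q'1]
    ring
  -- Since `p_0 = q_0 = 1` are constant, the full kernel is half the product of the deviations, and
  -- the one in `x` vanishes for equal unit vectors.
  have hQ : ∀ i₁ i₂ p₂, B.kernel (B.tailQ c' r 1) i₁ i₂ i₁ p₂ = 0 := by
    intro i₁ i₂ p₂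
    rw [hK 0 (by omega)]
    simp [p'0, q'0, w'0, devX, hA.p_zero, hS.normX_eq, hS.x_norm]
  have hM : ∀ {M}, B.IsAverage M → ∀ k ≤ r, M (B.kernel (B.tailQ c' r (k + 1))) =
      1 / 2 * M (fun i₁ i₂ p₁ p₂ => B.devX ((Λ t).p k) i₁ p₁ * B.devY ((Λ t).q k) i₂ p₂) +
      (-(1 - t) * p' k / 2) * M (fun i₁ i₂ p₁ p₂ => B.normX i₁ p₁ * B.devY ((Λ t).q k) i₂ p₂) +
      (-(1 - t) * q' k / 2) * M (fun i₁ i₂ p₁ p₂ => B.normY i₂ p₂ * B.devX ((Λ t).p k) i₁ p₁) +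
      w' k / 2 := by
    intro M hM k hk
    rw [hK k hk, hM.add, hM.add, hM.add, hM.const_mul, hM.const_mul, hM.const_mul, hM.const]
  -- the derivatives of the two parts
  have hF := hasDerivAt_meanFree hS.p_ne hS.s_ne hr hcurve hA.m_last hQ
  rw [hS.prefactor, hS.covDeriv_eq, hM (hS.isAverage le_rfl (by omega)) 0 (by omega),
    hM hS.isAverage22 1 hr, Finset.sum_congr rfl fun j hj => by
      rw [hM (hS.isAverage (k := j + 1) (by omega) (by have := (Finset.mem_Icc.1 hj).2; omega)) j
        (Finset.mem_Icc.1 hj).2]] at hF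
  have hC : HasDerivAt (fun τ => B.correction r (Λ τ)) (B.pref * ∑ k ∈ Finset.Icc 1 (r + 1),
      (((w' (k - 1) - w' k) * (Λ t).m k + ((Λ t).p (k - 1) * (Λ t).q (k - 1) -
        (Λ t).p k * (Λ t).q k) * m' k) * omegaWeight k B.p)) t := by
    refine HasDerivAt.const_mul B.pref (HasDerivAt.fun_sum fun k hk => ?_)
    have := (Finset.mem_Icc.1 hk).2
    exact (((dw (k - 1) (by omega)).sub (dw k this)).mul (dm k this)).mul_const _
  refine ((hC.neg.add hF).congr_of_eventuallyEq (hvar.mono fun τ hτ =>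
    hτ.1.psi1_eq_meanFree hτ.2.p_last)).congr_deriv ?_
  -- stationarity in the exponents
  have hE : ∑ k ∈ Finset.Icc 1 r, m' k * B.expDeriv r (parOf (Λ t) t) k =
      B.pref * ∑ k ∈ Finset.Icc 1 r, ((Λ t).p (k - 1) * (Λ t).q (k - 1) -
        (Λ t).p k * (Λ t).q k) * m' k * omegaWeight k B.p := by
    rw [Finset.mul_sum]
    refine Finset.sum_congr rfl fun k hk => ?_
    obtain ⟨h1, h2⟩ := Finset.mem_Icc.1 hk
    have hs := hS.expDeriv_eq hA.p_last hA.m_last (hA.var_nonneg hS.mem) h1 h2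
    rcases h1.eq_or_lt with rfl | h3
    · rcases h.m_one with h4 | h4
      · rw [show m' 1 = 0 from h4]
        ring
      · rw [hs h4]
        ring
    · rw [hs (h.stationary.m_gt_one k h3 h2)]
      ring
  -- the derivative of the correction
  have hsum : ∑ k ∈ Finset.Icc 1 (r + 1),
      (((w' (k - 1) - w' k) * (Λ t).m k + ((Λ t).p (k - 1) * (Λ t).q (k - 1) -
        (Λ t).p k * (Λ t).q k) * m' k) * omegaWeight k B.p) =
      ∑ k ∈ Finset.Icc 1 r, ((Λ t).m (k + 1) - (Λ t).m k) * B.p * w' k -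
        (Λ t).m 1 * (1 - B.p) * w' 1 + ∑ k ∈ Finset.Icc 1 r, ((Λ t).p (k - 1) * (Λ t).q (k - 1) -
        (Λ t).p k * (Λ t).q k) * m' k * omegaWeight k B.p := by
    have e1 := sum_Icc_by_parts w' (fun k => (Λ t).m k * omegaWeight k B.p) r
    rw [w'0, w'1] at e1
    have e2 : ∑ k ∈ Finset.Icc 1 r, w' k * ((Λ t).m (k + 1) * omegaWeight (k + 1) B.p -
        (Λ t).m k * omegaWeight k B.p) = ∑ k ∈ Finset.Icc 1 r,
        (((Λ t).m (k + 1) - (Λ t).m k) * B.p * w' k +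
          (if k = 1 then -((Λ t).m 1 * (1 - B.p) * w' 1) else 0)) := by
      refine Finset.sum_congr rfl fun k hk => ?_
      rw [omegaWeight_succ (Finset.mem_Icc.1 hk).1]
      by_cases hk1 : k = 1
      · subst hk1
        simp only [omegaWeight, if_true]
        ring
      · simp only [omegaWeight, if_neg hk1]
        ring
    rw [e2, Finset.sum_add_distrib, Finset.sum_ite_eq' , if_pos (Finset.mem_Icc.2 ⟨le_rfl, hr⟩)]
      at e1
    rw [Finset.sum_congr rfl fun k _ => add_mul _ _ _, Finset.sum_add_distrib,
      Finset.sum_congr rfl fun k _ => mul_assoc (w' (k - 1) - w' k) _ _, e1,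
      Finset.sum_Icc_succ_top (show 1 ≤ r + 1 by omega), m'1]
    ring
  rw [hE, hsum]
  -- stationarity in the overlaps
  have hst : B.pref * ∑ j ∈ Finset.Icc 1 r, ((Λ t).m (j + 1) - (Λ t).m j) * B.p *
      (-(1 - t) * p' j * B.meanAvg r (Λ t) t (j + 1)
        (fun i₁ i₂ p₁ p₂ => B.normX i₁ p₁ * B.devY ((Λ t).q j) i₂ p₂) +
      -(1 - t) * q' j * B.meanAvg r (Λ t) t (j + 1)
        (fun i₁ i₂ p₁ p₂ => B.normY i₂ p₂ * B.devX ((Λ t).p j) i₁ p₁)) =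
      B.pref * ((Λ t).m 1 * (1 - B.p) *
      (-(1 - t) * p' 1 * B.meanAvg22 r (Λ t) t
        (fun i₁ i₂ p₁ p₂ => B.normX i₁ p₁ * B.devY ((Λ t).q 1) i₂ p₂) +
      -(1 - t) * q' 1 * B.meanAvg22 r (Λ t) t
        (fun i₁ i₂ p₁ p₂ => B.normY i₂ p₂ * B.devX ((Λ t).p 1) i₁ p₁))) := by
    rw [Finset.mul_sum, Finset.sum_eq_single_of_mem 1 (Finset.mem_Icc.2 ⟨le_rfl, hr⟩)]
    · linear_combination p' 1 * h.stationary.p_one + q' 1 * h.stationary.q_one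
    · intro j hj hj1
      obtain ⟨h1, h2⟩ := Finset.mem_Icc.1 hj
      linear_combination p' j * h.stationary.p_gt_one j (by omega) h2 +
        q' j * h.stationary.q_gt_one j (by omega) h2
  have hphi : ∑ k ∈ Finset.Icc 1 r, B.phi r (Λ t) t (k + 1) =
      B.s * ∑ k ∈ Finset.Icc 1 r, ((Λ t).m (k + 1) - (Λ t).m k) * B.p *
        B.meanAvg r (Λ t) t (k + 1) (fun i₁ i₂ p₁ p₂ =>
          B.devX ((Λ t).p k) i₁ p₁ * B.devY ((Λ t).q k) i₂ p₂) := by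
    rw [Finset.mul_sum]
    refine Finset.sum_congr rfl fun k hk => ?_
    rw [phi, omegaWeight_succ (Finset.mem_Icc.1 hk).1, Nat.add_sub_cancel]
    ring
  have hterm : ∀ j ∈ Finset.Icc 1 r, ((Λ t).m (j + 1) - (Λ t).m j) * B.p *
      (1 / 2 * B.meanAvg r (Λ t) t (j + 1)
        (fun i₁ i₂ p₁ p₂ => B.devX ((Λ t).p j) i₁ p₁ * B.devY ((Λ t).q j) i₂ p₂) +
      (-(1 - t) * p' j / 2) * B.meanAvg r (Λ t) t (j + 1)
        (fun i₁ i₂ p₁ p₂ => B.normX i₁ p₁ * B.devY ((Λ t).q j) i₂ p₂) +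
      (-(1 - t) * q' j / 2) * B.meanAvg r (Λ t) t (j + 1)
        (fun i₁ i₂ p₁ p₂ => B.normY i₂ p₂ * B.devX ((Λ t).p j) i₁ p₁) + w' j / 2) =
      1 / 2 * (((Λ t).m (j + 1) - (Λ t).m j) * B.p * B.meanAvg r (Λ t) t (j + 1)
        (fun i₁ i₂ p₁ p₂ => B.devX ((Λ t).p j) i₁ p₁ * B.devY ((Λ t).q j) i₂ p₂)) +
      1 / 2 * (((Λ t).m (j + 1) - (Λ t).m j) * B.p *
      (-(1 - t) * p' j * B.meanAvg r (Λ t) t (j + 1)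
        (fun i₁ i₂ p₁ p₂ => B.normX i₁ p₁ * B.devY ((Λ t).q j) i₂ p₂) +
      -(1 - t) * q' j * B.meanAvg r (Λ t) t (j + 1)
        (fun i₁ i₂ p₁ p₂ => B.normY i₂ p₂ * B.devX ((Λ t).p j) i₁ p₁))) +
      1 / 2 * (((Λ t).m (j + 1) - (Λ t).m j) * B.p * w' j) := fun j _ => by ring
  have hphi1 : B.phi r (Λ t) t 1 = -B.s * (1 - (Λ t).m 1) * B.meanAvg r (Λ t) t 1
      (fun i₁ i₂ p₁ p₂ => B.devX ((Λ t).p 0) i₁ p₁ * B.devY ((Λ t).q 0) i₂ p₂) := by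
    rw [phi, omegaWeight, if_pos rfl, Nat.sub_self, hA.m_zero]
    ring
  rw [Finset.sum_congr rfl hterm, Finset.sum_add_distrib, Finset.sum_add_distrib,
    ← Finset.mul_sum, ← Finset.mul_sum, ← Finset.mul_sum, hphi, hphi1, phi22, p'0, q'0, w'0]
  have hs2 : B.pref / B.s * B.s = B.pref := div_mul_cancel₀ _ hS.s_ne
  generalize B.pref / B.s = κ at hs2 ⊢
  rw [← hs2] at hst ⊢
  linear_combination hst

end Blirp

namespace Blirp

open Interp

/-! ### The terms in `u^(4,k)` -/

variable {n : ℕ} {B : Blirp n} [Nonempty (Fin B.l)] {r : ℕ} {c : Par}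

lemma sum_gibbs {E ι : Type*} [Fintype ι] [Nonempty ι] (a : ℝ) (X : ι → E → ℝ) (v : E) :
    ∑ i, Real.exp (a * X i v) / ∑ j, Real.exp (a * X j v) = 1 := by
  rw [← Finset.sum_div]
  exact div_self (Finset.sum_pos (fun i _ => Real.exp_pos _) Finset.univ_nonempty).ne'

lemma tiltSum_const {E ι : Type*} [Fintype ι] [Nonempty ι] (a : ℝ) (X : ι → E → ℝ) (b : ℝ)
    (v : E) : tiltSum a X (fun _ _ => b) v = b := by
  rw [tiltSum_eq_sum, ← Finset.mul_sum, sum_gibbs, mul_one]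

/-- Adding a constant to the whole field leaves the Gibbs weights unchanged. Every free energy is
affine along this direction, so its first derivatives are constants and its second derivatives zero
at each level. -/
lemma lnC₁_one (i₃ i₁ : Fin B.l) (v : B.Field) : B.lnC₁ i₃ i₁ 1 v = B.β := by
  simp only [lnC₁_eq, Pi.one_apply, one_mul]
  have := sum_gibbs 1 (B.lnA i₁ i₃) v
  simp only [one_mul] at this
  rw [this, mul_one]

lemma lnZ₁_one (i₃ : Fin B.l) (v : B.Field) : B.lnZ₁ i₃ 1 v = B.s * B.β := by
  simp [lnZ₁_eq, sum_weight0_prod]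

lemma lnZ₂_one (i₃ : Fin B.l) (v : B.Field) : B.lnZ₂ i₃ 1 v = 0 := by
  have e : (fun i₁ v => B.lnC₂ i₃ i₁ 1 v + B.s * B.lnC₁ i₃ i₁ 1 v ^ 2) = fun _ _ =>
      B.s * B.β ^ 2 := by
    funext i₁ v
    simp only [lnC₂, lnC₁_one, Pi.one_apply, mul_one, tiltSum_const]
    ring
  rw [lnZ₂, e, tiltSum_const, lnZ₁_one]
  ring

lemma freeH₁_one (hs : B.s ≠ 0) (i₃ : Fin B.l) (v : B.Field) :
    B.freeH₁ c i₃ 1 v = B.s * B.β := by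
  rw [freeH₁, show B.lnZ₁ i₃ 1 = fun _ => B.s * B.β from funext (lnZ₁_one i₃), tilt1_const hs]

lemma freeH₂_one (hs : B.s ≠ 0) (i₃ : Fin B.l) (v : B.Field) : B.freeH₂ c i₃ 1 v = 0 := by
  simp only [freeH₂, lnZ₂_one, lnZ₁_one, tilt1_const hs, freeH₁_one hs]
  ring

lemma freeX₁_one (hp : B.p ≠ 0) (hs : B.s ≠ 0) (hc : c.Regular r) (k : ℕ) (hk : 1 ≤ k)
    (hkr : k ≤ r) (v : B.Field) : B.freeX₁ c k 1 v = B.p * B.s * B.β := by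
  simp [freeX₁_eq hp hs hc k hk hkr, sum_replicaWeight hp hs hc (hk.trans hkr) hkr]

lemma freeX₂_one (hp : B.p ≠ 0) (hs : B.s ≠ 0) (hc : c.Regular r) (k : ℕ) (hk : 1 ≤ k)
    (hkr : k ≤ r) (v : B.Field) : B.freeX₂ c k 1 v = 0 := by
  induction k, hk using Nat.le_induction generalizing v with
  | base =>
    simp only [freeX₂, freeH₂_one hs, freeH₁_one hs, tilt00_eq_sum, ← Finset.sum_mul, sum_weight00]
    ring
  | succ k hk ih =>
    obtain ⟨k, rfl⟩ := Nat.exists_eq_add_of_le' hk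
    change B.tiltX c (k + 2) _ v - c.m (k + 2) * B.freeX₁ c (k + 2) 1 v ^ 2 = 0
    simp only [ih (by omega), freeX₁_one hp hs hc (k + 1) hk (by omega),
      freeX₁_one hp hs hc (k + 2) (by omega) hkr, tiltX_const hp hs hc hkr]
    ring

lemma lvlQ_of_u4 (a : ℕ → ℝ) (k : ℕ) :
    B.lvlQ ⟨a, 0, 0, 0, 0⟩ k = Finsupp.single 1 (a k / 2) := by
  simp [lvlQ]

/-- Without curvature in the constant direction, a level contributes only its exponent times the
square of a constant first derivative. The constant is `s β` before the sum over `i₃` and `p s β`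
after it; this is the origin of `ω`. -/
lemma freeXDeriv_of_u4 (hp : B.p ≠ 0) (hs : B.s ≠ 0) (hc : c.Regular r) (a : ℕ → ℝ) (k : ℕ)
    (hk : 1 ≤ k) (hkr : k ≤ r) (v : B.Field) :
    B.freeXDeriv c (B.lvlQ ⟨a, 0, 0, 0, 0⟩) 0 k v =
      1 / 2 * (B.p * (B.s * B.β) ^ 2) * ∑ j ∈ Finset.Icc 1 k, a j * c.m j * omegaWeight j B.p := by
  induction k, hk using Nat.le_induction generalizing v with
  | base =>
    have e : B.freeHDeriv c (B.lvlQ ⟨a, 0, 0, 0, 0⟩) 0 = fun _ _ =>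
        a 1 / 2 * (c.m 1 * (B.s * B.β) ^ 2) := by
      funext i₃ v
      simp only [freeHDeriv, lvlQ_of_u4, quad_single, lnZ₂_one, lnZ₁_one, tilt1_const hs, zero_add,
        Pi.zero_apply, zero_mul, add_zero]
    simp only [freeXDeriv, e, tilt00_const, Pi.zero_apply, Finset.Icc_self, Finset.sum_singleton,
      omegaWeight, if_true]
    ring
  | succ k hk ih =>
    obtain ⟨k, rfl⟩ := Nat.exists_eq_add_of_le' hk
    simp only [freeXDeriv, ih (by omega), lvlQ_of_u4, quad_single,
      freeX₂_one hp hs hc (k + 1) hk (by omega), freeX₁_one hp hs hc (k + 1) hk (by omega),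
      tiltX_const hp hs hc hkr, Pi.zero_apply]
    rw [Finset.sum_Icc_succ_top (show 1 ≤ k + 1 + 1 by omega), omegaWeight_add_two]
    ring

/-- The variances of the `u^(4,k)` are switched on linearly, from none to their full size; along
this path the mean free energy has a constant derivative. -/
lemma Standing.meanFree_parOf {Λ : Lifting} {t : ℝ} (h : B.Standing r Λ t)
    (hΛ : Λ.Admissible r) :
    B.meanFree r (parOf Λ t) = B.meanFree r (parS Λ t) + t * B.correction r Λ := by
  set a : ℕ → ℝ := (parOf Λ t).u4 with ha
  set c : ℝ → Par := fun τ => { parOf Λ t with u4 := fun k => τ * a k } with hcdef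
  have c0 : c 0 = parS Λ t := by
    simp only [hcdef, parS, zero_mul]
    rfl
  have c1 : c 1 = parOf Λ t := by simp only [hcdef, one_mul, ha]
  have hcont : Continuous fun τ => B.meanFree r (c τ) := by
    refine continuous_iff_continuousAt.2 fun τ => tendsto_meanFree h.p_ne h.s_ne h.r_pos
      { u4 := fun k _ _ => ?_
        u2 := fun _ _ _ => tendsto_const_nhds
        h := fun _ _ _ => tendsto_const_nhds
        g := tendsto_const_nhds
        m := fun _ _ _ => tendsto_const_nhds
        ne := h.regular }
    exact (continuous_id.mul continuous_const).tendsto τ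
  have hvar := hΛ.var_nonneg h.mem
  have hder : ∀ τ ∈ Set.Ioo (0 : ℝ) 1, HasDerivAt (fun τ => B.meanFree r (c τ))
      (t * B.correction r Λ) τ := by
    intro τ hτ
    have hcurve : Par.HasDeriv c ⟨a, 0, 0, 0, 0⟩ τ r :=
      { u4 := fun k _ hk => ⟨by simpa using (hasDerivAt_id' τ).mul_const (a k),
          (lt_mem_nhds hτ.1).mono fun σ hσ => mul_nonneg hσ.le (hvar k hk).1⟩
        u2 := fun k _ hk => ⟨hasDerivAt_const τ ((parOf Λ t).u2 k), .of_forall fun _ =>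
          (hvar k hk).2.1⟩
        h := fun k _ hk => ⟨hasDerivAt_const τ ((parOf Λ t).h k), .of_forall fun _ =>
          (hvar k hk).2.2⟩
        g := ⟨hasDerivAt_const τ t, .of_forall fun _ => h.mem.1⟩
        m := fun k _ _ => hasDerivAt_const τ (Λ.m k)
        ne := h.regular }
    refine (hasDerivAt_meanFree_aux h.p_ne h.s_ne h.r_pos hcurve).congr_deriv ?_
    have hc : (c τ).Regular r := h.regular
    have hQ : B.matQ ⟨a, 0, 0, 0, 0⟩ = 0 := by simp [matQ]
    simp only [freeXDeriv_of_u4 h.p_ne h.s_ne hc a r h.r_pos le_rfl, hQ, zero_add, lvlQ_of_u4,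
      quad_single, freeX₂_one h.p_ne h.s_ne hc r h.r_pos le_rfl, mul_zero, add_zero, topMean_const]
    have hp := h.prefactor
    have e : ∑ j ∈ Finset.Icc 1 r, a j * (c τ).m j * omegaWeight j B.p =
        t * ∑ k ∈ Finset.Icc 1 (r + 1),
          (Λ.p (k - 1) * Λ.q (k - 1) - Λ.p k * Λ.q k) * Λ.m k * omegaWeight k B.p := by
      rw [Finset.sum_Icc_succ_top (by omega), hΛ.m_last, mul_zero, zero_mul, add_zero,
        Finset.mul_sum]
      refine Finset.sum_congr rfl fun j _ => ?_
      simp only [ha, parOf, hcdef]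
      ring
    rw [e, correction]
    linear_combination (1 / 2 * t * ∑ k ∈ Finset.Icc 1 (r + 1),
      (Λ.p (k - 1) * Λ.q (k - 1) - Λ.p k * Λ.q k) * Λ.m k * omegaWeight k B.p) * hp
  -- The derivative is needed only in the open interval, where the variances stay nonnegative on
  -- both sides; continuity takes care of the ends.
  obtain ⟨τ, hτ, h1⟩ := exists_hasDerivAt_eq_slope (fun τ => B.meanFree r (c τ)) _ zero_lt_one
    hcont.continuousOn hder
  rw [c0, c1] at h1
  linarith

/-- At `t = 1` the contribution of the `u^(4,k)` is the whole correction, which is what `ψ₁`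
subtracts. -/
lemma Standing.psiS_one {Λ : Lifting} (h : B.Standing r Λ 1) (hΛ : Λ.Admissible r) :
    B.psiS r Λ 1 = B.psi1 r Λ 1 := by
  have := h.meanFree_parOf hΛ
  rw [psiS_eq h.p_ne h.s_ne h.regular h.r_pos h.x_norm h.y_norm h.mem,
    h.psi1_eq_meanFree hΛ.p_last]
  linarith

lemma Standing.psiS_zero {Λ : Lifting} (h : B.Standing r Λ 0) (hΛ : Λ.Admissible r) :
    B.psiS r Λ 0 = B.psi r Λ 0 := by
  have := h.meanFree_parOf hΛ
  rw [psiS_eq h.p_ne h.s_ne h.regular h.r_pos h.x_norm h.y_norm h.mem,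
    psi_eq h.p_ne h.s_ne h.regular h.r_pos h.x_norm h.y_norm h.mem]
  linarith

end Blirp

open Interp

/-! ### Vanishing derivatives -/

namespace VanishesBoundedly

variable {a b : ℕ → ℝ → ℝ}

lemma of_le (hb : VanishesBoundedly b) (C : ℝ)
    (h : ∀ᶠ n in atTop, ∀ t ∈ Set.Ioo (0 : ℝ) 1, |a n t| ≤ C * |b n t|) :
    VanishesBoundedly a := by
  refine ⟨fun t ht => ?_, ?_⟩
  · have h1 : Tendsto (fun n => C * |b n t|) atTop (𝓝 0) := by
      simpa using (hb.1 t ht).abs.const_mul C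
    exact squeeze_zero_norm' (h.mono fun n hn => hn t ht) h1
  · obtain ⟨K, hK⟩ := hb.2
    refine ⟨|C| * K, ?_⟩
    filter_upwards [h, hK] with n h1 h2 t ht
    exact (h1 t ht).trans ((mul_le_mul_of_nonneg_right (le_abs_self C) (abs_nonneg _)).trans
      (mul_le_mul_of_nonneg_left (h2 t ht) (abs_nonneg C)))

lemma add (ha : VanishesBoundedly a) (hb : VanishesBoundedly b) :
    VanishesBoundedly fun n t => a n t + b n t := by
  refine ⟨fun t ht => by simpa using (ha.1 t ht).add (hb.1 t ht), ?_⟩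
  obtain ⟨K, hK⟩ := ha.2
  obtain ⟨L, hL⟩ := hb.2
  refine ⟨K + L, ?_⟩
  filter_upwards [hK, hL] with n h1 h2 t ht
  exact (abs_add_le _ _).trans (add_le_add (h1 t ht) (h2 t ht))

lemma const_mul (ha : VanishesBoundedly a) (c : ℝ) : VanishesBoundedly fun n t => c * a n t :=
  ha.of_le |c| (.of_forall fun _ _ _ => (abs_mul _ _).le)

lemma zero : VanishesBoundedly fun _ _ => 0 :=
  ⟨fun _ _ => tendsto_const_nhds, 0, by simp⟩

lemma sum {ι : Type*} (s : Finset ι) {a : ι → ℕ → ℝ → ℝ}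
    (h : ∀ i ∈ s, VanishesBoundedly (a i)) : VanishesBoundedly fun n t => ∑ i ∈ s, a i n t := by
  classical
  induction s using Finset.induction_on with
  | empty => simpa using zero
  | insert i s hi ih =>
    simp only [Finset.sum_insert hi]
    exact (h i (Finset.mem_insert_self i s)).add
      (ih fun j hj => h j (Finset.mem_insert_of_mem hj))

/-- The increment is the integral of the derivative, which tends to zero by dominated convergence
with a constant majorant; pointwise convergence with a uniform bound is thus enough. -/
lemma tendsto_sub {f : ℕ → ℝ → ℝ} (ha : VanishesBoundedly a)
    (hc : ∀ᶠ n in atTop, ContinuousOn (f n) (Set.Icc 0 1))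
    (hd : ∀ᶠ n in atTop, ∀ t ∈ Set.Ioo (0 : ℝ) 1, HasDerivAt (f n) (a n t) t) {t : ℝ}
    (ht : t ∈ Set.Icc (0 : ℝ) 1) : Tendsto (fun n => f n t - f n 0) atTop (𝓝 0) := by
  obtain ⟨K, hK⟩ := ha.2
  -- The half-open interval of integration may contain `1`, where nothing is known about the
  -- derivative.
  have hne : ∀ᵐ x : ℝ, x ≠ 1 := compl_mem_ae_iff.2 (measure_singleton 1)
  have hmem : ∀ x ∈ Set.uIoc 0 t, x ≠ 1 → x ∈ Set.Ioo (0 : ℝ) 1 := fun x hx h1 => by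
    rw [Set.uIoc_of_le ht.1] at hx
    exact ⟨hx.1, lt_of_le_of_ne (hx.2.trans ht.2) h1⟩
  have hderiv : ∀ᶠ n in atTop, ∀ x ∈ Set.Ioo (0 : ℝ) 1, deriv (f n) x = a n x :=
    hd.mono fun n hn x hx => (hn x hx).deriv
  have hbound : ∀ᶠ n in atTop, ∀ᵐ x, x ∈ Set.uIoc 0 t → ‖deriv (f n) x‖ ≤ K := by
    filter_upwards [hderiv, hK] with n h1 h2
    filter_upwards [hne] with x hx1 hx
    rw [h1 x (hmem x hx hx1)]
    exact h2 x (hmem x hx hx1)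
  -- The integrand is `deriv (f n)` and not `a n`, because the former is always measurable.
  have hlim : Tendsto (fun n => ∫ x in (0 : ℝ)..t, deriv (f n) x) atTop
      (𝓝 (∫ _ in (0 : ℝ)..t, (0 : ℝ))) := by
    refine intervalIntegral.tendsto_integral_filter_of_dominated_convergence (fun _ => K)
      (.of_forall fun n => (measurable_deriv (f n)).aestronglyMeasurable) hbound
      intervalIntegrable_const ?_
    filter_upwards [hne] with x hx1 hx
    refine (ha.1 x (hmem x hx hx1)).congr' ?_
    filter_upwards [hderiv] with n h1
    exact (h1 x (hmem x hx hx1)).symm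
  rw [intervalIntegral.integral_zero] at hlim
  refine hlim.congr' ?_
  filter_upwards [hc, hd, hbound] with n h1 h2 h3
  refine intervalIntegral.integral_eq_sub_of_hasDerivAt_of_le ht.1
    (h1.mono (Set.Icc_subset_Icc_right ht.2)) (fun x hx => ?_) ?_
  · have := h2 x ⟨hx.1, hx.2.trans_le ht.2⟩
    rwa [this.deriv]
  · refine (intervalIntegrable_const (c := K)).mono_fun
      (measurable_deriv (f n)).aestronglyMeasurable ?_
    rw [EventuallyLE, ae_restrict_iff' measurableSet_uIoc]
    filter_upwards [h3] with x hx hx1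
    exact (hx hx1).trans (le_abs_self K)

end VanishesBoundedly

/-! ### The frame -/

namespace Blirp

variable {n : ℕ} {B : Blirp n} {r : ℕ}

/-- No concentration is available at `p_0 = q_0 = 1`; each deviation is bounded by `2`, and
smallness must come from `1 - m_1`. -/
lemma Standing.abs_phi_one_le {Λ : Lifting} {t : ℝ} (h : B.Standing r Λ t)
    (hA : Λ.Admissible r) : |B.phi r Λ t 1| ≤ 4 * |B.s| * |1 - Λ.m 1| := by
  have h1 : |B.meanAvg r Λ t 1 (fun i₁ i₂ p₁ p₂ =>
      B.devX (Λ.p 0) i₁ p₁ * B.devY (Λ.q 0) i₂ p₂)| ≤ 4 := by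
    have hM := h.isAverage le_rfl (show 1 ≤ r + 1 by omega)
    refine (hM.abs_le (G := fun _ _ _ _ => 4) fun i₁ i₂ p₁ p₂ => ?_).trans (hM.const 4).le
    have hx : |B.devX (Λ.p 0) i₁ p₁| ≤ 2 := by
      have := abs_real_inner_le_norm (B.x p₁) (B.x i₁)
      rw [h.x_norm, h.x_norm, mul_one, abs_le] at this
      rw [devX, h.normX_eq, hA.p_zero, abs_le]
      constructor <;> linarith [this.1, this.2]
    have hy : |B.devY (Λ.q 0) i₂ p₂| ≤ 2 := by
      have := abs_real_inner_le_norm (B.y p₂) (B.y i₂)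
      rw [h.y_norm, h.y_norm, mul_one, abs_le] at this
      rw [devY, h.normY_eq, hA.q_zero, abs_le]
      constructor <;> linarith [this.1, this.2]
    rw [abs_mul]
    calc _ ≤ (2 : ℝ) * 2 := mul_le_mul hx hy (abs_nonneg _) zero_le_two
      _ = 4 := by norm_num
  rw [phi, Nat.sub_self, hA.m_zero, omegaWeight, if_pos rfl, mul_one, abs_mul, abs_mul, abs_neg]
  calc _ ≤ |B.s| * |1 - Λ.m 1| * 4 := by gcongr
    _ = _ := by ring

lemma IsAverage.abs_mul_le {M : (Fin B.l → Fin B.l → Fin B.l → Fin B.l → ℝ) → ℝ}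
    (h : B.IsAverage M) (F G : Fin B.l → Fin B.l → Fin B.l → Fin B.l → ℝ) :
    |M fun i₁ i₂ p₁ p₂ => F i₁ i₂ p₁ p₂ * G i₁ i₂ p₁ p₂| ≤
      1 / 2 * M fun i₁ i₂ p₁ p₂ => F i₁ i₂ p₁ p₂ ^ 2 + G i₁ i₂ p₁ p₂ ^ 2 := by
  rw [← h.const_mul]
  refine h.abs_le fun i₁ i₂ p₁ p₂ => ?_
  rw [_root_.abs_le]
  constructor <;>
    nlinarith [sq_nonneg (F i₁ i₂ p₁ p₂ + G i₁ i₂ p₁ p₂), sq_nonneg (F i₁ i₂ p₁ p₂ - G i₁ i₂ p₁ p₂)]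

lemma Standing.abs_phi_succ_le {Λ : Lifting} {t : ℝ} (h : B.Standing r Λ t) {k : ℕ} (hk : 1 ≤ k)
    (hkr : k ≤ r) :
    |B.β ^ 2 / √n * B.phi r Λ t (k + 1)| ≤ |B.s * B.p| / 2 * |B.spread r Λ t k| := by
  have hM := (h.isAverage (k := k + 1) (by omega) (by omega)).abs_mul_le
    (fun i₁ _ p₁ _ => B.devX (Λ.p k) i₁ p₁) (fun _ i₂ _ p₂ => B.devY (Λ.q k) i₂ p₂)
  rw [phi, omegaWeight_succ hk, Nat.add_sub_cancel, spread]
  set N := B.meanAvg r Λ t (k + 1) fun i₁ i₂ p₁ p₂ =>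
    B.devX (Λ.p k) i₁ p₁ ^ 2 + B.devY (Λ.q k) i₂ p₂ ^ 2
  have e : B.β ^ 2 / √n * (-B.s * (Λ.m k - Λ.m (k + 1)) * B.p * B.meanAvg r Λ t (k + 1)
      fun i₁ i₂ p₁ p₂ => B.devX (Λ.p k) i₁ p₁ * B.devY (Λ.q k) i₂ p₂) =
      -(B.s * B.p) * (B.β ^ 2 / √n * (Λ.m k - Λ.m (k + 1))) * B.meanAvg r Λ t (k + 1)
      fun i₁ i₂ p₁ p₂ => B.devX (Λ.p k) i₁ p₁ * B.devY (Λ.q k) i₂ p₂ := by ring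
  rw [e, abs_mul, abs_mul, abs_neg, abs_mul _ N, abs_mul _ |_|, abs_abs, ← abs_mul (_ / _)]
  calc _ ≤ |B.s * B.p| * |B.β ^ 2 / √n * (Λ.m k - Λ.m (k + 1))| * (1 / 2 * N) := by gcongr
    _ ≤ |B.s * B.p| * |B.β ^ 2 / √n * (Λ.m k - Λ.m (k + 1))| * (1 / 2 * |N|) := by
      gcongr; exact le_abs_self N
    _ = _ := by ring

lemma Standing.abs_phi22_le {Λ : Lifting} {t : ℝ} (h : B.Standing r Λ t) :
    |B.β ^ 2 / √n * B.phi22 r Λ t| ≤ |B.s| / 2 * |B.spread22 r Λ t| := by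
  have hM := h.isAverage22.abs_mul_le
    (fun i₁ _ p₁ _ => B.devX (Λ.p 1) i₁ p₁) (fun _ i₂ _ p₂ => B.devY (Λ.q 1) i₂ p₂)
  rw [phi22, spread22]
  set N := B.meanAvg22 r Λ t fun i₁ i₂ p₁ p₂ =>
    B.devX (Λ.p 1) i₁ p₁ ^ 2 + B.devY (Λ.q 1) i₂ p₂ ^ 2
  have e : B.β ^ 2 / √n * (-B.s * Λ.m 1 * (1 - B.p) * B.meanAvg22 r Λ t
      fun i₁ i₂ p₁ p₂ => B.devX (Λ.p 1) i₁ p₁ * B.devY (Λ.q 1) i₂ p₂) =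
      -B.s * (B.β ^ 2 / √n * (Λ.m 1 * (1 - B.p))) * B.meanAvg22 r Λ t
      fun i₁ i₂ p₁ p₂ => B.devX (Λ.p 1) i₁ p₁ * B.devY (Λ.q 1) i₂ p₂ := by ring
  rw [e, abs_mul, abs_mul, abs_neg, abs_mul _ N, abs_mul _ |_|, abs_abs, ← abs_mul (_ / _)]
  calc _ ≤ |B.s| * |B.β ^ 2 / √n * (Λ.m 1 * (1 - B.p))| * (1 / 2 * N) := by gcongr
    _ ≤ |B.s| * |B.β ^ 2 / √n * (Λ.m 1 * (1 - B.p))| * (1 / 2 * |N|) := by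
      gcongr; exact le_abs_self N
    _ = _ := by ring

lemma continuousOn_of_ends {f : ℕ → ℝ → ℝ} {s : Set ℝ} {r : ℕ} {a b : ℝ}
    (h : ∀ k, 1 ≤ k → k ≤ r → ContinuousOn (f k) s)
    (h0 : ∀ τ ∈ s, f 0 τ = a) (h1 : ∀ τ ∈ s, f (r + 1) τ = b) (k : ℕ) (hk : k ≤ r + 1) :
    ContinuousOn (f k) s := by
  rcases Nat.eq_zero_or_pos k with rfl | h2
  · exact continuousOn_const.congr h0
  rcases Nat.lt_or_ge k (r + 1) with h3 | h3
  · exact h k h2 (by omega)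
  · rw [show k = r + 1 by omega]
    exact continuousOn_const.congr h1

/-- Up to the explicit correction, `ψ₁` is the mean free energy, which depends continuously on the
variances and nonzero exponents. This includes the ends of the interval, where variances degenerate.
-/
lemma continuousOn_psi1 {Λ : ℝ → Lifting} {s : Set ℝ} (hS : ∀ τ ∈ s, B.Standing r (Λ τ) τ)
    (hA : ∀ τ ∈ s, (Λ τ).Admissible r)
    (hp : ∀ k, 1 ≤ k → k ≤ r → ContinuousOn (fun τ => (Λ τ).p k) s)
    (hq : ∀ k, 1 ≤ k → k ≤ r → ContinuousOn (fun τ => (Λ τ).q k) s)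
    (hm : ∀ k, 1 ≤ k → k ≤ r → ContinuousOn (fun τ => (Λ τ).m k) s) :
    ContinuousOn (fun τ => B.psi1 r (Λ τ) τ) s := by
  have cp : ∀ k ≤ r + 1, ContinuousOn (fun τ => (Λ τ).p k) s := continuousOn_of_ends
    (f := fun k τ => (Λ τ).p k) hp (fun τ hτ => (hA τ hτ).p_zero) fun τ hτ => (hA τ hτ).p_last
  have cq : ∀ k ≤ r + 1, ContinuousOn (fun τ => (Λ τ).q k) s := continuousOn_of_ends
    (f := fun k τ => (Λ τ).q k) hq (fun τ hτ => (hA τ hτ).q_zero) fun τ hτ => (hA τ hτ).q_last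
  have cm : ∀ k ≤ r + 1, ContinuousOn (fun τ => (Λ τ).m k) s := continuousOn_of_ends
    (f := fun k τ => (Λ τ).m k) hm (fun τ hτ => (hA τ hτ).m_zero) fun τ hτ => (hA τ hτ).m_last
  have cC : ContinuousOn (fun τ => B.correction r (Λ τ)) s := by
    refine ContinuousOn.mul continuousOn_const (continuousOn_finsetSum _ fun k hk => ?_)
    have := (Finset.mem_Icc.1 hk).2
    exact (((cp _ (by omega)).mul (cq _ (by omega))).sub ((cp k this).mul (cq k this))).mul
      (cm k this) |>.mul continuousOn_const
  have cF : ContinuousOn (fun τ => B.meanFree r (parOf (Λ τ) τ)) s := by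
    intro τ hτ
    have h := hS τ hτ
    have := h.nonempty
    have : (𝓝[s] τ).NeBot := mem_closure_iff_nhdsWithin_neBot.1 (subset_closure hτ)
    have ct : ContinuousOn (fun τ : ℝ => τ) s := continuousOn_id
    exact tendsto_meanFree h.p_ne h.s_ne h.r_pos
      { u4 := fun k _ hk => (ct.mul (((cp (k - 1) (by omega)).mul (cq (k - 1) (by omega))).sub
          ((cp k hk).mul (cq k hk)))) τ hτ
        u2 := fun k _ hk => ((continuousOn_const.sub ct).mul ((cp (k - 1) (by omega)).sub
          (cp k hk))) τ hτ
        h := fun k _ hk => ((continuousOn_const.sub ct).mul ((cq (k - 1) (by omega)).sub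
          (cq k hk))) τ hτ
        g := ct τ hτ
        m := fun k _ hk => cm k (by omega) τ hτ
        ne := h.regular }
  exact (cC.neg.add cF).congr fun τ hτ => (hS τ hτ).psi1_eq_meanFree (hA τ hτ).p_last

end Blirp

/-! ### Passage to the limit along the frame -/

namespace CompleteFrame

variable {r : ℕ} {p s : ℝ} {B : (n : ℕ) → Blirp n} {Λ : ℕ → ℝ → Lifting}

/-- The term `φ_1` is small by the limit of `m_1`. The others are averages of products of
deviations, bounded through the arithmetic-geometric mean inequality by the spread, unless they are
assumed to vanish directly. -/
lemma vanishes (hΛ : CompleteFrame r B Λ) (hr : 1 ≤ r) (hBp : ∀ n, (B n).p = p)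
    (hBs : ∀ n, (B n).s = s)
    (hS : ∀ n, 1 ≤ n → ∀ t ∈ Set.Icc (0 : ℝ) 1, (B n).Standing r (Λ n t) t) :
    VanishesBoundedly fun n t => (B n).pref / (B n).s * ((B n).phi r (Λ n t) t 1 +
      (B n).phi22 r (Λ n t) t + ∑ k ∈ Finset.Icc 1 r, (B n).phi r (Λ n t) t (k + 1)) := by
  have h1 : VanishesBoundedly fun n t => (B n).β ^ 2 / √n * (B n).phi r (Λ n t) t 1 := by
    refine hΛ.m_one_limit.of_le (4 * |s|) ?_
    filter_upwards [eventually_ge_atTop 1] with n hn t ht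
    have ht' := Set.Ioo_subset_Icc_self ht
    have := (hS n hn t ht').abs_phi_one_le (hΛ.admissible n hn t ht')
    rw [hBs] at this
    rw [abs_mul, abs_mul]
    calc _ ≤ |(B n).β ^ 2 / √n| * (4 * |s| * |1 - (Λ n t).m 1|) := by gcongr
      _ = _ := by ring
  have hsucc : ∀ k, 1 ≤ k → k ≤ r → VanishesBoundedly (fun n t => (B n).spread r (Λ n t) t k) →
      VanishesBoundedly fun n t => (B n).β ^ 2 / √n * (B n).phi r (Λ n t) t (k + 1) := by
    intro k hk hkr h
    refine h.of_le (|s * p| / 2) ?_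
    filter_upwards [eventually_ge_atTop 1] with n hn t ht
    have := (hS n hn t (Set.Ioo_subset_Icc_self ht)).abs_phi_succ_le hk hkr
    rwa [hBs, hBp] at this
  have h2 : VanishesBoundedly fun n t => (B n).β ^ 2 / √n *
      ((B n).phi r (Λ n t) t 2 + (B n).phi22 r (Λ n t) t) := by
    rcases hΛ.concentration_one with ⟨ha, hb⟩ | h
    · have hb' : VanishesBoundedly fun n t => (B n).β ^ 2 / √n * (B n).phi22 r (Λ n t) t := by
        refine hb.of_le (|s| / 2) ?_
        filter_upwards [eventually_ge_atTop 1] with n hn t ht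
        have := (hS n hn t (Set.Ioo_subset_Icc_self ht)).abs_phi22_le
        rwa [hBs] at this
      simpa only [mul_add] using (hsucc 1 le_rfl hr ha).add hb'
    · exact h
  have h3 : VanishesBoundedly fun n t => ∑ k ∈ Finset.Icc 2 r,
      (B n).β ^ 2 / √n * (B n).phi r (Λ n t) t (k + 1) := by
    refine VanishesBoundedly.sum _ fun k hk => ?_
    obtain ⟨hk2, hkr⟩ := Finset.mem_Icc.1 hk
    exact (hΛ.concentration_gt_one k hk2 hkr).elim (hsucc k (by omega) hkr) id
  refine (((h1.add h2).add h3).const_mul (Real.sign s / 2)).of_le 1 ?_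
  filter_upwards [eventually_ge_atTop 1] with n hn t ht
  have hs : (B n).s ≠ 0 := (hS n hn t (Set.Ioo_subset_Icc_self ht)).s_ne
  rw [one_mul]
  refine le_of_eq (congrArg _ ?_)
  have e : (B n).pref / (B n).s = Real.sign s / 2 * ((B n).β ^ 2 / √n) := by
    rw [Blirp.pref, hBs]
    rw [hBs] at hs
    field_simp
  -- The summand `k = 1` is kept with `φ_22`, since the alternative hypothesis at `k = 1` controls
  -- only their sum.
  have e2 : Finset.Icc 1 r = insert 1 (Finset.Icc 2 r) := by
    ext j; simp; omega
  rw [e, e2, Finset.sum_insert (by simp), ← Finset.mul_sum]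
  ring

lemma stationaryCurve (hΛ : CompleteFrame r B Λ)
    (hS : ∀ n, 1 ≤ n → ∀ t ∈ Set.Icc (0 : ℝ) 1, (B n).Standing r (Λ n t) t) {n : ℕ} (hn : 1 ≤ n)
    {t : ℝ} (ht : t ∈ Set.Ioo (0 : ℝ) 1) : (B n).StationaryCurve r (Λ n) t := by
  have hU : Set.Ioo (0 : ℝ) 1 ∈ 𝓝 t := Ioo_mem_nhds ht.1 ht.2
  exact
    { standing := mem_of_superset hU fun τ hτ => hS n hn τ (Set.Ioo_subset_Icc_self hτ)
      admissible := mem_of_superset hU fun τ hτ =>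
        hΛ.admissible n hn τ (Set.Ioo_subset_Icc_self hτ)
      p_diff := fun k h1 h2 => (hΛ.differentiable n hn k h1 h2).1.differentiableAt hU
      q_diff := fun k h1 h2 => (hΛ.differentiable n hn k h1 h2).2.1.differentiableAt hU
      m_diff := fun k h1 h2 => (hΛ.differentiable n hn k h1 h2).2.2.differentiableAt hU
      stationary := hΛ.stationary n hn t ht
      m_one := (hΛ.m_one n hn).imp (fun h => (Blirp.hasDerivAt_of_eventually_const
        (mem_of_superset hU fun τ hτ => h τ (Set.Ioo_subset_Icc_self hτ))).2) fun h => h t ht }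

lemma tendsto_psi1_sub (hΛ : CompleteFrame r B Λ) (hr : 1 ≤ r) (hBp : ∀ n, (B n).p = p)
    (hBs : ∀ n, (B n).s = s)
    (hS : ∀ n, 1 ≤ n → ∀ t ∈ Set.Icc (0 : ℝ) 1, (B n).Standing r (Λ n t) t) {t : ℝ}
    (ht : t ∈ Set.Icc (0 : ℝ) 1) :
    Tendsto (fun n => (B n).psi1 r (Λ n t) t - (B n).psi1 r (Λ n 0) 0) atTop (𝓝 0) := by
  refine (hΛ.vanishes hr hBp hBs hS).tendsto_sub (f := fun n t => (B n).psi1 r (Λ n t) t) ?_ ?_ ht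
  · filter_upwards [eventually_ge_atTop 1] with n hn
    exact Blirp.continuousOn_psi1 (hS n hn) (hΛ.admissible n hn)
      (fun k h1 h2 => (hΛ.continuous n hn k h1 h2).1)
      (fun k h1 h2 => (hΛ.continuous n hn k h1 h2).2.1)
      fun k h1 h2 => (hΛ.continuous n hn k h1 h2).2.2
  · filter_upwards [eventually_ge_atTop 1] with n hn t ht
    exact (hΛ.stationaryCurve hS hn ht).hasDerivAt_psi1

end CompleteFrame

lemma tendsto_iff_of_tendsto_sub {u v : ℕ → ℝ} (h : Tendsto (fun n => u n - v n) atTop (𝓝 0))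
    (L : ℝ) : Tendsto u atTop (𝓝 L) ↔ Tendsto v atTop (𝓝 L) := by
  refine ⟨fun hu => ?_, fun hv => ?_⟩
  · simpa using hu.sub h
  · simpa using h.add hv

theorem corollary6 (r : ℕ) (hr : 1 ≤ r) (p s : ℝ) (hp : 0 < p) (hs : s ≠ 0)
    (B : (n : ℕ) → Blirp n) (Λ : ℕ → ℝ → Lifting)
    (hBp : ∀ n, (B n).p = p) (hBs : ∀ n, (B n).s = s) (hBβ : ∀ n, 0 ≤ (B n).β)
    (hl : ∀ n, 1 ≤ n → 1 ≤ (B n).l)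
    (hx : ∀ n, 1 ≤ n → ∀ i, ‖(B n).x i‖ = 1)
    (hy : ∀ n, 1 ≤ n → ∀ i, ‖(B n).y i‖ = 1)
    (hΛ : CompleteFrame r B Λ) :
    -- the limit of `ψ₁` along the frame does not depend on `t`
    (∀ t ∈ Set.Icc (0 : ℝ) 1,
      Tendsto (fun n => (B n).psi1 r (Λ n t) t - (B n).psi1 r (Λ n 0) 0) atTop (𝓝 0) ∧
      ∀ L : ℝ,
        (Tendsto (fun n => (B n).psi1 r (Λ n t) t) atTop (𝓝 L) ↔
          Tendsto (fun n => (B n).psi1 r (Λ n 0) 0) atTop (𝓝 L)) ∧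
        (Tendsto (fun n => (B n).psi1 r (Λ n 0) 0) atTop (𝓝 L) ↔
          Tendsto (fun n => (B n).psi1 r (Λ n 1) 1) atTop (𝓝 L))) ∧
    -- the explicit form of `ψ₁` at the two ends
    (∀ n, 1 ≤ n →
      (B n).psi1 r (Λ n 0) 0 = -(B n).correction r (Λ n 0) + (B n).psi r (Λ n 0) 0 ∧
      (B n).psi1 r (Λ n 1) 1 = -(B n).correction r (Λ n 1) + (B n).psi r (Λ n 1) 1) ∧
    -- the limits of `ψ_S` at the two ends
    Tendsto (fun n => (B n).psiS r (Λ n 1) 1 -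
      (-(B n).correction r (Λ n 0) + (B n).psiS r (Λ n 0) 0)) atTop (𝓝 0) ∧
    (∀ K L : ℝ, Tendsto (fun n => (B n).correction r (Λ n 0)) atTop (𝓝 K) →
      Tendsto (fun n => (B n).psiS r (Λ n 0) 0) atTop (𝓝 L) →
      Tendsto (fun n => (B n).psiS r (Λ n 1) 1) atTop (𝓝 (-K + L))) := by
  have hS : ∀ n, 1 ≤ n → ∀ t ∈ Set.Icc (0 : ℝ) 1, (B n).Standing r (Λ n t) t := fun n hn t ht =>
    ⟨by rw [hBp]; exact hp.ne', by rw [hBs]; exact hs, hr, ⟨⟨0, hl n hn⟩⟩, hx n hn, hy n hn, ht,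
      (hΛ.admissible n hn t ht).m_ne⟩
  have m0 : (0 : ℝ) ∈ Set.Icc (0 : ℝ) 1 := ⟨le_rfl, zero_le_one⟩
  have m1 : (1 : ℝ) ∈ Set.Icc (0 : ℝ) 1 := ⟨zero_le_one, le_rfl⟩
  have hlim : ∀ t ∈ Set.Icc (0 : ℝ) 1,
      Tendsto (fun n => (B n).psi1 r (Λ n t) t - (B n).psi1 r (Λ n 0) 0) atTop (𝓝 0) := fun t ht =>
    hΛ.tendsto_psi1_sub hr hBp hBs hS ht
  have hSlim : Tendsto (fun n => (B n).psiS r (Λ n 1) 1 -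
      (-(B n).correction r (Λ n 0) + (B n).psiS r (Λ n 0) 0)) atTop (𝓝 0) := by
    -- The sequence is that of the first claim at `t = 1`, rewritten: `ψ_S` agrees with `ψ₁` at the
    -- right end and with `ψ` at the left one.
    refine (hlim 1 m1).congr' ?_
    filter_upwards [eventually_ge_atTop 1] with n hn
    have hA0 := hΛ.admissible n hn 0 m0
    have := (hS n hn 0 m0).nonempty
    rw [(hS n hn 1 m1).psiS_one (hΛ.admissible n hn 1 m1), (hS n hn 0 m0).psiS_zero hA0,
      (hS n hn 0 m0).psi1_eq hA0.p_last]
  refine ⟨fun t ht => ⟨hlim t ht, fun L => ⟨tendsto_iff_of_tendsto_sub (hlim t ht) L,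
    (tendsto_iff_of_tendsto_sub (hlim 1 m1) L).symm⟩⟩, fun n hn =>
    ⟨(hS n hn 0 m0).psi1_eq (hΛ.admissible n hn 0 m0).p_last,
      (hS n hn 1 m1).psi1_eq (hΛ.admissible n hn 1 m1).p_last⟩, hSlim, fun K L hK hL => ?_⟩
  exact (tendsto_iff_of_tendsto_sub hSlim _).2 (hK.neg.add hL)
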